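/- Let $q\in\mathbb C^\times$ and $d=q+q^{-1}$. Let $\mathcal K_d$ be the Temperley–Lieb category: its objects are the integers $n\ge 0$, with $n$ also written $X^{\otimes n}$; $\mathrm{Hom}(X^{\otimes n},X^{\otimes m})$ is the complex vector space with basis the Kauffman diagrams (isotopy classes of non-crossing planar pairings of $n$ lower and $m$ upper points of a rectangle); composition is concatenation of diagrams with every closed loop replaced by the factor $d$; and the tensor product is horizontal juxtaposition. Let $\widetilde{\mathcal K}_d$ be its idempotent completion, whose objects are the pairs $pA=(p,A)$ with $p=p^2\in\mathrm{End}(A)$, with $pA\otimes qB=(p\otimes q)(A\otimes B)$. Assume that $q^2$ is not a proper root of unity, i.e. if $(q^2)^n=1$ for some $n\ge 1$, then $q^2=1$. Then the following hold. 1. $\mathcal K_d$ is essentially semisimple: its hom-spaces are finite-dimensional, and for every finite family $A_1,\dots,A_m$ of objects the algebra $\mathrm{End}(A_1\oplus\dots\oplus A_m)$ of matrices with $(i,j)$ entry in $\mathrm{Hom}(A_j,A_i)$ is semisimple. 2. Put $[n]_q=q^{n-1}+q^{n-3}+\dots+q^{1-n}$, let $h_k\in \mathrm{End}(X^{\otimes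 (k+1)})$ be the elementary diagram with $k-1$ vertical lines followed by a cap joining the last two lower points and a cup joining the last two upper points, and define $f_0=1$, $f_1=1_X$ and $$f_{k+1}=f_k\otimes 1_X-\frac{[k]_q}{[k+1]_q}\,(f_k\otimes 1_X)\,h_k\,(f_k\otimes 1_X)\qquad(k\ge 1).$$ Then every $f_k$ is an idempotent, and the objects $X_k=f_kX^{\otimes k}$ ($k\ge 0$) of $\widetilde{\mathcal K}_d$ form a complete set of representatives of the simple objects: each $X_k$ is non-zero, $\mathrm{Hom}(X_j,X_k)=\delta_{jk}\,\mathbb C\,1_{X_k}$, and every object of $\widetilde{\mathcal K}_d$ is isomorphic to a finite direct sum (possibly empty, possibly with repetitions) of objects $X_k$. 3. The fusion rule is the Clebsch–Gordan rule: for all $j,k\ge 0$, $$X_j\otimes X_k\cong X_{|j-k|}\oplus X_{|j-k|+2}\oplus\dots\oplus X_{j+k}.$$ -/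

import Mathlib

open CategoryTheory

namespace TemperleyLieb

/-! ### Gluing of equivalence relations -/

section Gluing

variable {α β γ δ X Y Z : Type*}

/-- The number of equivalence classes of `S` that do not meet the range of `f`. -/
noncomputable def unhit (S : Setoid X) (f : Y → X) : ℕ :=
  Nat.card {c : Quotient S // ∀ y, Quotient.mk S (f y) ≠ c}

/-- The equivalence relation on `α ⊔ β ⊔ γ` generated by one on `α ⊔ β` and one on `β ⊔ γ`. -/
def glue (S : Setoid (α ⊕ β)) (T : Setoid (β ⊕ γ)) : Setoid (α ⊕ β ⊕ γ) :=
  S.map (Sum.map id Sum.inl) ⊔ T.map Sum.inr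

/-- The inclusion of the outer boundary points. -/
def outer : α ⊕ γ → α ⊕ β ⊕ γ := Sum.map id Sum.inr

/-- Two boundary points are related iff they are connected after gluing. -/
def compRel (S : Setoid (α ⊕ β)) (T : Setoid (β ⊕ γ)) : Setoid (α ⊕ γ) :=
  (glue S T).comap outer

/-- The number of components of the glued picture without boundary points (the closed loops). -/
noncomputable def loops (S : Setoid (α ⊕ β)) (T : Setoid (β ⊕ γ)) : ℕ :=
  unhit (glue S T) (outer : α ⊕ γ → α ⊕ β ⊕ γ)

theorem map_le_iff {S : Setoid X} {T : Setoid Y} {f : X → Y} :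
    S.map f ≤ T ↔ ∀ x y, S x y → T (f x) (f y) := by
  constructor
  · intro h x y hxy
    exact h (Relation.EqvGen.rel _ _ ⟨x, y, hxy, rfl, rfl⟩)
  · intro h
    apply Setoid.eqvGen_le
    rintro _ _ ⟨x, y, hxy, rfl, rfl⟩
    exact h x y hxy

theorem map_apply {S : Setoid X} (f : X → Y) {x y : X} (h : S x y) : S.map f (f x) (f y) :=
  Relation.EqvGen.rel _ _ ⟨x, y, h, rfl, rfl⟩

theorem map_map (S : Setoid X) (f : X → Y) (g : Y → Z) : (S.map f).map g = S.map (g ∘ f) := by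
  apply le_antisymm
  · rw [map_le_iff]
    have : S.map f ≤ (S.map (g ∘ f)).comap g := by
      rw [map_le_iff]
      intro x y h
      exact map_apply (g ∘ f) h
    intro x y h
    exact this h
  · rw [map_le_iff]
    intro x y h
    exact map_apply g (map_apply f h)

theorem map_sup (S T : Setoid X) (f : X → Y) : (S ⊔ T).map f = S.map f ⊔ T.map f := by
  apply le_antisymm
  · rw [map_le_iff]
    have : S ⊔ T ≤ (S.map f ⊔ T.map f).comap f := by
      apply sup_le
      · intro x y h
        exact (le_sup_left : S.map f ≤ S.map f ⊔ T.map f) (map_apply f h)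
      · intro x y h
        exact (le_sup_right : T.map f ≤ S.map f ⊔ T.map f) (map_apply f h)
    intro x y h
    exact this h
  · apply sup_le
    · rw [map_le_iff]
      intro x y h
      exact map_apply f ((le_sup_left : S ≤ S ⊔ T) h)
    · rw [map_le_iff]
      intro x y h
      exact map_apply f ((le_sup_right : T ≤ S ⊔ T) h)

theorem map_iff {S : Setoid X} {f : X → Y} (hf : Function.Injective f) {x y : Y} :
    S.map f x y ↔ x = y ∨ ∃ u v, S u v ∧ f u = x ∧ f v = y := by
  constructor
  · intro h
    let R : Setoid Y :=
      { r := fun x y => x = y ∨ ∃ u v, S u v ∧ f u = x ∧ f v = y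
        iseqv := by
          refine ⟨fun x => Or.inl rfl, ?_, ?_⟩
          · rintro x y (h | ⟨u, v, h, hu, hv⟩)
            · exact Or.inl h.symm
            · exact Or.inr ⟨v, u, S.symm' h, hv, hu⟩
          · rintro x y z (h | ⟨u, v, h, hu, hv⟩) h2
            · rw [h]; exact h2
            · rcases h2 with h2 | ⟨u', v', h2, hu', hv'⟩
              · rw [← h2]; exact Or.inr ⟨u, v, h, hu, hv⟩
              · have : v = u' := hf (hv.trans hu'.symm)
                subst this
                exact Or.inr ⟨u, v', S.trans' h h2, hu, hv'⟩ }
    have : S.map f ≤ R := by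
      rw [map_le_iff]
      intro x y h
      exact Or.inr ⟨x, y, h, rfl, rfl⟩
    exact this h
  · rintro (rfl | ⟨u, v, h, rfl, rfl⟩)
    · exact Setoid.refl' _ _
    · exact map_apply f h

theorem sup_map_iff (S : Setoid X) (T : Setoid Y) (f : Y → X) {x y : X} :
    (S ⊔ T.map f) x y ↔
      S x y ∨ ∃ u v, S x (f u) ∧ (S.comap f ⊔ T) u v ∧ S (f v) y := by
  constructor
  · intro h
    let R : Setoid X :=
      { r := fun x y => S x y ∨ ∃ u v, S x (f u) ∧ (S.comap f ⊔ T) u v ∧ S (f v) y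
        iseqv := by
          refine ⟨fun x => Or.inl (S.refl' x), ?_, ?_⟩
          · rintro x y (h | ⟨u, v, h1, h2, h3⟩)
            · exact Or.inl (S.symm' h)
            · exact Or.inr ⟨v, u, S.symm' h3, Setoid.symm' _ h2, S.symm' h1⟩
          · rintro x y z (h | ⟨u, v, h1, h2, h3⟩) (h' | ⟨u', v', h1', h2', h3'⟩)
            · exact Or.inl (S.trans' h h')
            · exact Or.inr ⟨u', v', S.trans' h h1', h2', h3'⟩
            · exact Or.inr ⟨u, v, h1, h2, S.trans' h3 h'⟩
            · refine Or.inr ⟨u, v', h1, ?_, h3'⟩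
              refine Setoid.trans' _ (Setoid.trans' _ h2 ?_) h2'
              exact (le_sup_left : S.comap f ≤ S.comap f ⊔ T) (S.trans' h3 h1') }
    have : S ⊔ T.map f ≤ R := by
      apply sup_le
      · intro x y h
        exact Or.inl h
      · rw [map_le_iff]
        intro u v h
        exact Or.inr ⟨u, v, S.refl' _, (le_sup_right : T ≤ S.comap f ⊔ T) h, S.refl' _⟩
    exact this h
  · have hS : S ≤ S ⊔ T.map f := le_sup_left
    have hc : S.comap f ⊔ T ≤ (S ⊔ T.map f).comap f := by
      apply sup_le
      · intro x y h
        exact hS h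
      · intro x y h
        exact (le_sup_right : T.map f ≤ S ⊔ T.map f) (map_apply f h)
    rintro (h | ⟨u, v, h1, h2, h3⟩)
    · exact hS h
    · exact Setoid.trans' _ (hS h1) (Setoid.trans' _ (hc h2) (hS h3))

theorem comap_sup_map (S : Setoid X) (T : Setoid Y) (f : Y → X) :
    (S ⊔ T.map f).comap f = S.comap f ⊔ T := by
  ext x y
  rw [Setoid.comap_rel, sup_map_iff]
  have hS : S.comap f ≤ S.comap f ⊔ T := le_sup_left
  constructor
  · rintro (h | ⟨u, v, h1, h2, h3⟩)
    · exact hS h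
    · exact Setoid.trans' _ (hS h1) (Setoid.trans' _ h2 (hS h3))
  · intro h
    exact Or.inr ⟨x, y, S.refl' _, h, S.refl' _⟩

theorem unhit_sup_map (S : Setoid X) (T : Setoid Y) (f : Y → X) :
    unhit (S ⊔ T.map f) f = unhit S f := by
  symm
  have hS : S ≤ S ⊔ T.map f := le_sup_left
  let φ : {c : Quotient S // ∀ y, Quotient.mk S (f y) ≠ c} →
      {c : Quotient (S ⊔ T.map f) // ∀ y, Quotient.mk (S ⊔ T.map f) (f y) ≠ c} := fun c =>
    ⟨Setoid.map_of_le hS c.1, by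
      obtain ⟨c, hc⟩ := c
      induction c using Quotient.inductionOn with
      | h x =>
        intro y hy
        rcases (sup_map_iff S T f).1 (Quotient.exact hy) with h | ⟨u, v, h1, h2, h3⟩
        · exact hc y (Quotient.sound h)
        · exact hc v (Quotient.sound h3)⟩
  refine Nat.card_eq_of_bijective φ ⟨?_, ?_⟩
  · rintro ⟨c, hc⟩ ⟨c', hc'⟩ h
    induction c using Quotient.inductionOn with
    | h x =>
      induction c' using Quotient.inductionOn with
      | h y =>
        have h' := congrArg Subtype.val h
        rcases (sup_map_iff S T f).1 (Quotient.exact h') with h | ⟨u, v, h1, h2, h3⟩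
        · exact Subtype.ext (Quotient.sound h)
        · exact absurd (Quotient.sound h3) (hc' v)
  · rintro ⟨c, hc⟩
    induction c using Quotient.inductionOn with
    | h x => exact ⟨⟨Quotient.mk S x, fun y h => hc y (Quotient.sound (hS (Quotient.exact h)))⟩, rfl⟩

theorem unhit_comp [Finite X] (S : Setoid X) (f : Y → X) (g : Z → Y) :
    unhit S (f ∘ g) = unhit S f + unhit (S.comap f) g := by
  classical
  let A := {c : Quotient S // ∀ z, Quotient.mk S ((f ∘ g) z) ≠ c}
  let p : A → Prop := fun c => ∀ y, Quotient.mk S (f y) ≠ c.1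
  have hcard : unhit S (f ∘ g) = Nat.card {c : A // p c} + Nat.card {c : A // ¬ p c} := by
    rw [← Nat.card_sum]
    exact (Nat.card_congr (Equiv.sumCompl p)).symm
  rw [hcard]
  congr 1
  · refine Nat.card_eq_of_bijective
      (fun c => (⟨c.1.1, c.2⟩ : {c : Quotient S // ∀ y, Quotient.mk S (f y) ≠ c})) ⟨?_, ?_⟩
    · rintro ⟨⟨c, hc⟩, hc1⟩ ⟨⟨c', hc'⟩, hc1'⟩ h
      have : c = c' := congrArg Subtype.val h
      subst this
      rfl
    · rintro ⟨c, hc⟩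
      exact ⟨⟨⟨c, fun z => hc (g z)⟩, hc⟩, rfl⟩
  · symm
    let φ : {c : Quotient (S.comap f) // ∀ z, Quotient.mk (S.comap f) (g z) ≠ c} →
        {c : A // ¬ p c} := fun c =>
      ⟨⟨Quotient.map' (s₁ := S.comap f) (s₂ := S) f (fun _ _ h => h) c.1, by
          obtain ⟨c, hc⟩ := c
          induction c using Quotient.inductionOn with
          | h y =>
            intro z hz
            have h0 : S (f (g z)) (f y) := Quotient.exact hz
            exact hc z (Quotient.sound (s := S.comap f) h0)⟩, by
          obtain ⟨c, hc⟩ := c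
          induction c using Quotient.inductionOn with
          | h y => exact fun h => h y rfl⟩
    refine Nat.card_eq_of_bijective φ ⟨?_, ?_⟩
    · rintro ⟨c, hc⟩ ⟨c', hc'⟩ h
      induction c using Quotient.inductionOn with
      | h x =>
        induction c' using Quotient.inductionOn with
        | h y =>
          have h' : Quotient.mk S (f x) = Quotient.mk S (f y) :=
            congrArg (fun c => c.1.1) h
          exact Subtype.ext (Quotient.sound (show S (f x) (f y) from Quotient.exact h'))
    · rintro ⟨⟨c, hc⟩, hp⟩
      simp only [p, not_forall, not_not] at hp
      obtain ⟨y, hy⟩ := hp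
      refine ⟨⟨Quotient.mk _ y, fun z hz => hc z ?_⟩, ?_⟩
      · rw [← hy]
        have h0 : (S.comap f) (g z) y := Quotient.exact hz
        exact Quotient.sound (s := S) h0
      · exact Subtype.ext (Subtype.ext hy)

theorem comap_map_pullback (S : Setoid X) {h : X → Z} {f : Y → Z} {k : α → X} {g : α → Y}
    (hh : Function.Injective h) (hf : Function.Injective f) (hc : ∀ a, h (k a) = f (g a))
    (hp : ∀ x y, h x = f y → ∃ a, k a = x ∧ g a = y) :
    (S.map h).comap f = (S.comap k).map g := by
  apply le_antisymm
  · intro x y hxy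
    rcases (map_iff hh).1 hxy with e | ⟨u, v, huv, hu, hv⟩
    · rw [hf e]
    · obtain ⟨a, rfl, rfl⟩ := hp u x hu
      obtain ⟨b, rfl, rfl⟩ := hp v y hv
      exact map_apply g huv
  · rw [map_le_iff]
    intro a b hab
    rw [Setoid.comap_rel, ← hc, ← hc]
    exact map_apply h hab

theorem unhit_map_pullback (S : Setoid X) {h : X → Z} {f : Y → Z} {k : α → X} {g : α → Y}
    (hh : Function.Injective h) (hc : ∀ a, h (k a) = f (g a))
    (hp : ∀ x y, h x = f y → ∃ a, k a = x ∧ g a = y)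
    (hs : ∀ z, (∃ x, h x = z) ∨ ∃ y, f y = z) :
    unhit (S.map h) f = unhit S k := by
  symm
  let φ : {c : Quotient S // ∀ y, Quotient.mk S (k y) ≠ c} →
      {c : Quotient (S.map h) // ∀ y, Quotient.mk (S.map h) (f y) ≠ c} := fun c =>
    ⟨Quotient.map' (s₁ := S) (s₂ := S.map h) h (fun _ _ e => map_apply h e) c.1, by
      obtain ⟨c, hc'⟩ := c
      induction c using Quotient.inductionOn with
      | h x =>
        intro y hy
        rcases (map_iff hh).1 (Quotient.exact hy) with e | ⟨u, v, huv, hu, hv⟩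
        · obtain ⟨a, rfl, rfl⟩ := hp x y e.symm
          exact hc' a rfl
        · obtain ⟨a, rfl, rfl⟩ := hp u y hu
          have := hh hv
          subst this
          exact hc' a (Quotient.sound huv)⟩
  refine Nat.card_eq_of_bijective φ ⟨?_, ?_⟩
  · rintro ⟨c, hc⟩ ⟨c', hc'⟩ e
    induction c using Quotient.inductionOn with
    | h x =>
      induction c' using Quotient.inductionOn with
      | h y =>
        have e' : Quotient.mk (S.map h) (h x) = Quotient.mk (S.map h) (h y) :=
          congrArg Subtype.val e
        rcases (map_iff hh).1 (Quotient.exact e') with e | ⟨u, v, huv, hu, hv⟩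
        · have := hh e
          subst this
          rfl
        · have h1 := hh hu
          have h2 := hh hv
          subst h1 h2
          exact Subtype.ext (Quotient.sound huv)
  · rintro ⟨c, hc'⟩
    induction c using Quotient.inductionOn with
    | h z =>
      rcases hs z with ⟨x, rfl⟩ | ⟨y, rfl⟩
      · refine ⟨⟨Quotient.mk _ x, fun a ha => hc' (g a) ?_⟩, rfl⟩
        rw [← hc]
        exact Quotient.sound (map_apply h (Quotient.exact ha))
      · exact absurd rfl (hc' y)

section Assoc

variable (S : Setoid (α ⊕ β)) (T : Setoid (β ⊕ γ)) (U : Setoid (γ ⊕ δ))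

/-- Three relations glued along two middle sets. -/
def glue₃ : Setoid (α ⊕ β ⊕ γ ⊕ δ) :=
  S.map (Sum.map id Sum.inl) ⊔ T.map (Sum.inr ∘ Sum.map id Sum.inl) ⊔ U.map (Sum.inr ∘ Sum.inr)

theorem glue₃_eq_left : glue₃ S T U =
    (glue S T).map (Sum.map id (Sum.map id Sum.inl)) ⊔
      (U.map (Sum.inr : _ → α ⊕ γ ⊕ δ)).map (Sum.map id Sum.inr) := by
  unfold glue glue₃
  rw [map_sup, map_map, map_map, map_map]
  congr 2
  congr 1
  funext x
  rcases x with x | x <;> rfl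

theorem glue₃_eq_right : glue₃ S T U =
    (glue T U).map Sum.inr ⊔
      (S.map (Sum.map id Sum.inl : _ → α ⊕ β ⊕ δ)).map (Sum.map id (Sum.map id Sum.inr)) := by
  unfold glue glue₃
  rw [map_sup, map_map, map_map, map_map, sup_assoc, sup_comm]
  congr 2
  funext x
  rcases x with x | x <;> rfl

theorem comap_left : ((glue S T).map (Sum.map id (Sum.map id Sum.inl))).comap
      (Sum.map id Sum.inr : α ⊕ γ ⊕ δ → α ⊕ β ⊕ γ ⊕ δ) =
    (compRel S T).map (Sum.map id Sum.inl) := by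
  apply comap_map_pullback
  · intro x y; rcases x with x | x | x <;> rcases y with y | y | y <;> simp
  · intro x y; rcases x with x | x | x <;> rcases y with y | y | y <;> simp
  · intro a; rcases a with a | a <;> rfl
  · intro x y
    rcases x with x | x | x <;> rcases y with y | y | y <;> simp [outer]

theorem unhit_left : unhit ((glue S T).map (Sum.map id (Sum.map id Sum.inl)))
      (Sum.map id Sum.inr : α ⊕ γ ⊕ δ → α ⊕ β ⊕ γ ⊕ δ) = loops S T := by
  apply unhit_map_pullback (g := Sum.map id Sum.inl)
  · intro x y; rcases x with x | x | x <;> rcases y with y | y | y <;> simp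
  · intro a; rcases a with a | a <;> rfl
  · intro x y
    rcases x with x | x | x <;> rcases y with y | y | y <;> simp [outer]
  · intro z
    rcases z with z | z | z | z <;> simp

theorem comap_right : ((glue T U).map Sum.inr).comap
      (Sum.map id (Sum.map id Sum.inr) : α ⊕ β ⊕ δ → α ⊕ β ⊕ γ ⊕ δ) =
    (compRel T U).map Sum.inr := by
  apply comap_map_pullback
  · intro x y; rcases x with x | x | x <;> rcases y with y | y | y <;> simp
  · intro x y; rcases x with x | x | x <;> rcases y with y | y | y <;> simp
  · intro a; rcases a with a | a <;> rfl
  · intro x y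
    rcases x with x | x | x <;> rcases y with y | y | y <;> simp [outer, eq_comm]

theorem unhit_right : unhit ((glue T U).map Sum.inr)
      (Sum.map id (Sum.map id Sum.inr) : α ⊕ β ⊕ δ → α ⊕ β ⊕ γ ⊕ δ) = loops T U := by
  apply unhit_map_pullback (g := Sum.inr)
  · intro x y; rcases x with x | x | x <;> rcases y with y | y | y <;> simp
  · intro a; rcases a with a | a <;> rfl
  · intro x y
    rcases x with x | x | x <;> rcases y with y | y | y <;> simp [outer, eq_comm]
  · intro z
    rcases z with z | z | z | z <;> simp

theorem comap_glue₃_left :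
    (glue₃ S T U).comap (Sum.map id Sum.inr) = glue (compRel S T) U := by
  rw [glue₃_eq_left, comap_sup_map, comap_left]
  rfl

theorem comap_glue₃_right :
    (glue₃ S T U).comap (Sum.map id (Sum.map id Sum.inr)) = glue S (compRel T U) := by
  rw [glue₃_eq_right, comap_sup_map, comap_right, sup_comm]
  rfl

theorem outer_left : (Sum.map id Sum.inr : α ⊕ γ ⊕ δ → α ⊕ β ⊕ γ ⊕ δ) ∘ outer =
    Sum.map id (Sum.inr ∘ Sum.inr) := by
  funext x; rcases x with x | x <;> rfl

theorem outer_right : (Sum.map id (Sum.map id Sum.inr) : α ⊕ β ⊕ δ → α ⊕ β ⊕ γ ⊕ δ) ∘ outer =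
    Sum.map id (Sum.inr ∘ Sum.inr) := by
  funext x; rcases x with x | x <;> rfl

theorem compRel_assoc : compRel (compRel S T) U = compRel S (compRel T U) := by
  have h1 : compRel (compRel S T) U = (glue (compRel S T) U).comap outer := rfl
  have h2 : compRel S (compRel T U) = (glue S (compRel T U)).comap outer := rfl
  rw [h1, h2, ← comap_glue₃_left, ← comap_glue₃_right]
  have h3 := Setoid.comap_comp (glue₃ S T U) (Sum.map id Sum.inr : α ⊕ γ ⊕ δ → _) outer
  have h4 := Setoid.comap_comp (glue₃ S T U)
    (Sum.map id (Sum.map id Sum.inr) : α ⊕ β ⊕ δ → _) outer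
  rw [← h3, ← h4, outer_left, outer_right]

theorem loops_assoc [Finite α] [Finite β] [Finite γ] [Finite δ] :
    loops S T + loops (compRel S T) U = loops T U + loops S (compRel T U) := by
  have h1 := unhit_comp (glue₃ S T U) (Sum.map id Sum.inr : α ⊕ γ ⊕ δ → _) outer
  have h2 := unhit_comp (glue₃ S T U)
    (Sum.map id (Sum.map id Sum.inr) : α ⊕ β ⊕ δ → _) outer
  rw [outer_left, comap_glue₃_left, glue₃_eq_left, unhit_sup_map, unhit_left] at h1
  rw [outer_right, comap_glue₃_right, glue₃_eq_right, unhit_sup_map, unhit_right,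
    ← glue₃_eq_right, glue₃_eq_left] at h2
  exact h1.symm.trans h2

end Assoc

section Identity

/-- The relation joining each lower point to the upper point above it. -/
def idRel : Setoid (α ⊕ α) := Setoid.ker (Sum.elim id id)

theorem glue_idRel_left (S : Setoid (α ⊕ β)) :
    glue idRel S = S.comap (Sum.elim Sum.inl id) := by
  apply le_antisymm
  · apply sup_le
    · rw [map_le_iff]
      intro x y h
      have h' : (Sum.elim id id x : α) = Sum.elim id id y := h
      rcases x with x | x <;> rcases y with y | y <;> simp at h' <;> subst h' <;>
        exact S.refl' _
    · rw [map_le_iff]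
      intro x y h
      exact h
  · have key : ∀ x : α ⊕ α ⊕ β, glue idRel S x (Sum.inr (Sum.elim Sum.inl id x)) := by
      intro x
      rcases x with x | x
      · exact (le_sup_left : _ ≤ glue idRel S)
          (map_apply (Sum.map id Sum.inl) (show idRel (Sum.inl x) (Sum.inr x) from rfl))
      · exact Setoid.refl' _ _
    intro x y h
    exact Setoid.trans' _ (key x) (Setoid.trans' _
      ((le_sup_right : _ ≤ glue idRel S) (map_apply Sum.inr h)) (Setoid.symm' _ (key y)))

theorem glue_idRel_right (S : Setoid (α ⊕ β)) :
    glue S idRel = S.comap (Sum.elim Sum.inl (Sum.elim Sum.inr Sum.inr)) := by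
  apply le_antisymm
  · apply sup_le
    · rw [map_le_iff]
      intro x y h
      rcases x with x | x <;> rcases y with y | y <;> exact h
    · rw [map_le_iff]
      intro x y h
      have h' : (Sum.elim id id x : β) = Sum.elim id id y := h
      rcases x with x | x <;> rcases y with y | y <;> simp at h' <;> subst h' <;>
        exact S.refl' _
  · have key : ∀ x : α ⊕ β ⊕ β, glue S idRel x
        (Sum.map id Sum.inl (Sum.elim Sum.inl (Sum.elim Sum.inr Sum.inr) x : α ⊕ β)) := by
      intro x
      rcases x with x | x | x
      · exact Setoid.refl' _ _
      · exact Setoid.refl' _ _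
      · exact (le_sup_right : _ ≤ glue S idRel)
          (map_apply Sum.inr (show idRel (Sum.inr x) (Sum.inl x) from rfl))
    intro x y h
    exact Setoid.trans' _ (key x) (Setoid.trans' _
      ((le_sup_left : _ ≤ glue S idRel) (map_apply (Sum.map id Sum.inl) h))
      (Setoid.symm' _ (key y)))

theorem compRel_idRel_left (S : Setoid (α ⊕ β)) : compRel idRel S = S := by
  unfold compRel
  rw [glue_idRel_left]
  ext x y
  rcases x with x | x <;> rcases y with y | y <;> rfl

theorem compRel_idRel_right (S : Setoid (α ⊕ β)) : compRel S idRel = S := by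
  unfold compRel
  rw [glue_idRel_right]
  ext x y
  rcases x with x | x <;> rcases y with y | y <;> rfl

theorem unhit_eq_zero {S : Setoid X} {f : Y → X} (h : ∀ x, ∃ y, S (f y) x) : unhit S f = 0 := by
  have : IsEmpty {c : Quotient S // ∀ y, Quotient.mk S (f y) ≠ c} := by
    constructor
    rintro ⟨c, hc⟩
    induction c using Quotient.inductionOn with
    | h x =>
      obtain ⟨y, hy⟩ := h x
      exact hc y (Quotient.sound hy)
  exact Nat.card_of_isEmpty

theorem loops_idRel_left (S : Setoid (α ⊕ β)) : loops idRel S = 0 := by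
  unfold loops
  apply unhit_eq_zero
  rw [glue_idRel_left]
  rintro (x | x | x)
  · exact ⟨Sum.inl x, S.refl' _⟩
  · exact ⟨Sum.inl x, S.refl' _⟩
  · exact ⟨Sum.inr x, S.refl' _⟩

theorem loops_idRel_right (S : Setoid (α ⊕ β)) : loops S idRel = 0 := by
  unfold loops
  apply unhit_eq_zero
  rw [glue_idRel_right]
  rintro (x | x | x)
  · exact ⟨Sum.inl x, S.refl' _⟩
  · exact ⟨Sum.inr x, S.refl' _⟩
  · exact ⟨Sum.inr x, S.refl' _⟩

end Identity

section Juxtaposition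

variable {X' Y' : Type*}

/-- The relation generated by two relations living on two disjoint pieces of `Z`. -/
theorem sup_map_disjoint_iff (S : Setoid X) (T : Setoid Y) {i : X → Z} {j : Y → Z}
    (hi : Function.Injective i) (hj : Function.Injective j) (hd : ∀ x y, i x ≠ j y)
    {z w : Z} :
    (S.map i ⊔ T.map j) z w ↔
      z = w ∨ (∃ u v, S u v ∧ i u = z ∧ i v = w) ∨ ∃ u v, T u v ∧ j u = z ∧ j v = w := by
  have hc : (S.map i).comap j = ⊥ := by
    rw [eq_bot_iff]
    intro u v h
    rcases (map_iff hi).1 h with e | ⟨x, y, _, e, _⟩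
    · exact hj e
    · exact absurd e (hd _ _)
  rw [sup_map_iff, hc, bot_sup_eq]
  constructor
  · rintro (h | ⟨u, v, h1, h2, h3⟩)
    · rcases (map_iff hi).1 h with e | h
      · exact Or.inl e
      · exact Or.inr (Or.inl h)
    · refine Or.inr (Or.inr ⟨u, v, h2, ?_, ?_⟩)
      · rcases (map_iff hi).1 h1 with e | ⟨x, y, _, _, e⟩
        · exact e.symm
        · exact absurd e (hd _ _)
      · rcases (map_iff hi).1 h3 with e | ⟨x, y, _, e, _⟩
        · exact e
        · exact absurd e (hd _ _)
  · rintro (rfl | ⟨u, v, h, rfl, rfl⟩ | ⟨u, v, h, rfl, rfl⟩)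
    · exact Or.inl (Setoid.refl' _ _)
    · exact Or.inl (map_apply i h)
    · exact Or.inr ⟨u, v, Setoid.refl' _ _, h, Setoid.refl' _ _⟩

theorem sup_map_left_iff (S : Setoid X) (T : Setoid Y) {i : X → Z} {j : Y → Z}
    (hi : Function.Injective i) (hj : Function.Injective j) (hd : ∀ x y, i x ≠ j y)
    {u v : X} : (S.map i ⊔ T.map j) (i u) (i v) ↔ S u v := by
  rw [sup_map_disjoint_iff S T hi hj hd]
  constructor
  · rintro (h | ⟨u', v', h, hu, hv⟩ | ⟨u', v', h, hu, hv⟩)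
    · rw [hi h]
    · rw [← hi hu, ← hi hv]; exact h
    · exact absurd hu.symm (hd _ _)
  · intro h
    exact Or.inr (Or.inl ⟨u, v, h, rfl, rfl⟩)

theorem sup_map_right_iff (S : Setoid X) (T : Setoid Y) {i : X → Z} {j : Y → Z}
    (hi : Function.Injective i) (hj : Function.Injective j) (hd : ∀ x y, i x ≠ j y)
    {u v : Y} : (S.map i ⊔ T.map j) (j u) (j v) ↔ T u v := by
  rw [sup_comm]
  exact sup_map_left_iff T S hj hi (fun x y h => hd y x h.symm)

theorem sup_map_left_right (S : Setoid X) (T : Setoid Y) {i : X → Z} {j : Y → Z}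
    (hi : Function.Injective i) (hj : Function.Injective j) (hd : ∀ x y, i x ≠ j y)
    {u : X} {v : Y} : ¬ (S.map i ⊔ T.map j) (i u) (j v) := by
  rw [sup_map_disjoint_iff S T hi hj hd]
  rintro (h | ⟨u', v', h, hu, hv⟩ | ⟨u', v', h, hu, hv⟩)
  · exact hd _ _ h
  · exact hd _ _ hv
  · exact hd _ _ hu.symm

theorem unhit_sup_disjoint [Finite X] [Finite Y] (S : Setoid X) (T : Setoid Y)
    {i : X → Z} {j : Y → Z} {f : α → Z} {k : X' → X} {l : Y' → Y}
    (hi : Function.Injective i) (hj : Function.Injective j) (hd : ∀ x y, i x ≠ j y)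
    (hs : ∀ z, (∃ x, i x = z) ∨ ∃ y, j y = z)
    (hk : ∀ x, (∃ a, f a = i x) ↔ ∃ b, k b = x) (hl : ∀ y, (∃ a, f a = j y) ↔ ∃ b, l b = y) :
    unhit (S.map i ⊔ T.map j) f = unhit S k + unhit T l := by
  set R := S.map i ⊔ T.map j with hR
  have hf : ∀ a, (∃ b, f a = i (k b)) ∨ ∃ b, f a = j (l b) := by
    intro a
    rcases hs (f a) with ⟨x, hx⟩ | ⟨y, hy⟩
    · obtain ⟨b, rfl⟩ := (hk x).1 ⟨a, hx.symm⟩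
      exact Or.inl ⟨b, hx.symm⟩
    · obtain ⟨b, rfl⟩ := (hl y).1 ⟨a, hy.symm⟩
      exact Or.inr ⟨b, hy.symm⟩
  symm
  unfold unhit
  rw [← Nat.card_sum]
  let φ : {c : Quotient S // ∀ y, Quotient.mk S (k y) ≠ c} ⊕
      {c : Quotient T // ∀ y, Quotient.mk T (l y) ≠ c} →
      {c : Quotient R // ∀ y, Quotient.mk R (f y) ≠ c} :=
    Sum.elim
      (fun c => ⟨Quotient.map' (s₁ := S) (s₂ := R) i
        (fun _ _ e => (sup_map_left_iff S T hi hj hd).2 e) c.1, by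
          obtain ⟨c, hc⟩ := c
          induction c using Quotient.inductionOn with
          | h x =>
            intro a ha
            have ha' : R (f a) (i x) := Quotient.exact ha
            rcases hf a with ⟨b, hb⟩ | ⟨b, hb⟩
            · rw [hb] at ha'
              exact hc b (Quotient.sound ((sup_map_left_iff S T hi hj hd).1 ha'))
            · rw [hb] at ha'
              exact sup_map_left_right S T hi hj hd (Setoid.symm' _ ha')⟩)
      (fun c => ⟨Quotient.map' (s₁ := T) (s₂ := R) j
        (fun _ _ e => (sup_map_right_iff S T hi hj hd).2 e) c.1, by
          obtain ⟨c, hc⟩ := c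
          induction c using Quotient.inductionOn with
          | h x =>
            intro a ha
            have ha' : R (f a) (j x) := Quotient.exact ha
            rcases hf a with ⟨b, hb⟩ | ⟨b, hb⟩
            · rw [hb] at ha'
              exact sup_map_left_right S T hi hj hd ha'
            · rw [hb] at ha'
              exact hc b (Quotient.sound ((sup_map_right_iff S T hi hj hd).1 ha'))⟩)
  refine Nat.card_eq_of_bijective φ ⟨?_, ?_⟩
  · rintro (⟨c, hc⟩ | ⟨c, hc⟩) (⟨c', hc'⟩ | ⟨c', hc'⟩) h <;>
      induction c using Quotient.inductionOn with
      | h x =>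
        induction c' using Quotient.inductionOn with
        | h y =>
          have h' := Quotient.exact (congrArg Subtype.val h)
          first
          | exact congrArg Sum.inl
              (Subtype.ext (Quotient.sound ((sup_map_left_iff S T hi hj hd).1 h')))
          | exact congrArg Sum.inr
              (Subtype.ext (Quotient.sound ((sup_map_right_iff S T hi hj hd).1 h')))
          | exact absurd h' (sup_map_left_right S T hi hj hd)
          | exact absurd (Setoid.symm' _ h') (sup_map_left_right S T hi hj hd)
  · rintro ⟨c, hc⟩
    induction c using Quotient.inductionOn with
    | h z =>
      rcases hs z with ⟨x, rfl⟩ | ⟨y, rfl⟩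
      · refine ⟨Sum.inl ⟨Quotient.mk _ x, fun b hb => ?_⟩, rfl⟩
        obtain ⟨a, ha⟩ := (hk (k b)).2 ⟨b, rfl⟩
        refine hc a (Quotient.sound ?_)
        rw [ha]
        exact (sup_map_left_iff S T hi hj hd).2 (Quotient.exact hb)
      · refine ⟨Sum.inr ⟨Quotient.mk _ y, fun b hb => ?_⟩, rfl⟩
        obtain ⟨a, ha⟩ := (hl (l b)).2 ⟨b, rfl⟩
        refine hc a (Quotient.sound ?_)
        rw [ha]
        exact (sup_map_right_iff S T hi hj hd).2 (Quotient.exact hb)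

end Juxtaposition

end Gluing


/-! ### Kauffman diagrams -/

/-- The boundary points of a box with `a` lower and `b` upper points. -/
abbrev Pt (a b : ℕ) : Type := Fin a ⊕ Fin b

/-- The position of a boundary point in the linear order that runs along the boundary of the box:
first the upper edge from right to left, then the lower edge from left to right. -/
def pos {a b : ℕ} : Pt a b → ℤ
  | Sum.inl i => i
  | Sum.inr j => -1 - j

theorem pos_injective {a b : ℕ} : Function.Injective (pos : Pt a b → ℤ) := by
  rintro (x | x) (y | y) h <;> simp only [pos] at h
  · congr 1; omega
  · omega
  · omega
  · congr 1; omega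

/-- A Kauffman diagram with `a` lower and `b` upper points, up to isotopy: the relation of being
joined by a curve. Each point is joined to exactly one other point, and curves do not cross. -/
@[ext]
structure Diagram (a b : ℕ) where
  rel : Setoid (Pt a b)
  matched : ∀ x, ∃! y, y ≠ x ∧ rel x y
  planar : ∀ p q r s, pos p < pos q → pos q < pos r → pos r < pos s → rel p r → ¬ rel q s

namespace Diagram

variable {a b c : ℕ}

/-- The other end of the curve that starts at `x`. -/
noncomputable def partner (D : Diagram a b) (x : Pt a b) : Pt a b := (D.matched x).choose

theorem partner_ne (D : Diagram a b) (x : Pt a b) : D.partner x ≠ x :=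
  (D.matched x).choose_spec.1.1

theorem rel_partner (D : Diagram a b) (x : Pt a b) : D.rel x (D.partner x) :=
  (D.matched x).choose_spec.1.2

theorem eq_partner (D : Diagram a b) {x y : Pt a b} (hne : y ≠ x) (h : D.rel x y) :
    y = D.partner x :=
  (D.matched x).choose_spec.2 y ⟨hne, h⟩

theorem partner_partner (D : Diagram a b) (x : Pt a b) : D.partner (D.partner x) = x :=
  (D.eq_partner (D.partner_ne x).symm (D.rel.symm' (D.rel_partner x))).symm

theorem rel_iff (D : Diagram a b) {x y : Pt a b} : D.rel x y ↔ y = x ∨ y = D.partner x := by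
  constructor
  · intro h
    by_cases e : y = x
    · exact Or.inl e
    · exact Or.inr (D.eq_partner e h)
  · rintro (rfl | rfl)
    · exact D.rel.refl' _
    · exact D.rel_partner x

instance : Finite (Diagram a b) := by
  have h : Function.Injective (fun (D : Diagram a b) (x y : Pt a b) => D.rel x y) := by
    intro D E h
    apply Diagram.ext
    ext x y
    exact iff_of_eq (congrFun (congrFun h x) y)
  exact Finite.of_injective _ h

/-- In the orbit of a point `p` under two involutions `s`, `t` of a finite set such that `p` is
fixed by `t` only, there is exactly one other point fixed by `s` or `t`. -/
theorem orbit_end {X : Type*} [Finite X] (R : Setoid X) (s t : X → X)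
    (hs : ∀ x, s (s x) = x) (ht : ∀ x, t (t x) = x)
    (hsR : ∀ x, R x (s x)) (htR : ∀ x, R x (t x))
    (hmin : ∀ T : Setoid X, (∀ x, T x (s x)) → (∀ x, T x (t x)) → R ≤ T)
    (p : X) (hp : t p = p) (hp' : s p ≠ p) :
    ∃! y, y ≠ p ∧ R p y ∧ (s y = y ∨ t y = y) := by
  let σ : Equiv.Perm X := ⟨s, s, hs, hs⟩
  let τ : Equiv.Perm X := ⟨t, t, ht, ht⟩
  have hσ : σ * σ = 1 := Equiv.ext hs
  have hτ : τ * τ = 1 := Equiv.ext ht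
  have hσi : σ⁻¹ = σ := inv_eq_of_mul_eq_one_right hσ
  have hτi : τ⁻¹ = τ := inv_eq_of_mul_eq_one_right hτ
  let ρ : Equiv.Perm X := τ * σ
  have hρi : ρ⁻¹ = σ * τ := by rw [mul_inv_rev, hσi, hτi]
  have hτρ : ∀ k : ℤ, τ * ρ ^ k = ρ ^ (-k) * τ := by
    intro k
    have h1 : τ * ρ * τ⁻¹ = ρ⁻¹ := by
      rw [hρi, hτi, ← mul_assoc, hτ, one_mul]
    have h2 : (τ * ρ * τ⁻¹) ^ k = τ * ρ ^ k * τ⁻¹ := conj_zpow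
    rw [h1, inv_zpow, ← zpow_neg] at h2
    rw [h2, inv_mul_cancel_right]
  have htk : ∀ k : ℤ, t ((ρ ^ k) p) = (ρ ^ (-k)) p := by
    intro k
    have := congrArg (fun e : Equiv.Perm X => e p) (hτρ k)
    simp only [Equiv.Perm.mul_apply] at this
    exact this.trans (congrArg _ hp)
  have hsk : ∀ k : ℤ, s ((ρ ^ k) p) = (ρ ^ (-k - 1)) p := by
    intro k
    have h1 : σ = τ * ρ := by rw [← mul_assoc, hτ, one_mul]
    have h2 : s ((ρ ^ k) p) = τ ((ρ ^ (1 + k)) p) := by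
      rw [zpow_add, zpow_one]
      exact congrArg (fun e : Equiv.Perm X => e ((ρ ^ k) p)) h1
    rw [h2]
    have h3 := htk (1 + k)
    have h4 : -(1 + k) = -k - 1 := by ring
    rw [h4] at h3
    exact h3
  have hRk : ∀ k : ℕ, R p ((ρ ^ k) p) ∧ R p ((ρ ^ (-(k : ℤ))) p) := by
    intro k
    have : R p ((ρ ^ k) p) := by
      induction k with
      | zero => exact R.refl' _
      | succ k ih =>
        rw [pow_succ']
        exact R.trans' ih (R.trans' (hsR _) (htR _))
    refine ⟨this, ?_⟩
    rw [← htk, zpow_natCast]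
    exact R.trans' this (htR _)
  have hRz : ∀ k : ℤ, R p ((ρ ^ k) p) := by
    intro k
    obtain ⟨n, rfl | rfl⟩ := k.eq_nat_or_neg
    · rw [zpow_natCast]; exact (hRk n).1
    · exact (hRk n).2
  have horb : ∀ y, R p y → ∃ k : ℤ, y = (ρ ^ k) p := by
    let T : Setoid X := Setoid.ker fun y => ∃ k : ℤ, y = (ρ ^ k) p
    have hT : R ≤ T := by
      apply hmin
      · intro x
        refine propext ⟨?_, ?_⟩
        · rintro ⟨k, rfl⟩; exact ⟨_, hsk k⟩
        · rintro ⟨k, hk⟩; exact ⟨_, (hs x).symm.trans ((congrArg s hk).trans (hsk k))⟩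
      · intro x
        refine propext ⟨?_, ?_⟩
        · rintro ⟨k, rfl⟩; exact ⟨_, htk k⟩
        · rintro ⟨k, hk⟩; exact ⟨_, (ht x).symm.trans ((congrArg t hk).trans (htk k))⟩
    intro y hy
    have h : (∃ k : ℤ, p = (ρ ^ k) p) = ∃ k : ℤ, y = (ρ ^ k) p := hT hy
    rw [← h]
    exact ⟨0, rfl⟩
  obtain ⟨L, hL, hdvd⟩ : ∃ L : ℕ, 0 < L ∧ ∀ k l : ℤ, (ρ ^ k) p = (ρ ^ l) p ↔ (L : ℤ) ∣ k - l := by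
    refine ⟨Function.minimalPeriod (ρ • ·) p, ?_, ?_⟩
    · apply Function.minimalPeriod_pos_of_mem_periodicPts
      exact (Function.Injective.mem_periodicPts (MulAction.injective ρ) p)
    · intro k l
      rw [← MulAction.zpow_smul_eq_iff_minimalPeriod_dvd, sub_eq_neg_add, zpow_add, mul_smul]
      rw [zpow_neg, inv_smul_eq_iff]
      rfl
  have hfix : ∀ k : ℤ, (s ((ρ ^ k) p) = (ρ ^ k) p ∨ t ((ρ ^ k) p) = (ρ ^ k) p) ↔
      ((L : ℤ) ∣ 2 * k + 1 ∨ (L : ℤ) ∣ 2 * k) := by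
    intro k
    rw [hsk, htk, hdvd, hdvd, ← dvd_neg, ← dvd_neg (b := -k - k)]
    ring_nf
  have hne : ∀ k : ℤ, (ρ ^ k) p ≠ p ↔ ¬ (L : ℤ) ∣ k := by
    intro k
    have := hdvd k 0
    simp only [zpow_zero, Equiv.Perm.one_apply, sub_zero] at this
    rw [← this]
  have hL1 : L ≠ 1 := by
    rintro rfl
    apply hp'
    have := hsk 0
    rw [zpow_zero, Equiv.Perm.one_apply] at this
    rw [this]
    have h2 := (hdvd (-0 - 1) 0).2 (by simp)
    simpa using h2
  rcases Nat.even_or_odd' L with ⟨m, hm | hm⟩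
  · refine ⟨(ρ ^ (m : ℤ)) p, ⟨(hne _).2 ?_, hRz _, (hfix _).2 (Or.inr ⟨1, by omega⟩)⟩, ?_⟩
    · intro h
      have := Int.le_of_dvd (by omega) h
      omega
    · rintro y ⟨h1, h2, h3⟩
      obtain ⟨k, rfl⟩ := horb y h2
      rw [hne] at h1
      rw [hfix] at h3
      rw [hdvd]
      rcases h3 with ⟨e, he⟩ | ⟨e, he⟩
      · exfalso
        rw [hm] at he
        push_cast at he
        rw [mul_assoc] at he
        omega
      · have hk : k = m * e := by
          rw [hm] at he
          push_cast at he
          rw [mul_assoc] at he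
          omega
        rcases Int.even_or_odd' e with ⟨j, hj | hj⟩
        · exfalso
          apply h1
          exact ⟨j, by rw [hk, hj, hm]; push_cast; ring⟩
        · exact ⟨j, by rw [hk, hj, hm]; push_cast; ring⟩
  · refine ⟨(ρ ^ (m : ℤ)) p, ⟨(hne _).2 ?_, hRz _, (hfix _).2 (Or.inl ⟨1, by omega⟩)⟩, ?_⟩
    · intro h
      have := Int.le_of_dvd (by omega) h
      omega
    · rintro y ⟨h1, h2, h3⟩
      obtain ⟨k, rfl⟩ := horb y h2
      rw [hne] at h1
      rw [hfix] at h3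
      rw [hdvd]
      have hcop : IsCoprime (L : ℤ) 2 := ⟨1, -m, by rw [hm]; push_cast; ring⟩
      rcases h3 with h3 | h3
      · apply hcop.dvd_of_dvd_mul_left
        have : (2 : ℤ) * (k - m) = (2 * k + 1) - L := by rw [hm]; push_cast; ring
        rw [this]
        exact dvd_sub_self_right.2 h3
      · exact absurd (hcop.dvd_of_dvd_mul_left h3) h1


section Comp

variable (D : Diagram a b) (E : Diagram b c)

/-- Travel along the curves of the lower diagram. -/
noncomputable def stepLower : Fin a ⊕ Fin b ⊕ Fin c → Fin a ⊕ Fin b ⊕ Fin c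
  | Sum.inl i => Sum.map id Sum.inl (D.partner (Sum.inl i))
  | Sum.inr (Sum.inl j) => Sum.map id Sum.inl (D.partner (Sum.inr j))
  | Sum.inr (Sum.inr k) => Sum.inr (Sum.inr k)

/-- Travel along the curves of the upper diagram. -/
noncomputable def stepUpper : Fin a ⊕ Fin b ⊕ Fin c → Fin a ⊕ Fin b ⊕ Fin c
  | Sum.inl i => Sum.inl i
  | Sum.inr x => Sum.inr (E.partner x)

theorem stepLower_apply (x : Pt a b) :
    (stepLower D (Sum.map id Sum.inl x) : Fin a ⊕ Fin b ⊕ Fin c) =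
      Sum.map id Sum.inl (D.partner x) := by
  rcases x with x | x <;> rfl

theorem stepLower_stepLower (x : Fin a ⊕ Fin b ⊕ Fin c) : stepLower D (stepLower D x) = x := by
  rcases x with x | x | x
  · exact (stepLower_apply D _).trans (congrArg _ (D.partner_partner _))
  · exact (stepLower_apply D _).trans (congrArg _ (D.partner_partner _))
  · rfl

theorem stepUpper_stepUpper (x : Fin a ⊕ Fin b ⊕ Fin c) : stepUpper E (stepUpper E x) = x := by
  rcases x with x | x
  · rfl
  · exact congrArg Sum.inr (E.partner_partner _)

theorem glue_stepLower (x : Fin a ⊕ Fin b ⊕ Fin c) : glue D.rel E.rel x (stepLower D x) := by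
  have h : ∀ y : Pt a b, glue D.rel E.rel (Sum.map id Sum.inl y)
      (Sum.map id Sum.inl (D.partner y)) := fun y =>
    (le_sup_left : _ ≤ glue D.rel E.rel) (map_apply (Sum.map id Sum.inl) (D.rel_partner y))
  rcases x with x | x | x
  · exact h (Sum.inl x)
  · exact h (Sum.inr x)
  · exact Setoid.refl' _ _

theorem glue_stepUpper (x : Fin a ⊕ Fin b ⊕ Fin c) : glue D.rel E.rel x (stepUpper E x) := by
  rcases x with x | x
  · exact Setoid.refl' _ _
  · exact (le_sup_right : _ ≤ glue D.rel E.rel) (map_apply Sum.inr (E.rel_partner x))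

theorem glue_le (T : Setoid (Fin a ⊕ Fin b ⊕ Fin c)) (h1 : ∀ x, T x (stepLower D x))
    (h2 : ∀ x, T x (stepUpper E x)) : glue D.rel E.rel ≤ T := by
  apply sup_le
  · rw [map_le_iff]
    intro x y h
    rcases D.rel_iff.1 h with rfl | rfl
    · exact T.refl' _
    · have := h1 (Sum.map id Sum.inl x)
      rwa [stepLower_apply] at this
  · rw [map_le_iff]
    intro x y h
    rcases E.rel_iff.1 h with rfl | rfl
    · exact T.refl' _
    · exact h2 (Sum.inr x)

theorem stepLower_outer (x : Pt a c) :
    (stepLower D (outer x) : Fin a ⊕ Fin b ⊕ Fin c) = outer x ↔ ∃ k, x = Sum.inr k := by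
  rcases x with x | x
  · have h := D.partner_ne (Sum.inl x)
    rcases e : D.partner (Sum.inl x) with y | y <;> rw [e] at h <;>
      simp_all [outer, stepLower]
  · simp [outer, stepLower]

theorem stepUpper_outer (x : Pt a c) :
    (stepUpper E (outer x) : Fin a ⊕ Fin b ⊕ Fin c) = outer x ↔ ∃ k, x = Sum.inl k := by
  rcases x with x | x
  · simp [outer, stepUpper]
  · have h := E.partner_ne (Sum.inr x)
    simp [outer, stepUpper, h]

theorem fixed_iff (y : Fin a ⊕ Fin b ⊕ Fin c) :
    (stepLower D y = y ∨ stepUpper E y = y) ↔ ∃ x : Pt a c, outer x = y := by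
  rcases y with y | y | y
  · exact ⟨fun _ => ⟨Sum.inl y, rfl⟩, fun _ => Or.inr rfl⟩
  · have h := D.partner_ne (Sum.inr y)
    have h' := E.partner_ne (Sum.inl y)
    constructor
    · rintro (h1 | h1)
      · exfalso
        rcases e : D.partner (Sum.inr y) with z | z <;> rw [e] at h <;> simp_all [stepLower]
      · exfalso
        simp_all [stepUpper]
    · rintro ⟨x | x, hx⟩ <;> simp [outer] at hx
  · exact ⟨fun _ => ⟨Sum.inr y, rfl⟩, fun _ => Or.inl rfl⟩

theorem outer_injective {α β γ : Type*} :
    Function.Injective (outer : α ⊕ γ → α ⊕ β ⊕ γ) := by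
  intro x y
  rcases x with x | x <;> rcases y with y | y <;> simp [outer]

theorem matched_comp (x : Pt a c) : ∃! y, y ≠ x ∧ compRel D.rel E.rel x y := by
  have key : ∃! y : Fin a ⊕ Fin b ⊕ Fin c, y ≠ outer x ∧ glue D.rel E.rel (outer x) y ∧
      (stepLower D y = y ∨ stepUpper E y = y) := by
    rcases x with x | x
    · apply orbit_end _ _ _ (stepLower_stepLower D) (stepUpper_stepUpper E)
        (glue_stepLower D E) (glue_stepUpper D E) (glue_le D E)
      · exact (stepUpper_outer E _).2 ⟨x, rfl⟩
      · rw [Ne, stepLower_outer]; simp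
    · have := orbit_end _ _ _ (stepUpper_stepUpper E) (stepLower_stepLower D)
        (glue_stepUpper D E) (glue_stepLower D E) (fun T h1 h2 => glue_le D E T h2 h1)
        (outer (Sum.inr x)) ((stepLower_outer D _).2 ⟨x, rfl⟩)
        (by rw [Ne, stepUpper_outer]; simp)
      simpa only [or_comm] using this
  obtain ⟨y, ⟨h1, h2, h3⟩, h4⟩ := key
  obtain ⟨z, rfl⟩ := (fixed_iff D E y).1 h3
  refine ⟨z, ⟨fun e => h1 (by rw [e]), h2⟩, ?_⟩
  rintro w ⟨hw1, hw2⟩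
  exact outer_injective (h4 (outer w) ⟨fun e => hw1 (outer_injective e), hw2,
    (fixed_iff D E _).2 ⟨w, rfl⟩⟩)

end Comp

section Parity

theorem sum_half (D : Diagram a b) (F : Pt a b → ZMod 2) :
    ∑ x, F x = ∑ x ∈ Finset.univ.filter (fun x => pos x < pos (D.partner x)),
      (F x + F (D.partner x)) := by
  rw [Finset.sum_add_distrib,
    ← Finset.sum_filter_add_sum_filter_not Finset.univ (fun x => pos x < pos (D.partner x))]
  congr 1
  refine Finset.sum_bij' (fun x _ => D.partner x) (fun x _ => D.partner x) ?_ ?_ ?_ ?_ ?_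
  · intro x hx
    have h : pos (D.partner x) ≠ pos x := fun e => D.partner_ne x (pos_injective e)
    simp only [Finset.mem_filter, Finset.mem_univ, true_and, partner_partner] at hx ⊢
    omega
  · intro x hx
    simp only [Finset.mem_filter, Finset.mem_univ, true_and, partner_partner] at hx ⊢
    omega
  · intro x _
    exact D.partner_partner x
  · intro x _
    exact D.partner_partner x
  · intro x _
    rw [D.partner_partner]

/-- The sign `[pos x < pos y]` modulo two. -/
def chi {a b : ℕ} (x y : Pt a b) : ZMod 2 := if pos x < pos y then 1 else 0

theorem sum_invariant (D : Diagram a b) {f : Pt a b → ZMod 2}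
    (hf : ∀ x y, D.rel x y → f x = f y) : ∑ x, f x = 0 := by
  rw [sum_half D]
  apply Finset.sum_eq_zero
  intro x _
  rw [← hf _ _ (D.rel_partner x)]
  exact CharTwo.add_self_eq_zero _

theorem sum_chi (D : Diagram a b) {f g : Pt a b → ZMod 2}
    (hf : ∀ x y, D.rel x y → f x = f y) (hg : ∀ x y, D.rel x y → g x = g y)
    (hfg : ∀ x, f x * g x = 0) :
    ∑ x, ∑ y, f x * g y * chi x y = 0 := by
  rw [sum_half D]
  apply Finset.sum_eq_zero
  intro x hx
  rw [← Finset.sum_add_distrib, sum_half D]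
  apply Finset.sum_eq_zero
  intro y hy
  simp only [Finset.mem_filter, Finset.mem_univ, true_and] at hx hy
  rw [← hf _ _ (D.rel_partner x), ← hg _ _ (D.rel_partner y)]
  have hfac : f x * g y * chi x y + f x * g y * chi (D.partner x) y +
      (f x * g y * chi x (D.partner y) + f x * g y * chi (D.partner x) (D.partner y)) =
      f x * g y * (chi x y + chi (D.partner x) y +
        (chi x (D.partner y) + chi (D.partner x) (D.partner y))) := by ring
  rw [hfac]
  by_cases hz : f x * g y = 0
  · rw [hz, zero_mul]
  have h1 : pos x ≠ pos y := fun e => hz (by rw [← pos_injective e]; exact hfg x)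
  have h2 : pos (D.partner x) ≠ pos y := fun e => hz (by
    rw [hf _ _ (D.rel_partner x), pos_injective e]; exact hfg y)
  have h3 : pos x ≠ pos (D.partner y) := fun e => hz (by
    rw [hg _ _ (D.rel_partner y), pos_injective e]; exact hfg _)
  have h4 : pos (D.partner x) ≠ pos (D.partner y) := fun e => hz (by
    rw [hg _ _ (D.rel_partner y), hf _ _ (D.rel_partner x), pos_injective e]; exact hfg _)
  have n1 : ¬ (pos x < pos y ∧ pos y < pos (D.partner x) ∧
      pos (D.partner x) < pos (D.partner y)) := fun h =>
    D.planar x y (D.partner x) (D.partner y) h.1 h.2.1 h.2.2 (D.rel_partner x) (D.rel_partner y)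
  have n2 : ¬ (pos y < pos x ∧ pos x < pos (D.partner y) ∧
      pos (D.partner y) < pos (D.partner x)) := fun h =>
    D.planar y x (D.partner y) (D.partner x) h.1 h.2.1 h.2.2 (D.rel_partner y) (D.rel_partner x)
  have two : (1 + 1 : ZMod 2) = 0 := rfl
  unfold chi
  generalize pos x = p at *
  generalize pos y = q at *
  generalize pos (D.partner x) = p' at *
  generalize pos (D.partner y) = q' at *
  split_ifs <;> first | (simp [two]; done) | (exfalso; omega)

theorem chi_ll (i j : Fin a) : chi (Sum.inl i : Pt a b) (Sum.inl j) = if i < j then 1 else 0 := by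
  simp [chi, pos]

theorem chi_lr (i : Fin a) (j : Fin b) : chi (Sum.inl i : Pt a b) (Sum.inr j) = 0 := by
  apply if_neg
  simp only [pos]
  omega

theorem chi_rl (i : Fin b) (j : Fin a) : chi (Sum.inr i : Pt a b) (Sum.inl j) = 1 := by
  apply if_pos
  simp only [pos]
  omega

theorem chi_rr (i j : Fin b) : chi (Sum.inr i : Pt a b) (Sum.inr j) = if j < i then 1 else 0 := by
  simp [chi, pos]

theorem sum_expand (f1 g1 : Fin a → ZMod 2) (f2 g2 : Fin b → ZMod 2) :
    ∑ x : Pt a b, ∑ y : Pt a b, Sum.elim f1 f2 x * Sum.elim g1 g2 y * chi x y =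
      ∑ i, ∑ j, f1 i * g1 j * (if i < j then 1 else 0) + (∑ i, f2 i) * (∑ j, g1 j) +
        ∑ i, ∑ j, f2 i * g2 j * (if j < i then 1 else 0) := by
  simp only [Fintype.sum_sum_type, Sum.elim_inl, Sum.elim_inr, chi_ll, chi_lr, chi_rl, chi_rr,
    mul_zero, mul_one, Finset.sum_const_zero, Finset.sum_add_distrib,
    Finset.sum_mul_sum]
  ring

theorem planar_comp (D : Diagram a b) (E : Diagram b c) (p q r s : Pt a c)
    (hpq : pos p < pos q) (hqr : pos q < pos r) (hrs : pos r < pos s)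
    (hpr : compRel D.rel E.rel p r) : ¬ compRel D.rel E.rel q s := by
  classical
  intro hqs
  set G := glue D.rel E.rel with hG
  have ne_of : ∀ {x y : Pt a c}, pos x < pos y → y ≠ x := fun h e => by
    rw [e] at h; exact lt_irrefl _ h
  have class_iff : ∀ {p r x : Pt a c}, r ≠ p → compRel D.rel E.rel p r →
      (G (outer p) (outer x) ↔ x = p ∨ x = r) := by
    intro p r x hne h
    constructor
    · intro hx
      by_cases e : x = p
      · exact Or.inl e
      · exact Or.inr ((matched_comp D E p).unique ⟨e, hx⟩ ⟨hne, h⟩)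
    · rintro (rfl | rfl)
      · exact G.refl' _
      · exact h
  have hrp : r ≠ p := ne_of (hpq.trans hqr)
  have hsq : s ≠ q := ne_of (hqr.trans hrs)
  let f : Fin a ⊕ Fin b ⊕ Fin c → ZMod 2 := fun x => if G (outer p) x then 1 else 0
  let g : Fin a ⊕ Fin b ⊕ Fin c → ZMod 2 := fun x => if G (outer q) x then 1 else 0
  have inv : ∀ (z x y : Fin a ⊕ Fin b ⊕ Fin c), G x y →
      (if G z x then (1 : ZMod 2) else 0) = if G z y then 1 else 0 := by
    intro z x y h
    have : G z x ↔ G z y := ⟨fun h' => G.trans' h' h, fun h' => G.trans' h' (G.symm' h)⟩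
    rw [if_congr this rfl rfl]
  have hfg : ∀ x, f x * g x = 0 := by
    intro x
    by_cases h1 : G (outer p) x
    · by_cases h2 : G (outer q) x
      · exfalso
        rcases (class_iff (x := q) hrp hpr).1 (G.trans' h1 (G.symm' h2)) with e | e
        · exact ne_of hpq e
        · exact ne_of hqr e.symm
      · simp [g, h2]
    · simp [f, h1]
  have hDrel : ∀ x y : Pt a b, D.rel x y → G (Sum.map id Sum.inl x) (Sum.map id Sum.inl y) :=
    fun x y h => (le_sup_left : _ ≤ glue D.rel E.rel) (map_apply (Sum.map id Sum.inl) h)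
  have hErel : ∀ x y : Pt b c, E.rel x y → G (Sum.inr x) (Sum.inr y) :=
    fun x y h => (le_sup_right : _ ≤ glue D.rel E.rel) (map_apply Sum.inr h)
  let f1 := fun i => f (Sum.inl i)
  let f2 := fun i => f (Sum.inr (Sum.inl i))
  let f3 := fun i => f (Sum.inr (Sum.inr i))
  let g1 := fun i => g (Sum.inl i)
  let g2 := fun i => g (Sum.inr (Sum.inl i))
  let g3 := fun i => g (Sum.inr (Sum.inr i))
  have eD : ∀ h : Fin a ⊕ Fin b ⊕ Fin c → ZMod 2,
      (Sum.elim (fun i => h (Sum.inl i)) (fun i => h (Sum.inr (Sum.inl i))) : Pt a b → ZMod 2) =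
        fun x => h (Sum.map id Sum.inl x) := by
    intro h; funext x; rcases x with x | x <;> rfl
  have eE : ∀ h : Fin a ⊕ Fin b ⊕ Fin c → ZMod 2,
      (Sum.elim (fun i => h (Sum.inr (Sum.inl i))) (fun i => h (Sum.inr (Sum.inr i))) :
        Pt b c → ZMod 2) = fun x => h (Sum.inr x) := by
    intro h; funext x; rcases x with x | x <;> rfl
  have eO : ∀ h : Fin a ⊕ Fin b ⊕ Fin c → ZMod 2,
      (Sum.elim (fun i => h (Sum.inl i)) (fun i => h (Sum.inr (Sum.inr i))) : Pt a c → ZMod 2) =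
        fun x => h (outer x) := by
    intro h; funext x; rcases x with x | x <;> rfl
  have hD := sum_chi D (f := Sum.elim f1 f2) (g := Sum.elim g1 g2)
    (by rw [eD]; exact fun x y h => inv _ _ _ (hDrel _ _ h))
    (by rw [eD]; exact fun x y h => inv _ _ _ (hDrel _ _ h))
    (by rw [eD, eD]; exact fun x => hfg _)
  have hE := sum_chi E (f := Sum.elim f2 f3) (g := Sum.elim g2 g3)
    (by rw [eE]; exact fun x y h => inv _ _ _ (hErel _ _ h))
    (by rw [eE]; exact fun x y h => inv _ _ _ (hErel _ _ h))
    (by rw [eE, eE]; exact fun x => hfg _)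
  have sDf := sum_invariant D (f := Sum.elim f1 f2)
    (by rw [eD]; exact fun x y h => inv _ _ _ (hDrel _ _ h))
  have sDg := sum_invariant D (f := Sum.elim g1 g2)
    (by rw [eD]; exact fun x y h => inv _ _ _ (hDrel _ _ h))
  have sEf := sum_invariant E (f := Sum.elim f2 f3)
    (by rw [eE]; exact fun x y h => inv _ _ _ (hErel _ _ h))
  rw [sum_expand] at hD hE
  simp only [Fintype.sum_sum_type, Sum.elim_inl, Sum.elim_inr] at sDf sDg sEf
  have hO : ∑ x : Pt a c, ∑ y : Pt a c, Sum.elim f1 f3 x * Sum.elim g1 g3 y * chi x y = 1 := by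
    have e1 : ∀ x : Pt a c, (Sum.elim f1 f3 x : ZMod 2) =
        (if x = p then 1 else 0) + if x = r then 1 else 0 := by
      intro x
      have : (Sum.elim f1 f3 x : ZMod 2) = f (outer x) := congrFun (eO f) x
      rw [this]
      simp only [f, class_iff hrp hpr]
      by_cases h1 : x = p
      · subst h1; simp [hrp.symm]
      · simp [h1]
    have e2 : ∀ x : Pt a c, (Sum.elim g1 g3 x : ZMod 2) =
        (if x = q then 1 else 0) + if x = s then 1 else 0 := by
      intro x
      have : (Sum.elim g1 g3 x : ZMod 2) = g (outer x) := congrFun (eO g) x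
      rw [this]
      simp only [g, class_iff hsq hqs]
      by_cases h1 : x = q
      · subst h1; simp [hsq.symm]
      · simp [h1]
    simp only [e1, e2, add_mul, mul_add, Finset.sum_add_distrib, ite_mul, mul_ite, one_mul,
      zero_mul, mul_zero, mul_one, Finset.sum_ite_eq',
      Finset.mem_univ, if_true]
    have c1 : chi p q = 1 := if_pos hpq
    have c2 : chi p s = 1 := if_pos (hpq.trans (hqr.trans hrs))
    have c3 : chi r q = 0 := if_neg (not_lt.2 hqr.le)
    have c4 : chi r s = 1 := if_pos hrs
    rw [c1, c2, c3, c4]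
    rfl
  rw [sum_expand] at hO
  have hBB : ∑ i, ∑ j, f2 i * g2 j * (if i < j then 1 else 0) +
      ∑ i, ∑ j, f2 i * g2 j * (if j < i then 1 else 0) = (∑ i, f2 i) * ∑ j, g2 j := by
    rw [Finset.sum_mul_sum, ← Finset.sum_add_distrib]
    refine Finset.sum_congr rfl fun i _ => ?_
    rw [← Finset.sum_add_distrib]
    refine Finset.sum_congr rfl fun j _ => ?_
    rcases lt_trichotomy i j with h | h | h
    · simp [h, h.not_gt]
    · subst h
      simp only [lt_irrefl, if_false, mul_zero, add_zero]
      exact (hfg _).symm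
    · simp [h, h.not_gt]
  have s1 : ∑ i, f2 i = ∑ i, f1 i := (CharTwo.add_eq_zero.1 sDf).symm
  have s2 : ∑ i, g2 i = ∑ i, g1 i := (CharTwo.add_eq_zero.1 sDg).symm
  have s3 : ∑ i, f3 i = ∑ i, f1 i := (CharTwo.add_eq_zero.1 sEf).symm.trans s1
  rw [s1] at hD
  rw [s3, s2] at hE
  rw [s1, s2] at hBB
  rw [s3] at hO
  have two : (2 : ZMod 2) = 0 := rfl
  have : (1 : ZMod 2) = 0 := by
    linear_combination hD + hE - hO - hBB - (∑ i, f1 i) * (∑ i, g1 i) * two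
  exact one_ne_zero this

end Parity

/-- Stacking `E` on top of `D` and removing the closed loops. -/
def comp (D : Diagram a b) (E : Diagram b c) : Diagram a c where
  rel := compRel D.rel E.rel
  matched := matched_comp D E
  planar := planar_comp D E

/-- The diagram of `a` vertical lines. -/
def one (a : ℕ) : Diagram a a where
  rel := idRel
  matched := by
    rintro (x | x)
    · refine ⟨Sum.inr x, ⟨by simp, rfl⟩, ?_⟩
      rintro (y | y) ⟨h1, h2⟩
      · have h3 : x = y := h2
        simp [h3] at h1
      · have h3 : x = y := h2
        rw [h3]
    · refine ⟨Sum.inl x, ⟨by simp, rfl⟩, ?_⟩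
      rintro (y | y) ⟨h1, h2⟩
      · have h3 : x = y := h2
        rw [h3]
      · have h3 : x = y := h2
        simp [h3] at h1
  planar := by
    intro p q r s h1 h2 h3 h4 h5
    have h6 : (Sum.elim id id p : Fin a) = Sum.elim id id r := h4
    have h7 : (Sum.elim id id q : Fin a) = Sum.elim id id s := h5
    rcases p with p | p <;> rcases q with q | q <;> rcases r with r | r <;>
      rcases s with s | s <;> simp only [pos, Sum.elim_inl, Sum.elim_inr, id] at * <;>
      subst h6 <;> subst h7 <;> omega

section Tensor

variable {a' b' c' : ℕ}

/-- The boundary points of the left box in a juxtaposition of two boxes. -/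
def leftPt (a' b' : ℕ) : Pt a b → Pt (a + a') (b + b') :=
  Sum.map (Fin.castAdd a') (Fin.castAdd b')

/-- The boundary points of the right box in a juxtaposition of two boxes. -/
def rightPt (a b : ℕ) : Pt a' b' → Pt (a + a') (b + b') :=
  Sum.map (Fin.natAdd a) (Fin.natAdd b)

theorem leftPt_injective : Function.Injective (leftPt a' b' : Pt a b → _) :=
  Sum.map_injective.2 ⟨Fin.castAdd_injective _ _, Fin.castAdd_injective _ _⟩

theorem rightPt_injective : Function.Injective (rightPt a b : Pt a' b' → _) :=
  Sum.map_injective.2 ⟨Fin.natAdd_injective _ _, Fin.natAdd_injective _ _⟩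

theorem castAdd_ne_natAdd (x : Fin a) (y : Fin a') : Fin.castAdd a' x ≠ Fin.natAdd a y := by
  intro h
  have := congrArg Fin.val h
  simp only [Fin.val_castAdd, Fin.val_natAdd] at this
  omega

theorem leftPt_ne_rightPt (x : Pt a b) (y : Pt a' b') : leftPt a' b' x ≠ rightPt a b y := by
  rcases x with x | x <;> rcases y with y | y <;>
    simp [leftPt, rightPt, castAdd_ne_natAdd]

theorem eq_castAdd_or (z : Fin (a + a')) :
    (∃ x, Fin.castAdd a' x = z) ∨ ∃ y, Fin.natAdd a y = z := by
  induction z using Fin.addCases with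
  | left i => exact Or.inl ⟨i, rfl⟩
  | right i => exact Or.inr ⟨i, rfl⟩

theorem eq_leftPt_or (z : Pt (a + a') (b + b')) :
    (∃ x, leftPt a' b' x = z) ∨ ∃ y, rightPt a b y = z := by
  rcases z with z | z <;> rcases eq_castAdd_or z with ⟨x, rfl⟩ | ⟨x, rfl⟩
  · exact Or.inl ⟨Sum.inl x, rfl⟩
  · exact Or.inr ⟨Sum.inl x, rfl⟩
  · exact Or.inl ⟨Sum.inr x, rfl⟩
  · exact Or.inr ⟨Sum.inr x, rfl⟩

theorem pos_leftPt (x : Pt a b) :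
    pos (leftPt a' b' x) = pos x ∧ -(b : ℤ) ≤ pos x ∧ pos x < a := by
  rcases x with x | x <;> simp [leftPt, pos] <;> omega

theorem pos_rightPt (x : Pt a' b') :
    (0 ≤ pos x ∧ pos (rightPt a b x) = pos x + a) ∨
      (pos x < 0 ∧ pos (rightPt a b x) = pos x - b) := by
  rcases x with x | x <;> simp [rightPt, pos] <;> omega

/-- Placing `E` to the right of `D`. -/
def tensor (D : Diagram a b) (E : Diagram a' b') : Diagram (a + a') (b + b') where
  rel := D.rel.map (leftPt a' b') ⊔ E.rel.map (rightPt a b)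
  matched := by
    intro z
    have hl := fun {u v} => sup_map_left_iff D.rel E.rel (u := u) (v := v)
      leftPt_injective rightPt_injective leftPt_ne_rightPt
    have hr := fun {u v} => sup_map_right_iff D.rel E.rel (u := u) (v := v)
      leftPt_injective rightPt_injective leftPt_ne_rightPt
    have hn := fun {u v} => sup_map_left_right D.rel E.rel (u := u) (v := v)
      leftPt_injective rightPt_injective leftPt_ne_rightPt
    rcases eq_leftPt_or z with ⟨x, rfl⟩ | ⟨x, rfl⟩
    · refine ⟨leftPt a' b' (D.partner x),
        ⟨fun e => D.partner_ne x (leftPt_injective e), hl.2 (D.rel_partner x)⟩, ?_⟩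
      rintro w ⟨h1, h2⟩
      rcases eq_leftPt_or w with ⟨y, rfl⟩ | ⟨y, rfl⟩
      · exact congrArg _ (D.eq_partner (fun e => h1 (congrArg _ e)) (hl.1 h2))
      · exact absurd h2 hn
    · refine ⟨rightPt a b (E.partner x),
        ⟨fun e => E.partner_ne x (rightPt_injective e), hr.2 (E.rel_partner x)⟩, ?_⟩
      rintro w ⟨h1, h2⟩
      rcases eq_leftPt_or w with ⟨y, rfl⟩ | ⟨y, rfl⟩
      · exact absurd (Setoid.symm' _ h2) hn
      · exact congrArg _ (E.eq_partner (fun e => h1 (congrArg _ e)) (hr.1 h2))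
  planar := by
    intro p q r s h1 h2 h3 h4 h5
    have hl := fun {u v} => sup_map_left_iff D.rel E.rel (u := u) (v := v)
      leftPt_injective rightPt_injective leftPt_ne_rightPt
    have hr := fun {u v} => sup_map_right_iff D.rel E.rel (u := u) (v := v)
      leftPt_injective rightPt_injective leftPt_ne_rightPt
    have hn := fun {u v} => sup_map_left_right D.rel E.rel (u := u) (v := v)
      leftPt_injective rightPt_injective leftPt_ne_rightPt
    rcases eq_leftPt_or p with ⟨p, rfl⟩ | ⟨p, rfl⟩ <;>
      rcases eq_leftPt_or r with ⟨r, rfl⟩ | ⟨r, rfl⟩ <;>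
      rcases eq_leftPt_or q with ⟨q, rfl⟩ | ⟨q, rfl⟩ <;>
      rcases eq_leftPt_or s with ⟨s, rfl⟩ | ⟨s, rfl⟩ <;>
      first
      | exact hn h4
      | exact hn (Setoid.symm' _ h4)
      | exact hn h5
      | exact hn (Setoid.symm' _ h5)
      | skip
    · have p1 := pos_leftPt (a' := a') (b' := b') p
      have p2 := pos_leftPt (a' := a') (b' := b') q
      have p3 := pos_leftPt (a' := a') (b' := b') r
      have p4 := pos_leftPt (a' := a') (b' := b') s
      exact D.planar p q r s (by omega) (by omega) (by omega) (hl.1 h4) (hl.1 h5)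
    · have p1 := pos_leftPt (a' := a') (b' := b') p
      have p2 := pos_rightPt (a := a) (b := b) q
      have p3 := pos_leftPt (a' := a') (b' := b') r
      have p4 := pos_rightPt (a := a) (b := b) s
      omega
    · have p1 := pos_rightPt (a := a) (b := b) p
      have p2 := pos_leftPt (a' := a') (b' := b') q
      have p3 := pos_rightPt (a := a) (b := b) r
      have p4 := pos_leftPt (a' := a') (b' := b') s
      omega
    · have p1 := pos_rightPt (a := a) (b := b) p
      have p2 := pos_rightPt (a := a) (b := b) q
      have p3 := pos_rightPt (a := a) (b := b) r
      have p4 := pos_rightPt (a := a) (b := b) s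
      exact E.planar p q r s (by omega) (by omega) (by omega) (hr.1 h4) (hr.1 h5)

theorem tensor_one : (one a).tensor (one a') = one (a + a') := by
  apply Diagram.ext
  apply le_antisymm
  · apply sup_le
    · rw [map_le_iff]
      intro x y h
      have h' : (Sum.elim id id x : Fin a) = Sum.elim id id y := h
      rcases x with x | x <;> rcases y with y | y <;> simp at h' <;> subst h' <;>
        exact (rfl : (_ : Fin (a + a')) = _)
    · rw [map_le_iff]
      intro x y h
      have h' : (Sum.elim id id x : Fin a') = Sum.elim id id y := h
      rcases x with x | x <;> rcases y with y | y <;> simp at h' <;> subst h' <;>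
        exact (rfl : (_ : Fin (a + a')) = _)
  · have key : ∀ z : Fin (a + a'), ((one a).tensor (one a')).rel (Sum.inl z) (Sum.inr z) := by
      intro z
      rcases eq_castAdd_or z with ⟨x, rfl⟩ | ⟨x, rfl⟩
      · exact (le_sup_left : _ ≤ ((one a).tensor (one a')).rel)
          (map_apply (leftPt a' a') (show idRel (Sum.inl x) (Sum.inr x) from rfl))
      · exact (le_sup_right : _ ≤ ((one a).tensor (one a')).rel)
          (map_apply (rightPt a a) (show idRel (Sum.inl x) (Sum.inr x) from rfl))
    intro x y h
    have h' : (Sum.elim id id x : Fin (a + a')) = Sum.elim id id y := h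
    rcases x with x | x <;> rcases y with y | y <;> simp at h' <;> subst h'
    · exact Setoid.refl' _ _
    · exact key _
    · exact Setoid.symm' _ (key _)
    · exact Setoid.refl' _ _

/-- The points of the left pair of boxes in a two by two arrangement. -/
def left3 (a' b' c' : ℕ) :
    Fin a ⊕ Fin b ⊕ Fin c → Fin (a + a') ⊕ Fin (b + b') ⊕ Fin (c + c') :=
  Sum.map (Fin.castAdd a') (Sum.map (Fin.castAdd b') (Fin.castAdd c'))

/-- The points of the right pair of boxes in a two by two arrangement. -/
def right3 (a b c : ℕ) :
    Fin a' ⊕ Fin b' ⊕ Fin c' → Fin (a + a') ⊕ Fin (b + b') ⊕ Fin (c + c') :=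
  Sum.map (Fin.natAdd a) (Sum.map (Fin.natAdd b) (Fin.natAdd c))

theorem left3_injective :
    Function.Injective (left3 a' b' c' : Fin a ⊕ Fin b ⊕ Fin c → _) :=
  Sum.map_injective.2 ⟨Fin.castAdd_injective _ _,
    Sum.map_injective.2 ⟨Fin.castAdd_injective _ _, Fin.castAdd_injective _ _⟩⟩

theorem right3_injective :
    Function.Injective (right3 a b c : Fin a' ⊕ Fin b' ⊕ Fin c' → _) :=
  Sum.map_injective.2 ⟨Fin.natAdd_injective _ _,
    Sum.map_injective.2 ⟨Fin.natAdd_injective _ _, Fin.natAdd_injective _ _⟩⟩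

theorem left3_ne_right3 (x : Fin a ⊕ Fin b ⊕ Fin c) (y : Fin a' ⊕ Fin b' ⊕ Fin c') :
    left3 a' b' c' x ≠ right3 a b c y := by
  rcases x with x | x | x <;> rcases y with y | y | y <;>
    simp [left3, right3, castAdd_ne_natAdd]

theorem eq_left3_or (z : Fin (a + a') ⊕ Fin (b + b') ⊕ Fin (c + c')) :
    (∃ x, left3 a' b' c' x = z) ∨ ∃ y, right3 a b c y = z := by
  rcases z with z | z | z <;> rcases eq_castAdd_or z with ⟨x, rfl⟩ | ⟨x, rfl⟩
  · exact Or.inl ⟨Sum.inl x, rfl⟩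
  · exact Or.inr ⟨Sum.inl x, rfl⟩
  · exact Or.inl ⟨Sum.inr (Sum.inl x), rfl⟩
  · exact Or.inr ⟨Sum.inr (Sum.inl x), rfl⟩
  · exact Or.inl ⟨Sum.inr (Sum.inr x), rfl⟩
  · exact Or.inr ⟨Sum.inr (Sum.inr x), rfl⟩

theorem outer_leftPt (x : Pt a c) :
    (outer (leftPt a' c' x) : _ ⊕ Fin (b + b') ⊕ _) = left3 a' b' c' (outer x) := by
  rcases x with x | x <;> rfl

theorem outer_rightPt (x : Pt a' c') :
    (outer (rightPt a c x) : _ ⊕ Fin (b + b') ⊕ _) = right3 a b c (outer x) := by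
  rcases x with x | x <;> rfl

theorem exists_outer_left3 (x : Fin a ⊕ Fin b ⊕ Fin c) :
    (∃ y, outer y = left3 a' b' c' x) ↔ ∃ y, outer y = x := by
  constructor
  · rintro ⟨y, hy⟩
    rcases eq_leftPt_or y with ⟨z, rfl⟩ | ⟨z, rfl⟩
    · rw [outer_leftPt] at hy
      exact ⟨z, left3_injective hy⟩
    · rw [outer_rightPt] at hy
      exact absurd hy.symm (left3_ne_right3 _ _)
  · rintro ⟨y, rfl⟩
    exact ⟨leftPt a' c' y, outer_leftPt y⟩

theorem exists_outer_right3 (x : Fin a' ⊕ Fin b' ⊕ Fin c') :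
    (∃ y, outer y = right3 a b c x) ↔ ∃ y, outer y = x := by
  constructor
  · rintro ⟨y, hy⟩
    rcases eq_leftPt_or y with ⟨z, rfl⟩ | ⟨z, rfl⟩
    · rw [outer_leftPt] at hy
      exact absurd hy (left3_ne_right3 _ _)
    · rw [outer_rightPt] at hy
      exact ⟨z, right3_injective hy⟩
  · rintro ⟨y, rfl⟩
    exact ⟨rightPt a c y, outer_rightPt y⟩

theorem glue_tensor (D : Diagram a b) (E : Diagram b c) (D' : Diagram a' b')
    (E' : Diagram b' c') : glue (D.tensor D').rel (E.tensor E').rel =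
      (glue D.rel E.rel).map (left3 a' b' c') ⊔ (glue D'.rel E'.rel).map (right3 a b c) := by
  unfold glue tensor
  simp only [map_sup, map_map]
  have h1 : (Sum.map id Sum.inl ∘ leftPt a' b' : Pt a b → _ ⊕ _ ⊕ Fin (c + c')) =
      left3 a' b' c' ∘ Sum.map id Sum.inl := by funext x; rcases x with x | x <;> rfl
  have h2 : (Sum.map id Sum.inl ∘ rightPt a b : Pt a' b' → _ ⊕ _ ⊕ Fin (c + c')) =
      right3 a b c ∘ Sum.map id Sum.inl := by funext x; rcases x with x | x <;> rfl
  have h3 : (Sum.inr ∘ leftPt b' c' : Pt b c → Fin (a + a') ⊕ _ ⊕ _) =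
      left3 a' b' c' ∘ Sum.inr := by funext x; rcases x with x | x <;> rfl
  have h4 : (Sum.inr ∘ rightPt b c : Pt b' c' → Fin (a + a') ⊕ _ ⊕ _) =
      right3 a b c ∘ Sum.inr := by funext x; rcases x with x | x <;> rfl
  rw [h1, h2, h3, h4]
  exact sup_sup_sup_comm _ _ _ _

theorem tensor_comp (D : Diagram a b) (E : Diagram b c) (D' : Diagram a' b')
    (E' : Diagram b' c') :
    (D.comp E).tensor (D'.comp E') = (D.tensor D').comp (E.tensor E') := by
  apply Diagram.ext
  change _ = (glue (D.tensor D').rel (E.tensor E').rel).comap outer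
  rw [glue_tensor]
  apply le_antisymm
  · apply sup_le
    · rw [map_le_iff]
      intro x y h
      rw [Setoid.comap_rel, outer_leftPt, outer_leftPt]
      exact (le_sup_left : _ ≤ (glue D.rel E.rel).map (left3 a' b' c') ⊔ _) (map_apply _ h)
    · rw [map_le_iff]
      intro x y h
      rw [Setoid.comap_rel, outer_rightPt, outer_rightPt]
      exact (le_sup_right : _ ≤ _ ⊔ (glue D'.rel E'.rel).map (right3 a b c)) (map_apply _ h)
  · intro z w h
    rw [Setoid.comap_rel] at h
    rcases eq_leftPt_or z with ⟨x, rfl⟩ | ⟨x, rfl⟩ <;>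
      rcases eq_leftPt_or w with ⟨y, rfl⟩ | ⟨y, rfl⟩ <;>
      simp only [outer_leftPt, outer_rightPt] at h
    · rw [sup_map_left_iff _ _ left3_injective right3_injective left3_ne_right3] at h
      exact (le_sup_left : _ ≤ ((D.comp E).tensor (D'.comp E')).rel)
        (map_apply (leftPt a' c') h)
    · exact absurd h (sup_map_left_right _ _ left3_injective right3_injective left3_ne_right3)
    · exact absurd (Setoid.symm' _ h)
        (sup_map_left_right _ _ left3_injective right3_injective left3_ne_right3)
    · rw [sup_map_right_iff _ _ left3_injective right3_injective left3_ne_right3] at h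
      exact (le_sup_right : _ ≤ ((D.comp E).tensor (D'.comp E')).rel)
        (map_apply (rightPt a c) h)

theorem loops_tensor (D : Diagram a b) (E : Diagram b c) (D' : Diagram a' b')
    (E' : Diagram b' c') : loops (D.tensor D').rel (E.tensor E').rel =
      loops D.rel E.rel + loops D'.rel E'.rel := by
  unfold loops
  rw [glue_tensor]
  exact unhit_sup_disjoint _ _ left3_injective right3_injective left3_ne_right3 eq_left3_or
    exists_outer_left3 exists_outer_right3

end Tensor

theorem comp_assoc {e : ℕ} (D : Diagram a b) (E : Diagram b c) (F : Diagram c e) :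
    (D.comp E).comp F = D.comp (E.comp F) :=
  Diagram.ext (compRel_assoc D.rel E.rel F.rel)

theorem one_comp (D : Diagram a b) : (one a).comp D = D :=
  Diagram.ext (compRel_idRel_left D.rel)

theorem comp_one (D : Diagram a b) : D.comp (one b) = D :=
  Diagram.ext (compRel_idRel_right D.rel)

theorem eq_rev {x y : Fin 2} (h : y ≠ x) : y = x.rev := by
  revert x y; decide

/-- The arc joining two lower points. -/
def cap : Diagram 2 0 where
  rel := ⊤
  matched := by
    rintro (x | x)
    · refine ⟨Sum.inl x.rev, ⟨?_, trivial⟩, ?_⟩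
      · intro h
        have h' := Sum.inl_injective h
        revert h'; revert x; decide
      · rintro (y | y) ⟨h, _⟩
        · have h' : y ≠ x := fun e => h (congrArg _ e)
          congr 1
          exact eq_rev h'
        · exact y.elim0
    · exact x.elim0
  planar := by
    rintro (p | p) (q | q) (r | r) (s | s) h1 h2 h3 <;>
      first
      | exact p.elim0
      | exact q.elim0
      | exact r.elim0
      | exact s.elim0
      | (simp only [pos] at h1 h2 h3; omega)

/-- The arc joining two upper points. -/
def cup : Diagram 0 2 where
  rel := ⊤
  matched := by
    rintro (x | x)
    · exact x.elim0
    · refine ⟨Sum.inr x.rev, ⟨?_, trivial⟩, ?_⟩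
      · intro h
        have h' := Sum.inr_injective h
        revert h'; revert x; decide
      · rintro (y | y) ⟨h, _⟩
        · exact y.elim0
        · have h' : y ≠ x := fun e => h (congrArg _ e)
          congr 1
          exact eq_rev h'
  planar := by
    rintro (p | p) (q | q) (r | r) (s | s) h1 h2 h3 <;>
      first
      | exact p.elim0
      | exact q.elim0
      | exact r.elim0
      | exact s.elim0
      | (simp only [pos] at h1 h2 h3; omega)

end Diagram

/-! ### The Temperley-Lieb category -/

/-- The bilinear composition of linear combinations of diagrams: stack the diagrams and replace
each closed loop by the number `d`. The first argument is the lower diagram. -/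
noncomputable def compLin (d : ℂ) (a b c : ℕ) :
    (Diagram a b →₀ ℂ) →ₗ[ℂ] (Diagram b c →₀ ℂ) →ₗ[ℂ] (Diagram a c →₀ ℂ) :=
  Finsupp.linearCombination ℂ fun D : Diagram a b =>
    Finsupp.linearCombination ℂ fun E : Diagram b c =>
      Finsupp.single (D.comp E) (d ^ loops D.rel E.rel)

/-- The bilinear extension of the juxtaposition of diagrams. -/
noncomputable def tensorLin (a b a' b' : ℕ) :
    (Diagram a b →₀ ℂ) →ₗ[ℂ] (Diagram a' b' →₀ ℂ) →ₗ[ℂ] (Diagram (a + a') (b + b') →₀ ℂ) :=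
  Finsupp.linearCombination ℂ fun D : Diagram a b =>
    Finsupp.linearCombination ℂ fun E : Diagram a' b' => Finsupp.single (D.tensor E) 1

@[simp]
theorem compLin_single (d : ℂ) {a b c : ℕ} (D : Diagram a b) (E : Diagram b c) (x y : ℂ) :
    compLin d a b c (Finsupp.single D x) (Finsupp.single E y) =
      Finsupp.single (D.comp E) (x * y * d ^ loops D.rel E.rel) := by
  rw [compLin, Finsupp.linearCombination_single, LinearMap.smul_apply,
    Finsupp.linearCombination_single, Finsupp.smul_single, Finsupp.smul_single, smul_eq_mul,
    smul_eq_mul, mul_assoc]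

@[simp]
theorem tensorLin_single {a b a' b' : ℕ} (D : Diagram a b) (E : Diagram a' b') (x y : ℂ) :
    tensorLin a b a' b' (Finsupp.single D x) (Finsupp.single E y) =
      Finsupp.single (D.tensor E) (x * y) := by
  rw [tensorLin, Finsupp.linearCombination_single, LinearMap.smul_apply,
    Finsupp.linearCombination_single, Finsupp.smul_single, Finsupp.smul_single, smul_eq_mul,
    smul_eq_mul, mul_one]

theorem compLin_assoc (d : ℂ) {a b c e : ℕ} (f : Diagram a b →₀ ℂ) (g : Diagram b c →₀ ℂ)
    (h : Diagram c e →₀ ℂ) :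
    compLin d a c e (compLin d a b c f g) h = compLin d a b e f (compLin d b c e g h) := by
  induction f using Finsupp.induction_linear with
  | zero => simp
  | add f f' hf hf' => simp only [map_add, LinearMap.add_apply, hf, hf']
  | single D x =>
    induction g using Finsupp.induction_linear with
    | zero => simp
    | add g g' hg hg' => simp only [map_add, LinearMap.add_apply, hg, hg']
    | single E y =>
      induction h using Finsupp.induction_linear with
      | zero => simp
      | add h h' hh hh' => simp only [map_add, LinearMap.add_apply, hh, hh']
      | single F z =>
        have key := loops_assoc D.rel E.rel F.rel
        simp only [compLin_single, Diagram.comp_assoc]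
        congr 1
        have e1 : (D.comp E).rel = compRel D.rel E.rel := rfl
        have e2 : (E.comp F).rel = compRel E.rel F.rel := rfl
        have e3 : d ^ loops D.rel E.rel * d ^ loops (compRel D.rel E.rel) F.rel =
            d ^ loops E.rel F.rel * d ^ loops D.rel (compRel E.rel F.rel) := by
          rw [← pow_add, ← pow_add, key]
        rw [e1, e2]
        linear_combination x * y * z * e3

theorem one_compLin (d : ℂ) {a b : ℕ} (f : Diagram a b →₀ ℂ) :
    compLin d a a b (Finsupp.single (Diagram.one a) 1) f = f := by
  induction f using Finsupp.induction_linear with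
  | zero => simp
  | add f f' hf hf' => simp only [map_add, LinearMap.add_apply, hf, hf']
  | single D x =>
    have e : loops (Diagram.one a).rel D.rel = 0 := loops_idRel_left D.rel
    simp [Diagram.one_comp, e]

theorem compLin_one (d : ℂ) {a b : ℕ} (f : Diagram a b →₀ ℂ) :
    compLin d a b b f (Finsupp.single (Diagram.one b) 1) = f := by
  induction f using Finsupp.induction_linear with
  | zero => simp
  | add f f' hf hf' => simp only [map_add, LinearMap.add_apply, hf, hf']
  | single D x =>
    have e : loops D.rel (Diagram.one b).rel = 0 := loops_idRel_right D.rel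
    simp [Diagram.comp_one, e]

theorem tensorLin_compLin (d : ℂ) {a b c a' b' c' : ℕ} (f : Diagram a b →₀ ℂ)
    (g : Diagram b c →₀ ℂ) (f' : Diagram a' b' →₀ ℂ) (g' : Diagram b' c' →₀ ℂ) :
    tensorLin a c a' c' (compLin d a b c f g) (compLin d a' b' c' f' g') =
      compLin d (a + a') (b + b') (c + c') (tensorLin a b a' b' f f')
        (tensorLin b c b' c' g g') := by
  induction f using Finsupp.induction_linear with
  | zero => simp
  | add f1 f2 h1 h2 => simp only [map_add, LinearMap.add_apply, h1, h2]
  | single D x =>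
    induction g using Finsupp.induction_linear with
    | zero => simp
    | add f1 f2 h1 h2 => simp only [map_add, LinearMap.add_apply, h1, h2]
    | single E y =>
      induction f' using Finsupp.induction_linear with
      | zero => simp
      | add f1 f2 h1 h2 => simp only [map_add, LinearMap.add_apply, h1, h2]
      | single D' x' =>
        induction g' using Finsupp.induction_linear with
        | zero => simp
        | add f1 f2 h1 h2 => simp only [map_add, LinearMap.add_apply, h1, h2]
        | single E' y' =>
          simp only [compLin_single, tensorLin_single, Diagram.tensor_comp,
            Diagram.loops_tensor, pow_add]
          congr 1
          ring

/-- The Temperley-Lieb category `K_d` with loop parameter `d`: the objects are the natural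
numbers, the object `⟨n⟩` being the `n`-th tensor power of the generator `⟨1⟩`. -/
@[ext]
structure TLCat (d : ℂ) where
  strands : ℕ

namespace TLCat

variable {d : ℂ}

/-- A morphism `⟨a⟩ ⟶ ⟨b⟩` is a linear combination of diagrams with `a` lower and `b` upper points
(diagrams are read from bottom to top). -/
noncomputable instance : Category (TLCat d) where
  Hom A B := Diagram A.strands B.strands →₀ ℂ
  id A := Finsupp.single (Diagram.one A.strands) 1
  comp f g := compLin d _ _ _ f g
  id_comp f := one_compLin d f
  comp_id f := compLin_one d f
  assoc f g h := compLin_assoc d f g h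

noncomputable instance : Preadditive (TLCat d) where
  homGroup A B := inferInstanceAs (AddCommGroup (Diagram A.strands B.strands →₀ ℂ))
  add_comp _ _ _ f f' g := LinearMap.map_add₂ (compLin d _ _ _) f f' g
  comp_add _ _ _ f g g' := LinearMap.map_add (compLin d _ _ _ f) g g'

noncomputable instance : Linear ℂ (TLCat d) where
  homModule A B := inferInstanceAs (Module ℂ (Diagram A.strands B.strands →₀ ℂ))
  smul_comp _ _ _ r f g := LinearMap.map_smul₂ (compLin d _ _ _) r f g
  comp_smul _ _ _ f r g := LinearMap.map_smul (compLin d _ _ _ f) r g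

/-- The morphism given by a single diagram. -/
noncomputable def ofDiagram {a b : ℕ} (D : Diagram a b) : (⟨a⟩ : TLCat d) ⟶ ⟨b⟩ :=
  Finsupp.single D 1

/-- The tensor product of objects. -/
def tensorObj (A B : TLCat d) : TLCat d := ⟨A.strands + B.strands⟩

/-- The tensor product of morphisms, given by juxtaposition of diagrams. -/
noncomputable def tensorHom {A B A' B' : TLCat d} (f : A ⟶ B) (g : A' ⟶ B') :
    tensorObj A A' ⟶ tensorObj B B' :=
  tensorLin _ _ _ _ f g

theorem tensorHom_id (A B : TLCat d) : tensorHom (𝟙 A) (𝟙 B) = 𝟙 (tensorObj A B) := by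
  have h := tensorLin_single (Diagram.one A.strands) (Diagram.one B.strands) 1 1
  rw [Diagram.tensor_one, mul_one] at h
  exact h

theorem tensorHom_comp {A B C A' B' C' : TLCat d} (f : A ⟶ B) (g : B ⟶ C) (f' : A' ⟶ B')
    (g' : B' ⟶ C') :
    tensorHom (f ≫ g) (f' ≫ g') = tensorHom f f' ≫ tensorHom g g' :=
  tensorLin_compLin d f g f' g'

/-- The tensor product `pA ⊗ qB = (p ⊗ q)(A ⊗ B)` of objects of the idempotent completion. -/
noncomputable def karoubiTensor (P Q : Idempotents.Karoubi (TLCat d)) :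
    Idempotents.Karoubi (TLCat d) where
  X := tensorObj P.X Q.X
  p := tensorHom P.p Q.p
  idem := by rw [← tensorHom_comp, P.idem, Q.idem]

/-- The elementary diagram consisting of `k` vertical lines followed, on the right, by a pair of
horizontal arcs joining the last two lower points and the last two upper points. -/
noncomputable def elementary (k : ℕ) : (⟨k + 2⟩ : TLCat d) ⟶ ⟨k + 2⟩ :=
  ofDiagram ((Diagram.one k).tensor (Diagram.cap.comp Diagram.cup))

end TLCat

/-- The quantum integer `[n]_q = q ^ (n-1) + q ^ (n-3) + ... + q ^ (1-n)`, which equals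
`(q ^ n - q ^ (-n)) / (q - q ^ (-1))` when `q ^ 2 ≠ 1`. -/
noncomputable def quantumInt (q : ℂ) (n : ℕ) : ℂ :=
  ∑ i ∈ Finset.range n, q ^ ((n : ℤ) - 1 - 2 * i)

/-- The endomorphisms `f_k` of the `k`-th tensor power of the generator, defined by Wenzl's
recursion. -/
noncomputable def wenzl (q : ℂ) : (k : ℕ) → ((⟨k⟩ : TLCat (q + q⁻¹)) ⟶ ⟨k⟩)
  | 0 => 𝟙 _
  | 1 => 𝟙 _
  | k + 2 =>
    let F : (⟨k + 2⟩ : TLCat (q + q⁻¹)) ⟶ ⟨k + 2⟩ :=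
      TLCat.tensorHom (A := ⟨k + 1⟩) (B := ⟨k + 1⟩) (A' := ⟨1⟩) (B' := ⟨1⟩)
        (wenzl q (k + 1)) (𝟙 _)
    F - (quantumInt q (k + 1) / quantumInt q (k + 2)) • (F ≫ TLCat.elementary k ≫ F)

/-! ### Semisimplicity and direct sums in linear categories -/

/-- A linear category is essentially semisimple if its hom-spaces are finite-dimensional and, for
every finite family of objects, the endomorphism algebra of their formal direct sum is
semisimple. -/
def IsEssentiallySemisimple (C : Type*) [Category C] [Preadditive C] [Linear ℂ C] : Prop :=
  (∀ A B : C, FiniteDimensional ℂ (A ⟶ B)) ∧ ∀ M : Mat_ C, IsSemisimpleRing (End M)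

/-- `A` is a direct sum of the finite family `B`. -/
def IsDirectSum {C : Type*} [Category C] [Preadditive C] {ι : Type*} [Fintype ι]
    (A : C) (B : ι → C) : Prop :=
  ∃ (α : ∀ i, B i ⟶ A) (β : ∀ i, A ⟶ B i),
    (∀ i, α i ≫ β i = 𝟙 (B i)) ∧ (∀ i j, i ≠ j → α j ≫ β i = 0) ∧ ∑ i, β i ≫ α i = 𝟙 A

end TemperleyLieb

namespace TemperleyLieb

/-! ### Diagram calculus -/

namespace Diagram

variable {a b c a' b' c' : ℕ}

/-! Everything rests on the Jones-Wenzl idempotents `f_k`. The root of unity hypothesis makes all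
`[n]_q` with `n ≥ 1` non-zero (`quantumInt_ne_zero`), so Wenzl's recursion never divides by zero.
One induction (`wenzlProps`) shows that `f_{k+1}` is idempotent, that it absorbs `f_k ⊗ 1` on both
sides, and that closing its last strand gives `[k+2]/[k+1]` times `f_k`. The coefficient in the
recursion is the inverse of this scalar, which is exactly what makes a cap or cup on the last two
strands annihilate `f_{k+2}`; absorption carries the annihilation to any two neighbouring strands
(`hook_comp_wenzl`, `wenzl_comp_hook`).

A planar diagram other than the identity has an innermost arc on its lower or upper edge, joining
neighbouring points (`Diagram.trichotomy`), and then a hook can be split off, up to a power of the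
non-zero number `d = [2]_q`. Hence `f_j D f_k` vanishes unless `D` is an identity, which is Schur's
lemma for the `X_k`. Read backwards, the recursion says that `f_{k+1} ⊗ 1` is `f_{k+2}` plus a term
factoring through `f_k`; adding strands one at a time, the identity of every object lies in the
ideal generated by the `f_k` (`id_mem_span_wenzl`).

The rest of the semisimplicity is formal (`IsSchurFamily`). If mutually orthogonal objects with
scalar endomorphisms generate all identities, then composition pairs `Hom(X_k, Y)` non-degenerately
with `Hom(Y, X_k)`. Dual bases split `Y` into copies of the `X_k`, with multiplicities `dim Hom(X_k,
Y)`. The same pairing gives for each `f ≠ 0` some `g ≠ 0` with `gfg = g`, so a matrix algebra of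
morphisms has no Jacobson radical.

For the fusion rule, the recursion splits `X_{k+1} ⊗ X_1` into `X_{k+2} ⊕ X_k`. Decomposing `X_j ⊗
X_{k+1} ⊗ X_1` with either bracketing gives a recursion in `k` for the multiplicities
(`fusionMult_add_two`), whose solution is the Clebsch-Gordan indicator. -/

theorem eq_of_rel_partner {D E : Diagram a b} (h : ∀ x, E.rel x (D.partner x)) : D = E := by
  apply Diagram.ext
  ext x y
  -- Every class has exactly two points, so one inclusion between the sets of arcs already forces
  -- equality.
  rw [rel_iff, rel_iff, ← E.eq_partner (D.partner_ne x) (h x)]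

theorem partner_eq (D : Diagram a b) {x y : Pt a b} (hne : y ≠ x) (h : D.rel x y) :
    D.partner x = y :=
  (D.eq_partner hne h).symm

theorem glue_lower (D : Diagram a b) (E : Diagram b c) {x y : Pt a b} (h : D.rel x y) :
    glue D.rel E.rel (Sum.map id Sum.inl x) (Sum.map id Sum.inl y) :=
  (le_sup_left : _ ≤ glue D.rel E.rel) (map_apply (Sum.map id Sum.inl) h)

theorem glue_upper (D : Diagram a b) (E : Diagram b c) {x y : Pt b c} (h : E.rel x y) :
    glue D.rel E.rel (Sum.inr x) (Sum.inr y) :=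
  (le_sup_right : _ ≤ glue D.rel E.rel) (map_apply Sum.inr h)

theorem tensor_left (D : Diagram a b) (E : Diagram a' b') {x y : Pt a b} (h : D.rel x y) :
    (D.tensor E).rel (leftPt a' b' x) (leftPt a' b' y) :=
  (le_sup_left : _ ≤ (D.tensor E).rel) (map_apply _ h)

theorem tensor_right (D : Diagram a b) (E : Diagram a' b') {x y : Pt a' b'} (h : E.rel x y) :
    (D.tensor E).rel (rightPt a b x) (rightPt a b y) :=
  (le_sup_right : _ ≤ (D.tensor E).rel) (map_apply _ h)

theorem partner_tensor_left (D : Diagram a b) (E : Diagram a' b') (x : Pt a b) :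
    (D.tensor E).partner (leftPt a' b' x) = leftPt a' b' (D.partner x) :=
  partner_eq _ (fun e => D.partner_ne x (leftPt_injective e)) (tensor_left D E (D.rel_partner x))

theorem partner_tensor_right (D : Diagram a b) (E : Diagram a' b') (x : Pt a' b') :
    (D.tensor E).partner (rightPt a b x) = rightPt a b (E.partner x) :=
  partner_eq _ (fun e => E.partner_ne x (rightPt_injective e)) (tensor_right D E (E.rel_partner x))

/-! ### Strict unit and associativity for added strands -/

theorem tensor_one_zero (D : Diagram a b) : D.tensor (one 0) = D := by
  symm
  apply eq_of_rel_partner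
  intro x
  have h := tensor_left D (one 0) (D.rel_partner x)
  have e : ∀ y : Pt a b, (leftPt 0 0 y : Pt a b) = y := by
    rintro (y | y) <;> rfl
  have e1 := e x
  have e2 := e (D.partner x)
  rw [e1, e2] at h
  exact h

/-- Tensoring with a single strand is the case in which both sides have the same type by
computation, as `a + a' + 1` and `a + (a' + 1)` are definitionally equal. The fusion recursion needs
no other associativity. -/
theorem tensor_assoc_one (D : Diagram a b) (E : Diagram a' b') :
    (D.tensor E).tensor (one 1) = D.tensor (E.tensor (one 1)) := by
  symm
  apply eq_of_rel_partner
  intro z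
  change Pt (a + (a' + 1)) (b + (b' + 1)) at z
  rcases eq_leftPt_or z with ⟨x, rfl⟩ | ⟨x, rfl⟩
  · rw [partner_tensor_left]
    have h := tensor_left (D.tensor E) (one 1) (tensor_left D E (D.rel_partner x))
    have e : ∀ y : Pt a b, (leftPt 1 1 (leftPt a' b' y) : Pt (a + a' + 1) (b + b' + 1)) =
      (leftPt (a' + 1) (b' + 1) y : Pt (a + (a' + 1)) (b + (b' + 1))) := by
      rintro (y | y) <;> rfl
    have e1 := e x
    have e2 := e (D.partner x)
    rw [e1, e2] at h
    exact h
  · rcases eq_leftPt_or x with ⟨x, rfl⟩ | ⟨x, rfl⟩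
    · rw [partner_tensor_right, partner_tensor_left]
      have h := tensor_left (D.tensor E) (one 1) (tensor_right D E (E.rel_partner x))
      have e : ∀ y : Pt a' b', (leftPt 1 1 (rightPt a b y) : Pt (a + a' + 1) (b + b' + 1)) =
        (rightPt a b (leftPt 1 1 y) : Pt (a + (a' + 1)) (b + (b' + 1))) := by
        rintro (y | y) <;> rfl
      have e1 := e x
      have e2 := e (E.partner x)
      rw [e1, e2] at h
      exact h
    · rw [partner_tensor_right, partner_tensor_right]
      have h := tensor_right (D.tensor E) (one 1) ((one 1).rel_partner x)
      have e : ∀ y : Pt 1 1, (rightPt (a + a') (b + b') y : Pt (a + a' + 1) (b + b' + 1)) =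
        (rightPt a b (rightPt a' b' y) : Pt (a + (a' + 1)) (b + (b' + 1))) := by
        rintro (y | y)
        · apply congrArg Sum.inl
          apply Fin.ext
          simp
        · apply congrArg Sum.inr
          apply Fin.ext
          simp
      have e1 := e x
      have e2 := e ((one 1).partner x)
      rw [e1, e2] at h
      exact h

theorem eq_one_of_rel {D : Diagram a a} (h : ∀ x, D.rel (Sum.inl x) (Sum.inr x)) : D = one a := by
  symm
  apply eq_of_rel_partner
  rintro (x | x)
  · rw [partner_eq (one a) (x := Sum.inl x) (y := Sum.inr x) (by simp) rfl]
    exact h x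
  · rw [partner_eq (one a) (x := Sum.inr x) (y := Sum.inl x) (by simp) rfl]
    exact D.rel.symm' (h x)

/-! ### Hooks as left and right factors of diagrams -/

/-- `i` vertical lines, a pair of horizontal arcs, and `j` vertical lines. -/
def hook (i : ℕ) : (j : ℕ) → Diagram (i + 2 + j) (i + 2 + j)
  | 0 => (one i).tensor (cap.comp cup)
  -- Strands are added on the right to match Wenzl's recursion: annihilation then passes from `j` to
  -- `j + 1` by absorption.
  | j + 1 => (hook i j).tensor (one 1)

theorem hook_lower (i j : ℕ) :
    (hook i j).rel (Sum.inl ⟨i, by omega⟩) (Sum.inl ⟨i + 1, by omega⟩) := by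
  induction j with
  | zero =>
    have h : (cap.comp cup).rel (Sum.inl 0) (Sum.inl 1) :=
      glue_lower cap cup (x := Sum.inl 0) (y := Sum.inl 1) trivial
    exact tensor_right (one i) (cap.comp cup) h
  | succ j ih => exact tensor_left (hook i j) (one 1) ih

theorem hook_upper (i j : ℕ) :
    (hook i j).rel (Sum.inr ⟨i, by omega⟩) (Sum.inr ⟨i + 1, by omega⟩) := by
  induction j with
  | zero =>
    have h : (cap.comp cup).rel (Sum.inr 0) (Sum.inr 1) :=
      glue_upper cap cup (x := Sum.inr 0) (y := Sum.inr 1) trivial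
    exact tensor_right (one i) (cap.comp cup) h
  | succ j ih => exact tensor_left (hook i j) (one 1) ih

theorem one_rel (x : Fin a) : (one a).rel (Sum.inl x) (Sum.inr x) := rfl

theorem hook_through (i j : ℕ) (x : Fin (i + 2 + j)) (h : x.val ≠ i) (h' : x.val ≠ i + 1) :
    (hook i j).rel (Sum.inl x) (Sum.inr x) := by
  induction j with
  | zero =>
    have hx : x.val < i := by have := x.2; omega
    exact tensor_left (one i) (cap.comp cup) (one_rel ⟨x.val, hx⟩)
  | succ j ih =>
    by_cases hx : x.val < i + 2 + j
    · exact tensor_left (hook i j) (one 1) (ih ⟨x.val, hx⟩ h h')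
    · have e : x = Fin.natAdd (i + 2 + j) (0 : Fin 1) := by
        apply Fin.ext
        have := x.2
        simp only [Fin.val_natAdd]
        omega
      rw [e]
      exact tensor_right (hook i j) (one 1) (one_rel 0)

/-- The upper arc of the hook and the arc of `D` close up to a loop, which `comp` discards, and the
lower arc of the hook takes the place of the arc of `D`. So every diagram with such an arc factors
through a hook. -/
theorem hook_comp {i j : ℕ} (D : Diagram (i + 2 + j) b)
    (h : D.rel (Sum.inl ⟨i, by omega⟩) (Sum.inl ⟨i + 1, by omega⟩)) : (hook i j).comp D = D := by
  symm
  apply eq_of_rel_partner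
  intro x
  have hne : (Sum.inl ⟨i + 1, by omega⟩ : Pt (i + 2 + j) b) ≠ Sum.inl ⟨i, by omega⟩ := by simp
  have e1 := D.partner_eq hne h
  have e2 := D.partner_eq hne.symm (D.rel.symm' h)
  -- Away from the two ends of the arc, the hook only prolongs the strands of `D`.
  have key : ∀ y : Pt (i + 2 + j) b, y ≠ Sum.inl ⟨i, by omega⟩ → y ≠ Sum.inl ⟨i + 1, by omega⟩ →
      glue (hook i j).rel D.rel (outer y) (Sum.inr y) := by
    rintro (y | y) h1 h2
    · exact glue_lower (hook i j) D (x := Sum.inl y) (y := Sum.inr y) (hook_through i j y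
        (fun e => h1 (congrArg Sum.inl (Fin.ext e))) (fun e => h2 (congrArg Sum.inl (Fin.ext e))))
    · exact Setoid.refl' _ _
  by_cases h1 : x = Sum.inl ⟨i, by omega⟩
  · rw [h1, e1]
    exact glue_lower (hook i j) D (hook_lower i j)
  by_cases h2 : x = Sum.inl ⟨i + 1, by omega⟩
  · rw [h2, e2]
    exact Setoid.symm' _ (glue_lower (hook i j) D (hook_lower i j))
  have h3 : D.partner x ≠ Sum.inl ⟨i, by omega⟩ := fun e => h2 (by
    rw [← e1, ← e, D.partner_partner])
  have h4 : D.partner x ≠ Sum.inl ⟨i + 1, by omega⟩ := fun e => h1 (by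
    rw [← e2, ← e, D.partner_partner])
  exact Setoid.trans' (glue (hook i j).rel D.rel) (key x h1 h2)
    (Setoid.trans' _ (glue_upper _ D (D.rel_partner x)) (Setoid.symm' _ (key _ h3 h4)))

/-- Upside-down version of `hook_comp`. -/
theorem comp_hook {i j : ℕ} (D : Diagram a (i + 2 + j))
    (h : D.rel (Sum.inr ⟨i, by omega⟩) (Sum.inr ⟨i + 1, by omega⟩)) : D.comp (hook i j) = D := by
  symm
  apply eq_of_rel_partner
  intro x
  have hne : (Sum.inr ⟨i + 1, by omega⟩ : Pt a (i + 2 + j)) ≠ Sum.inr ⟨i, by omega⟩ := by simp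
  have e1 := D.partner_eq hne h
  have e2 := D.partner_eq hne.symm (D.rel.symm' h)
  have key : ∀ y : Pt a (i + 2 + j), y ≠ Sum.inr ⟨i, by omega⟩ → y ≠ Sum.inr ⟨i + 1, by omega⟩ →
      glue D.rel (hook i j).rel (outer y) (Sum.map id Sum.inl y) := by
    rintro (y | y) h1 h2
    · exact Setoid.refl' _ _
    · exact Setoid.symm' _ (glue_upper D (hook i j) (x := Sum.inl y) (y := Sum.inr y)
        (hook_through i j y (fun e => h1 (congrArg Sum.inr (Fin.ext e)))
          (fun e => h2 (congrArg Sum.inr (Fin.ext e)))))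
  by_cases h1 : x = Sum.inr ⟨i, by omega⟩
  · rw [h1, e1]
    exact glue_upper D (hook i j) (hook_upper i j)
  by_cases h2 : x = Sum.inr ⟨i + 1, by omega⟩
  · rw [h2, e2]
    exact Setoid.symm' _ (glue_upper D (hook i j) (hook_upper i j))
  have h3 : D.partner x ≠ Sum.inr ⟨i, by omega⟩ := fun e => h2 (by
    rw [← e1, ← e, D.partner_partner])
  have h4 : D.partner x ≠ Sum.inr ⟨i + 1, by omega⟩ := fun e => h1 (by
    rw [← e2, ← e, D.partner_partner])
  exact Setoid.trans' (glue D.rel (hook i j).rel) (key x h1 h2)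
    (Setoid.trans' _ (glue_lower D _ (D.rel_partner x)) (Setoid.symm' _ (key _ h3 h4)))

/-! ### Innermost arcs -/

theorem exists_pos_eq {t : ℤ} (h1 : -(b : ℤ) ≤ t) (h2 : t < a) : ∃ z : Pt a b, pos z = t := by
  by_cases h : 0 ≤ t
  · exact ⟨Sum.inl ⟨t.toNat, by omega⟩, by simp only [pos]; omega⟩
  · exact ⟨Sum.inr ⟨(-1 - t).toNat, by omega⟩, by simp only [pos]; omega⟩

theorem pos_bounds (x : Pt a b) : -(b : ℤ) ≤ pos x ∧ pos x < a := by
  rcases x with x | x <;> simp only [pos] <;> omega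

/-- Below every arc there is an arc that joins two neighbouring points. -/
theorem exists_adjacent (D : Diagram a b) {x y : Pt a b} (h : D.rel x y) (hxy : pos x < pos y) :
    ∃ x' y', D.rel x' y' ∧ pos x ≤ pos x' ∧ pos y' = pos x' + 1 ∧ pos y' ≤ pos y := by
  obtain ⟨n, hn⟩ : ∃ n : ℕ, pos y - pos x = n := ⟨(pos y - pos x).toNat, by omega⟩
  induction n using Nat.strong_induction_on generalizing x y with
  | _ n ih =>
    by_cases h1 : pos y = pos x + 1
    · exact ⟨x, y, h, le_rfl, h1, le_rfl⟩
    have bx := pos_bounds x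
    have bY := pos_bounds y
    -- The neighbour `z` of `x` lies under the arc. By planarity its partner does too, hence lies
    -- beyond `z`, and the arc from `z` is shorter.
    obtain ⟨z, hz⟩ := exists_pos_eq (a := a) (b := b) (t := pos x + 1) (by omega) (by omega)
    have hyx : y ≠ x := fun e => by rw [e] at hxy; exact lt_irrefl _ hxy
    have ey := D.partner_eq hyx h
    have ex := D.partner_eq hyx.symm (D.rel.symm' h)
    have hw := D.rel_partner z
    have hw1 : pos (D.partner z) ≠ pos z := fun e => D.partner_ne z (pos_injective e)
    have hw2 : pos (D.partner z) ≠ pos x := fun e => by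
      have := D.partner_partner z
      rw [pos_injective e, ey] at this
      rw [this] at h1
      exact h1 hz
    have hw3 : pos (D.partner z) ≠ pos y := fun e => by
      have := D.partner_partner z
      rw [pos_injective e, ex] at this
      rw [this] at hz
      omega
    have hw4 : ¬ pos y < pos (D.partner z) := fun e =>
      D.planar x z y (D.partner z) (by omega) (by omega) e h hw
    have hw5 : ¬ pos (D.partner z) < pos x := fun e =>
      D.planar (D.partner z) x z y e (by omega) (by omega) (D.rel.symm' hw) h
    obtain ⟨x', y', h1, h2, h3, h4⟩ := ih (pos (D.partner z) - pos z).toNat (by omega) hw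
      (by omega) (by omega)
    exact ⟨x', y', h1, by omega, h3, by omega⟩

theorem exists_adjacent_lower (D : Diagram a b) {x y : Fin a} (hne : x ≠ y)
    (h : D.rel (Sum.inl x) (Sum.inl y)) :
    ∃ (i j : ℕ) (e : a = i + 2 + j),
      D.rel (Sum.inl ⟨i, by omega⟩) (Sum.inl ⟨i + 1, by omega⟩) := by
  wlog hxy : x < y generalizing x y
  · exact this hne.symm (D.rel.symm' h) (lt_of_le_of_ne (not_lt.1 hxy) hne.symm)
  obtain ⟨x', y', h1, h2, h3, h4⟩ := D.exists_adjacent h (by simpa [pos] using hxy)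
  -- `pos` passes the whole upper edge before the lower one, so an arc between lower points encloses
  -- lower points only.
  rcases x' with x' | x' <;> rcases y' with y' | y' <;> simp only [pos] at h2 h3 h4
  · have hy := y'.2
    refine ⟨x'.val, a - 2 - x'.val, by omega, ?_⟩
    have e : y' = ⟨x'.val + 1, by omega⟩ := Fin.ext (by simp only; omega)
    rw [e] at h1
    exact h1
  all_goals omega

theorem exists_adjacent_upper (D : Diagram a b) {x y : Fin b} (hne : x ≠ y)
    (h : D.rel (Sum.inr x) (Sum.inr y)) :
    ∃ (i j : ℕ) (e : b = i + 2 + j),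
      D.rel (Sum.inr ⟨i, by omega⟩) (Sum.inr ⟨i + 1, by omega⟩) := by
  -- On the upper edge `pos` runs from right to left, so the order of the indices is reversed.
  wlog hxy : y < x generalizing x y
  · exact this hne.symm (D.rel.symm' h) (lt_of_le_of_ne (not_lt.1 hxy) hne)
  obtain ⟨x', y', h1, h2, h3, h4⟩ := D.exists_adjacent h (by simpa [pos] using hxy)
  rcases x' with x' | x' <;> rcases y' with y' | y' <;> simp only [pos] at h2 h3 h4
  case inr.inr =>
    have hx := x'.2
    refine ⟨y'.val, b - 2 - y'.val, by omega, ?_⟩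
    have e : x' = ⟨y'.val + 1, by omega⟩ := Fin.ext (by simp only; omega)
    rw [e] at h1
    exact D.rel.symm' h1
  all_goals omega

/-- A diagram without caps and cups consists of vertical lines. -/
theorem eq_one_of_no_arcs (D : Diagram a b)
    (hl : ∀ x y : Fin a, x ≠ y → ¬ D.rel (Sum.inl x) (Sum.inl y))
    (hu : ∀ x y : Fin b, x ≠ y → ¬ D.rel (Sum.inr x) (Sum.inr y)) :
    ∃ e : a = b, D = e ▸ one a := by
  have h1 : ∀ x : Fin a, ∃ y : Fin b, D.rel (Sum.inl x) (Sum.inr y) := by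
    intro x
    have h := D.rel_partner (Sum.inl x)
    have hne := D.partner_ne (Sum.inl x)
    rcases e : D.partner (Sum.inl x) with y | y <;> rw [e] at h hne
    · exact absurd h (hl x y fun e => hne (by rw [e]))
    · exact ⟨y, h⟩
  have h2 : ∀ y : Fin b, ∃ x : Fin a, D.rel (Sum.inl x) (Sum.inr y) := by
    intro x
    have h := D.rel_partner (Sum.inr x)
    have hne := D.partner_ne (Sum.inr x)
    rcases e : D.partner (Sum.inr x) with y | y <;> rw [e] at h hne
    · exact ⟨y, D.rel.symm' h⟩
    · exact absurd h (hu x y fun e => hne (by rw [e]))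
  -- All curves are through-strands; planarity makes the resulting bijection `g` between the edges
  -- monotone.
  choose g hg using h1
  have hmono : StrictMono g := by
    intro x y hxy
    by_contra hlt
    rcases (not_lt.1 hlt).lt_or_eq with h | h
    · exact D.planar (Sum.inr (g x)) (Sum.inr (g y)) (Sum.inl x) (Sum.inl y)
        (by simpa [pos] using h) (by simp only [pos]; omega) (by simpa [pos] using hxy)
        (D.rel.symm' (hg x)) (D.rel.symm' (hg y))
    · refine hl x y hxy.ne (D.rel.trans' (hg x) ?_)
      rw [← h]
      exact D.rel.symm' (hg y)
  have hsurj : Function.Surjective g := by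
    intro y
    obtain ⟨x, hx⟩ := h2 y
    refine ⟨x, ?_⟩
    by_contra hne
    exact hu _ _ hne (D.rel.trans' (D.rel.symm' (hg x)) hx)
  let o : Fin a ≃o Fin b := StrictMono.orderIsoOfSurjective g hmono hsurj
  have hab : a = b := by simpa using Fintype.card_congr o.toEquiv
  subst hab
  refine ⟨rfl, ?_⟩
  -- A finite chain has no order automorphism besides the identity.
  have ho : o = OrderIso.refl _ := Subsingleton.elim _ _
  have hgx : ∀ x, g x = x := fun x => congrArg (fun e : Fin a ≃o Fin a => e x) ho
  apply eq_one_of_rel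
  intro x
  have := hg x
  rwa [hgx] at this

/-- A diagram starts with a cap, or ends with a cup, or consists of vertical lines. -/
theorem trichotomy (D : Diagram a b) :
    (∃ (i j : ℕ) (e : a = i + 2 + j),
      D.rel (Sum.inl ⟨i, by omega⟩) (Sum.inl ⟨i + 1, by omega⟩)) ∨
    (∃ (i j : ℕ) (e : b = i + 2 + j),
      D.rel (Sum.inr ⟨i, by omega⟩) (Sum.inr ⟨i + 1, by omega⟩)) ∨
    ∃ e : a = b, D = e ▸ one a := by
  by_cases hl : ∃ x y : Fin a, x ≠ y ∧ D.rel (Sum.inl x) (Sum.inl y)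
  · obtain ⟨x, y, h, h'⟩ := hl
    exact Or.inl (D.exists_adjacent_lower h h')
  by_cases hu : ∃ x y : Fin b, x ≠ y ∧ D.rel (Sum.inr x) (Sum.inr y)
  · obtain ⟨x, y, h, h'⟩ := hu
    exact Or.inr (Or.inl (D.exists_adjacent_upper h h'))
  push Not at hl hu
  exact Or.inr (Or.inr (D.eq_one_of_no_arcs hl hu))

/-! ### Closed loops and snake identities -/

theorem loops_eq_zero (D : Diagram a b) (E : Diagram b c)
    (h : ∀ y : Fin b, ∃ x : Pt a c, glue D.rel E.rel (outer x) (Sum.inr (Sum.inl y))) :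
    loops D.rel E.rel = 0 := by
  -- A loop avoids the boundary, so it could only consist of middle points.
  apply unhit_eq_zero
  rintro (x | x | x)
  · exact ⟨Sum.inl x, Setoid.refl' _ _⟩
  · exact h x
  · exact ⟨Sum.inr x, Setoid.refl' _ _⟩

/-- The first zigzag, from a bottom layer which ends with a cup to a top layer with a cap. -/
theorem zigzag_right (m : ℕ) (D : Diagram (m + 1) (m + 3)) (E : Diagram (m + 3) (m + 1))
    (hD : ∀ x : Fin (m + 1), D.rel (Sum.inl x) (Sum.inr ⟨x, by omega⟩))
    (hD' : D.rel (Sum.inr ⟨m + 1, by omega⟩) (Sum.inr ⟨m + 2, by omega⟩))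
    (hE : ∀ x : Fin m, E.rel (Sum.inl ⟨x, by omega⟩) (Sum.inr ⟨x, by omega⟩))
    (hE' : E.rel (Sum.inl ⟨m, by omega⟩) (Sum.inl ⟨m + 1, by omega⟩))
    (hE'' : E.rel (Sum.inl ⟨m + 2, by omega⟩) (Sum.inr ⟨m, by omega⟩)) :
    D.comp E = one (m + 1) ∧ loops D.rel E.rel = 0 := by
  have h1 := fun x : Fin (m + 1) => glue_lower D E (hD x)
  have h2 := glue_lower D E hD'
  have h3 := glue_upper D E hE'
  have h4 := glue_upper D E hE''
  have t := fun {x y z} => @Setoid.trans' _ (glue D.rel E.rel) x y z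
  constructor
  · apply eq_one_of_rel
    intro x
    by_cases hx : x.val < m
    · exact t (h1 x) (glue_upper D E (hE ⟨x, hx⟩))
    · have e : x = ⟨m, by omega⟩ := Fin.ext (by have := x.2; simp only; omega)
      rw [e]
      exact t (h1 ⟨m, by omega⟩) (t h3 (t h2 h4))
  · apply loops_eq_zero
    intro y
    by_cases hy : y.val < m + 1
    · exact ⟨Sum.inl ⟨y, hy⟩, h1 ⟨y, hy⟩⟩
    by_cases hy' : y.val = m + 1
    · refine ⟨Sum.inl ⟨m, by omega⟩, ?_⟩
      have e : y = ⟨m + 1, by omega⟩ := Fin.ext hy'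
      rw [e]
      exact t (h1 ⟨m, by omega⟩) h3
    · refine ⟨Sum.inl ⟨m, by omega⟩, ?_⟩
      have e : y = ⟨m + 2, by omega⟩ := Fin.ext (by have := y.2; simp only; omega)
      rw [e]
      exact t (h1 ⟨m, by omega⟩) (t h3 h2)

/-- The last strand climbs to the point `m + 2`, returns through the cap to `m + 1`, and leaves
through the cup and the point `m`. Stating the arcs as hypotheses keeps the index types free of the
sums produced by tensor products. -/
theorem zigzag_left (m : ℕ) (D : Diagram (m + 1) (m + 3)) (E : Diagram (m + 3) (m + 1))
    (hD : ∀ x : Fin m, D.rel (Sum.inl ⟨x, by omega⟩) (Sum.inr ⟨x, by omega⟩))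
    (hD' : D.rel (Sum.inr ⟨m, by omega⟩) (Sum.inr ⟨m + 1, by omega⟩))
    (hD'' : D.rel (Sum.inl ⟨m, by omega⟩) (Sum.inr ⟨m + 2, by omega⟩))
    (hE : ∀ x : Fin (m + 1), E.rel (Sum.inl ⟨x, by omega⟩) (Sum.inr x))
    (hE' : E.rel (Sum.inl ⟨m + 1, by omega⟩) (Sum.inl ⟨m + 2, by omega⟩)) :
    D.comp E = one (m + 1) ∧ loops D.rel E.rel = 0 := by
  have h1 := fun x : Fin (m + 1) => glue_upper D E (hE x)
  have h2 := glue_upper D E hE'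
  have h3 := glue_lower D E hD'
  have h4 := glue_lower D E hD''
  have t := fun {x y z} => @Setoid.trans' _ (glue D.rel E.rel) x y z
  have s := fun {x y} => @Setoid.symm' _ (glue D.rel E.rel) x y
  constructor
  · apply eq_one_of_rel
    intro x
    by_cases hx : x.val < m
    · exact t (glue_lower D E (hD ⟨x, hx⟩)) (h1 x)
    · have e : x = ⟨m, by omega⟩ := Fin.ext (by have := x.2; simp only; omega)
      rw [e]
      exact t h4 (t (s h2) (t (s h3) (h1 ⟨m, by omega⟩)))
  · apply loops_eq_zero
    intro y
    by_cases hy : y.val < m + 1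
    · exact ⟨Sum.inr ⟨y, hy⟩, s (h1 ⟨y, hy⟩)⟩
    by_cases hy' : y.val = m + 1
    · refine ⟨Sum.inl ⟨m, by omega⟩, ?_⟩
      have e : y = ⟨m + 1, by omega⟩ := Fin.ext hy'
      rw [e]
      exact t h4 (s h2)
    · refine ⟨Sum.inl ⟨m, by omega⟩, ?_⟩
      have e : y = ⟨m + 2, by omega⟩ := Fin.ext (by have := y.2; simp only; omega)
      rw [e]
      exact h4

/-- One of the two snake identities of the self-dual object `X`, padded by `m` strands. The widths
`m + 1 + 2` and `m + 2 + 1` both reduce to `m + 3`, so the composite needs no transport. -/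
theorem zigzag_cup_cap (m : ℕ) :
    ((one (m + 1)).tensor cup : Diagram (m + 1) (m + 3)).comp
        ((((one m).tensor cap).tensor (one 1) : Diagram (m + 3) (m + 1))) = one (m + 1) ∧
      loops ((one (m + 1)).tensor cup : Diagram (m + 1) (m + 3)).rel
        (((one m).tensor cap).tensor (one 1) : Diagram (m + 3) (m + 1)).rel = 0 :=
  zigzag_right m _ _
    (fun x => tensor_left (one (m + 1)) cup (one_rel x))
    (tensor_right (one (m + 1)) cup (x := Sum.inr 0) (y := Sum.inr 1) trivial)
    (fun x => tensor_left ((one m).tensor cap) (one 1) (tensor_left (one m) cap (one_rel x)))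
    (tensor_left ((one m).tensor cap) (one 1)
      (tensor_right (one m) cap (x := Sum.inl 0) (y := Sum.inl 1) trivial))
    (tensor_right ((one m).tensor cap) (one 1) (one_rel 0))

theorem zigzag_cap_cup (m : ℕ) :
    ((((one m).tensor cup).tensor (one 1) : Diagram (m + 1) (m + 3))).comp
        ((one (m + 1)).tensor cap : Diagram (m + 3) (m + 1)) = one (m + 1) ∧
      loops (((one m).tensor cup).tensor (one 1) : Diagram (m + 1) (m + 3)).rel
        ((one (m + 1)).tensor cap : Diagram (m + 3) (m + 1)).rel = 0 :=
  zigzag_left m _ _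
    (fun x => tensor_left ((one m).tensor cup) (one 1) (tensor_left (one m) cup (one_rel x)))
    (tensor_left ((one m).tensor cup) (one 1)
      (tensor_right (one m) cup (x := Sum.inr 0) (y := Sum.inr 1) trivial))
    (tensor_right ((one m).tensor cup) (one 1) (one_rel 0))
    (fun x => tensor_left (one (m + 1)) cap (one_rel x))
    (tensor_right (one (m + 1)) cap (x := Sum.inl 0) (y := Sum.inl 1) trivial)

theorem cup_comp_cap : cup.comp cap = one 0 := by
  apply eq_one_of_rel
  intro x
  exact x.elim0

theorem loops_cup_cap : loops cup.rel cap.rel = 1 := by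
  have h : ∀ x y, glue cup.rel cap.rel x y := by
    rintro (x | x | x) (y | y | y) <;> first | exact x.elim0 | exact y.elim0 | skip
    exact glue_upper cup cap (x := Sum.inl x) (y := Sum.inl y) trivial
  unfold loops unhit
  rw [Nat.card_eq_one_iff_unique]
  constructor
  · constructor
    rintro ⟨c, hc⟩ ⟨c', hc'⟩
    induction c using Quotient.inductionOn with
    | h x =>
      induction c' using Quotient.inductionOn with
      | h y => exact Subtype.ext (Quotient.sound (h x y))
  · refine ⟨⟨Quotient.mk _ (Sum.inr (Sum.inl 0)), ?_⟩⟩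
    rintro (y | y) <;> exact y.elim0

theorem loops_cap_cup : loops cap.rel cup.rel = 0 :=
  loops_eq_zero cap cup fun y => y.elim0

end Diagram

/-! ### Linear categories generated by a Schur family -/

section Abstract

variable {C : Type*} [Category C] [Preadditive C]

theorem IsDirectSum.reindex {ι κ : Type*} [Fintype ι] [Fintype κ] {A : C} {B : ι → C}
    (h : IsDirectSum A B) (e : κ ≃ ι) : IsDirectSum A (fun i => B (e i)) := by
  obtain ⟨α, β, h1, h2, h3⟩ := h
  refine ⟨fun i => α (e i), fun i => β (e i), fun i => h1 _,
    fun i j hij => h2 _ _ (fun h => hij (e.injective h)), ?_⟩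
  rw [← h3]
  exact e.sum_comp fun i => β i ≫ α i

variable [Linear ℂ C]

/-- The Hom-space into a direct sum is the product of the Hom-spaces into the summands. -/
theorem IsDirectSum.finrank_hom {ι : Type*} [Fintype ι] {A : C} {B : ι → C}
    (h : IsDirectSum A B) (hfd : ∀ A B : C, FiniteDimensional ℂ (A ⟶ B)) (Z : C) :
    Module.finrank ℂ (Z ⟶ A) = ∑ i, Module.finrank ℂ (Z ⟶ B i) := by
  classical
  obtain ⟨α, β, h1, h2, h3⟩ := h
  rw [← Module.finrank_pi_fintype]
  refine LinearEquiv.finrank_eq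
    { toFun := fun f i => f ≫ β i
      map_add' := fun f g => by funext i; exact Preadditive.add_comp _ _ _ _ _ _
      map_smul' := fun z f => by funext i; exact Linear.smul_comp _ _ _ _ _ _
      invFun := fun g => ∑ i, g i ≫ α i
      left_inv := fun f => ?_
      right_inv := fun g => ?_ }
  · simp only [Category.assoc]
    rw [← Preadditive.comp_sum, h3, Category.comp_id]
  · funext i
    simp only
    rw [Preadditive.sum_comp, Finset.sum_eq_single i]
    · rw [Category.assoc, h1, Category.comp_id]
    · intro j _ hj
      rw [Category.assoc, h2 i j hj.symm, Limits.comp_zero]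
    · simp

/-- A linear category is essentially semisimple if its Hom-spaces are finite-dimensional and
all morphisms have sections in the sense of von Neumann regularity. -/
theorem isEssentiallySemisimple_of_regular (hfd : ∀ A B : C, FiniteDimensional ℂ (A ⟶ B))
    (hreg : ∀ {A B : C} (f : A ⟶ B), f ≠ 0 → ∃ g : B ⟶ A, g ≠ 0 ∧ g ≫ f ≫ g = g) :
    IsEssentiallySemisimple C := by
  classical
  refine ⟨hfd, fun M => ?_⟩
  let _ : Module ℂ (End M) := inferInstanceAs (Module ℂ (∀ i j, M.X i ⟶ M.X j))
  have : Module.Finite ℂ (End M) := by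
    have : ∀ i j, Module.Finite ℂ (M.X i ⟶ M.X j) := fun i j => hfd _ _
    exact inferInstanceAs (Module.Finite ℂ (∀ i j, M.X i ⟶ M.X j))
  have : IsScalarTower ℂ (End M) (End M) := by
    constructor
    intro z f g
    apply Mat_.hom_ext
    intro i j
    change ∑ k, g i k ≫ (z • f k j) = z • ∑ k, g i k ≫ f k j
    simp only [Linear.comp_smul, Finset.smul_sum]
  have : IsArtinianRing (End M) := isArtinian_of_tower ℂ inferInstance
  -- It remains to exclude a non-zero radical element `x`. A non-zero entry of `x` yields `y ≠ 0`
  -- with `yxy = y`, so that `yx` would be a non-zero idempotent in the radical.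
  rw [IsArtinianRing.isSemisimpleRing_iff_jacobson, eq_bot_iff]
  intro x hx
  by_contra hne
  obtain ⟨i, j, hij⟩ : ∃ i j, (x : ∀ i j, M.X i ⟶ M.X j) i j ≠ 0 := by
    by_contra hall
    push Not at hall
    exact hne (Mat_.hom_ext _ _ hall)
  obtain ⟨g, hg, hgf⟩ := hreg _ hij
  -- The matrix whose only entry is `g`, in the position transposed to that of the chosen entry of
  -- `x`.
  let y : End M := (fun a b => if h : j = a ∧ i = b then
    eqToHom (congrArg M.X h.1.symm) ≫ g ≫ eqToHom (congrArg M.X h.2) else 0 :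
      ∀ a b, M.X a ⟶ M.X b)
  have hyx : y * x * y = y := by
    apply Mat_.hom_ext
    intro a b
    change ∑ k, (y : ∀ a b, M.X a ⟶ M.X b) a k ≫ (∑ l, (x : ∀ a b, M.X a ⟶ M.X b) k l ≫
      (y : ∀ a b, M.X a ⟶ M.X b) l b) = (y : ∀ a b, M.X a ⟶ M.X b) a b
    rw [Finset.sum_eq_single i, Finset.sum_eq_single j]
    · by_cases ha : j = a
      · subst ha
        by_cases hb : i = b
        · subst hb
          simpa [y] using hgf
        · simp [y, hb]
      · simp [y, ha]
    · intro l _ hl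
      simp [y, hl.symm]
    · simp
    · intro k _ hk
      simp [y, hk.symm]
    · simp
  have hy : y ≠ 0 := by
    intro h
    apply hg
    have := congrArg (fun f : End M => (f : ∀ a b, M.X a ⟶ M.X b) j i) h
    have h0 : (y : ∀ a b, M.X a ⟶ M.X b) j i = 0 := this
    simpa [y] using h0
  rw [← Ideal.jacobson_bot, Ideal.mem_jacobson_iff] at hx
  -- As `x` is in the radical, `1 - yx` has a left inverse `z`; but `(1 - yx)y = 0`.
  obtain ⟨z, hz⟩ := hx (-y)
  rw [Ideal.mem_bot, sub_eq_zero] at hz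
  apply hy
  calc y = (z * -y * x + z) * y := by rw [hz, one_mul]
    _ = -(z * (y * x * y)) + z * y := by noncomm_ring
    _ = 0 := by rw [hyx, neg_add_cancel]

/-- Objects whose endomorphisms are scalars, without morphisms between different ones, such that
the identity of every object factors through sums of them. -/
structure IsSchurFamily (X : ℕ → C) : Prop where
  finite : ∀ A B : C, FiniteDimensional ℂ (A ⟶ B)
  id_ne_zero : ∀ k, 𝟙 (X k) ≠ 0
  scalar : ∀ k (f : X k ⟶ X k), ∃ z : ℂ, f = z • 𝟙 (X k)
  orthogonal : ∀ j k, j ≠ k → ∀ f : X j ⟶ X k, f = 0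
  generates : ∀ Y : C, 𝟙 Y ∈
    Submodule.span ℂ {x : Y ⟶ Y | ∃ (k : ℕ) (g : Y ⟶ X k) (h : X k ⟶ Y), x = g ≫ h}

namespace IsSchurFamily

variable {X : ℕ → C}

/-- The form in which `generates` is used: taking for `φ` the composition with a morphism reduces
its vanishing to a check on simple objects. -/
theorem map_id_eq_zero (hX : IsSchurFamily X) {V : Type*} [AddCommGroup V] [Module ℂ V] {Y : C}
    (φ : (Y ⟶ Y) →ₗ[ℂ] V)
    (h : ∀ k (g : Y ⟶ X k) (h : X k ⟶ Y), φ (g ≫ h) = 0) : φ (𝟙 Y) = 0 := by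
  have : Submodule.span ℂ {x : Y ⟶ Y | ∃ (k : ℕ) (g : Y ⟶ X k) (h : X k ⟶ Y), x = g ≫ h} ≤
      LinearMap.ker φ := by
    rw [Submodule.span_le]
    rintro _ ⟨k, g, h', rfl⟩
    exact h k g h'
  exact this (hX.generates Y)

/-- Writing `r = 𝟙 Y ≫ r` and expanding `𝟙 Y` through the family, each term contains some `v ≫ r`.
-/
theorem eq_zero_of_comp (hX : IsSchurFamily X) {Y Z : C} {r : Y ⟶ Z}
    (h : ∀ k (v : X k ⟶ Y), v ≫ r = 0) : r = 0 := by
  have := hX.map_id_eq_zero (Linear.rightComp ℂ Y r) (fun k g v => by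
    simp only [Linear.rightComp_apply, Category.assoc, h, Limits.comp_zero])
  simpa using this

/-- Non-degeneracy of the composition pairing. Expand `v = v ≫ 𝟙 Y` through the family: the terms
through `X l` with `l ≠ k` vanish by orthogonality, so if all `v ≫ w` were zero, `v` would be zero.
-/
theorem exists_dual (hX : IsSchurFamily X) {k : ℕ} {Y : C} {v : X k ⟶ Y} (hv : v ≠ 0) :
    ∃ w : Y ⟶ X k, v ≫ w ≠ 0 := by
  by_contra hall
  push Not at hall
  apply hv
  have := hX.map_id_eq_zero (Linear.leftComp ℂ Y v) (fun l g h => by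
    simp only [Linear.leftComp_apply]
    rw [← Category.assoc]
    by_cases e : k = l
    · subst e
      rw [hall g, Limits.zero_comp]
    · rw [hX.orthogonal k l e (v ≫ g), Limits.zero_comp])
  simpa using this

/-- Some `X k` detects `f`: there are `v` and `w` with `v ≫ f ≫ w` a non-zero scalar `z`, and then
`z⁻¹ • (w ≫ v)` works. -/
theorem regular (hX : IsSchurFamily X) {A B : C} {f : A ⟶ B} (hf : f ≠ 0) :
    ∃ g : B ⟶ A, g ≠ 0 ∧ g ≫ f ≫ g = g := by
  obtain ⟨k, v, hv⟩ : ∃ k, ∃ v : X k ⟶ A, v ≫ f ≠ 0 := by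
    by_contra hall
    push Not at hall
    exact hf (hX.eq_zero_of_comp hall)
  obtain ⟨w, hw⟩ := hX.exists_dual hv
  obtain ⟨z, hz⟩ := hX.scalar k ((v ≫ f) ≫ w)
  have hz0 : z ≠ 0 := by
    rintro rfl
    rw [zero_smul] at hz
    exact hw hz
  have hvw : v ≫ f ≫ w = z • 𝟙 _ := by rw [← hz, Category.assoc]
  refine ⟨z⁻¹ • (w ≫ v), ?_, ?_⟩
  · intro h
    have h0 : w ≫ v = 0 := by
      rcases smul_eq_zero.1 h with h | h
      · exact absurd h (inv_ne_zero hz0)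
      · exact h
    -- The square contains the factor `w ≫ v`, but it is also `z ^ 2` times an identity.
    have h1 : (v ≫ f ≫ w) ≫ (v ≫ f ≫ w) = 0 := by
      have : (v ≫ f ≫ w) ≫ (v ≫ f ≫ w) = v ≫ f ≫ (w ≫ v) ≫ f ≫ w := by
        simp only [Category.assoc]
      rw [this, h0, Limits.zero_comp, Limits.comp_zero, Limits.comp_zero]
    rw [hvw] at h1
    simp only [Linear.smul_comp, Category.id_comp, smul_smul] at h1
    rcases smul_eq_zero.1 h1 with h | h
    · exact mul_ne_zero hz0 hz0 h
    · exact hX.id_ne_zero k h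
  · have h1 : w ≫ v ≫ f ≫ w ≫ v = z • (w ≫ v) := by
      have : v ≫ f ≫ w ≫ v = (v ≫ f ≫ w) ≫ v := by simp only [Category.assoc]
      rw [this, hvw, Linear.smul_comp, Category.id_comp, Linear.comp_smul]
    simp only [Linear.smul_comp, Linear.comp_smul, Category.assoc, h1, smul_smul]
    congr 1
    field_simp

/-- Endomorphisms of a simple object are scalars. -/
noncomputable def scalarEquiv (hX : IsSchurFamily X) (k : ℕ) : ℂ ≃ₗ[ℂ] (X k ⟶ X k) :=
  LinearEquiv.ofBijective (LinearMap.toSpanSingleton ℂ _ (𝟙 (X k)))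
    ⟨fun x y h => by
      simpa [hX.id_ne_zero k] using (smul_left_injective ℂ (hX.id_ne_zero k)) h,
    fun f => by
      obtain ⟨z, hz⟩ := hX.scalar k f
      exact ⟨z, hz.symm⟩⟩

theorem scalarEquiv_apply (hX : IsSchurFamily X) (k : ℕ) (z : ℂ) : hX.scalarEquiv k z = z • 𝟙 (X k)
    := rfl

theorem finrank_hom (hX : IsSchurFamily X) (m k : ℕ) : Module.finrank ℂ (X m ⟶ X k)
    = if m = k then 1 else 0 := by
  split_ifs with h
  · subst h
    rw [← (hX.scalarEquiv m).finrank_eq, Module.finrank_self]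
  · have : Subsingleton (X m ⟶ X k) :=
      ⟨fun f g => by rw [hX.orthogonal m k h f, hX.orthogonal m k h g]⟩
    exact Module.finrank_zero_of_subsingleton

/-! ### Dual bases and decomposition into simple objects -/

/-- Bases of `Hom(X_k, Y)` have dual bases in `Hom(Y, X_k)`. -/
theorem exists_dual_basis (hX : IsSchurFamily X) {ι : Type*} [DecidableEq ι] {k : ℕ} {Y : C}
    (b : Module.Basis ι ℂ (X k ⟶ Y)) :
    ∃ w : ι → (Y ⟶ X k), ∀ i j, b j ≫ w i = if j = i then 𝟙 (X k) else 0 := by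
  have := hX.finite (X k) Y
  let B : (X k ⟶ Y) →ₗ[ℂ] (Y ⟶ X k) →ₗ[ℂ] ℂ :=
    (Linear.comp (X k) Y (X k)).compr₂ (hX.scalarEquiv k).symm.toLinearMap
  have hB : ∀ v w, B v w = (hX.scalarEquiv k).symm (v ≫ w) := fun v w => rfl
  have hinj : Function.Injective B := by
    rw [injective_iff_map_eq_zero]
    intro v hv
    by_contra hne
    obtain ⟨w, hw⟩ := hX.exists_dual hne
    apply hw
    have h0 : B v w = 0 := by rw [hv]; rfl
    rw [hB] at h0
    simpa using h0
  -- In finite dimension, non-degeneracy in the first variable makes every functional on `Hom(X_k,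
  -- Y)` a pairing with some `w`; the dual vectors represent the coordinate functionals.
  have hsurj := LinearMap.flip_surjective_iff₁.2 hinj
  choose w hw using fun i => hsurj (b.coord i)
  refine ⟨w, fun i j => ?_⟩
  have h := congrArg (fun φ => φ (b j)) (hw i)
  simp only [LinearMap.flip_apply, hB, Module.Basis.coord_apply, Module.Basis.repr_self] at h
  rw [LinearEquiv.symm_apply_eq, scalarEquiv_apply, Finsupp.single_apply] at h
  rw [h]
  split_ifs <;> simp

/-- `𝟙 Y` is a finite sum of morphisms through objects `X l`, and a non-zero `v : X k ⟶ Y` must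
survive one of them, which forces `l = k`. For the span induction the claim is stated for arbitrary
`x` in place of `𝟙 Y`. -/
theorem finite_support (hX : IsSchurFamily X) (Y : C) : {k : ℕ | ∃ v : X k ⟶ Y, v ≠ 0}.Finite := by
  have key : ∀ x ∈ Submodule.span ℂ {x : Y ⟶ Y | ∃ (k : ℕ) (g : Y ⟶ X k) (h : X k ⟶ Y),
      x = g ≫ h}, {k : ℕ | ∃ v : X k ⟶ Y, v ≫ x ≠ 0}.Finite := by
    intro x hx
    induction hx using Submodule.span_induction with
    | mem x hx =>
      obtain ⟨l, g, h, rfl⟩ := hx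
      refine (Set.finite_singleton l).subset ?_
      rintro k ⟨v, hv⟩
      by_contra e
      apply hv
      rw [← Category.assoc, hX.orthogonal k l e (v ≫ g), Limits.zero_comp]
    | zero => simp
    | add x y _ _ hx hy =>
      refine (hx.union hy).subset ?_
      rintro k ⟨v, hv⟩
      by_contra e
      simp only [Set.mem_union, Set.mem_ofPred_eq, not_or, not_exists, not_not] at e
      apply hv
      rw [Preadditive.comp_add, e.1, e.2, add_zero]
    | smul z x _ hx =>
      refine hx.subset ?_
      rintro k ⟨v, hv⟩
      refine ⟨v, fun e => hv ?_⟩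
      rw [Linear.comp_smul, e, smul_zero]
  simpa using key _ (hX.generates Y)

/-- Every object is a direct sum of objects of the family. -/
theorem exists_isDirectSum (hX : IsSchurFamily X) (Y : C) :
    ∃ (n : ℕ) (l : Fin n → ℕ), IsDirectSum Y (fun i => X (l i)) := by
  classical
  have hfin := hX.finite
  let S := (hX.finite_support Y).toFinset
  -- One summand `X k` for each vector of a basis of `Hom(X_k, Y)`.
  let ι := Σ k : S, Fin (Module.finrank ℂ (X k ⟶ Y))
  let b := fun k : ℕ => Module.finBasis ℂ (X k ⟶ Y)
  choose w hw using fun k => hX.exists_dual_basis (b k)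
  suffices h : IsDirectSum Y (fun p : ι => X p.1) from
    ⟨Fintype.card ι, fun i => ((Fintype.equivFin ι).symm i).1, h.reindex (Fintype.equivFin ι).symm⟩
  refine ⟨fun p => b p.1 p.2, fun p => w p.1 p.2, ?_, ?_, ?_⟩
  · rintro ⟨k, i⟩
    simp [hw]
  · rintro ⟨⟨k, hk⟩, i⟩ ⟨⟨l, hl⟩, j⟩ hne
    by_cases e : l = k
    · subst e
      have : j ≠ i := fun e => hne (by rw [e])
      simp [hw, this]
    · exact hX.orthogonal l k e _
  · rw [← sub_eq_zero]
    -- Completeness may be tested on morphisms from `X k`, where only summands of type `k`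
    -- contribute and expansion in a basis remains.
    apply hX.eq_zero_of_comp
    intro k v
    rw [Preadditive.comp_sub, sub_eq_zero, Category.comp_id]
    by_cases hk : k ∈ S
    · have : Linear.rightComp ℂ (X k) (∑ p : ι, w p.1 p.2 ≫ b p.1 p.2) = LinearMap.id := by
        apply (b k).ext
        intro i
        rw [Linear.rightComp_apply, Preadditive.comp_sum,
          Finset.sum_eq_single (⟨⟨k, hk⟩, i⟩ : ι)]
        · simp only
          rw [← Category.assoc, hw]
          simp
        · rintro ⟨⟨l, hl⟩, j⟩ _ hne
          rw [← Category.assoc]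
          by_cases e : k = l
          · subst e
            have : i ≠ j := fun e => hne (by rw [e])
            simp [hw, this]
          · rw [hX.orthogonal k l e (b k i ≫ w l j), Limits.zero_comp]
        · simp
      exact congrArg (fun φ => φ v) this
    · have hv : v = 0 := by
        by_contra hv
        exact hk ((hX.finite_support Y).mem_toFinset.2 ⟨v, hv⟩)
      rw [hv, Limits.zero_comp]

theorem finrank_hom_isDirectSum (hX : IsSchurFamily X) {ι : Type*} [Fintype ι] {Y : C} {l : ι → ℕ}
    (h : IsDirectSum Y (fun i => X (l i))) (m : ℕ) :
    Module.finrank ℂ (X m ⟶ Y) = ∑ i, if m = l i then 1 else 0 := by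
  rw [h.finrank_hom hX.finite]
  exact Finset.sum_congr rfl fun i _ => hX.finrank_hom m (l i)

/-- An object is determined by the multiplicities of the simple objects. -/
theorem isDirectSum_of_finrank (hX : IsSchurFamily X) {κ : Type*} [Fintype κ] {Y : C} (l : κ → ℕ)
    (h : ∀ m, Module.finrank ℂ (X m ⟶ Y) = ∑ i, if m = l i then 1 else 0) :
    IsDirectSum Y (fun i => X (l i)) := by
  classical
  obtain ⟨n, l', hl'⟩ := hX.exists_isDirectSum Y
  have hcard : ∀ m, Fintype.card {i // l i = m} = Fintype.card {i // l' i = m} := by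
    intro m
    rw [Fintype.card_subtype, Fintype.card_subtype, Finset.card_filter, Finset.card_filter]
    have := (h m).symm.trans (hX.finrank_hom_isDirectSum hl' m)
    simpa only [eq_comm] using this
  -- Both index families have the same number of indices over each `m`; bijections between these
  -- fibres glue to `e`.
  let e : κ ≃ Fin n := (Equiv.sigmaFiberEquiv l).symm.trans
    ((Equiv.sigmaCongrRight fun m => Fintype.equivOfCardEq (hcard m)).trans
      (Equiv.sigmaFiberEquiv l'))
  have he : l = fun i => l' (e i) := by
    funext i
    exact (Fintype.equivOfCardEq (hcard (l i)) ⟨i, rfl⟩).2.symm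
  rw [he]
  exact hl'.reindex e

end IsSchurFamily

end Abstract

/-! ### The linear structure of the idempotent completion -/

section Karoubi

open Idempotents

variable {C : Type*} [Category C] [Preadditive C] [Linear ℂ C]

instance (P Q : Karoubi C) : SMul ℂ (P ⟶ Q) where
  smul z f := ⟨z • f.f, by rw [Linear.smul_comp, Linear.comp_smul, f.comm]⟩

instance karoubiModule (P Q : Karoubi C) : Module ℂ (P ⟶ Q) :=
  Function.Injective.module ℂ (Karoubi.inclusionHom P Q)
    (fun f g h => Karoubi.hom_ext f g h) (fun _ _ => rfl)

instance : Linear ℂ (Karoubi C) where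
  homModule P Q := karoubiModule P Q
  smul_comp P Q R z f g := by
    apply Karoubi.hom_ext
    exact Linear.smul_comp _ _ _ _ _ _
  comp_smul P Q R f z g := by
    apply Karoubi.hom_ext
    exact Linear.comp_smul _ _ _ _ _ _

theorem karoubi_finiteDimensional (hfd : ∀ A B : C, FiniteDimensional ℂ (A ⟶ B))
    (P Q : Karoubi C) : FiniteDimensional ℂ (P ⟶ Q) := by
  have := hfd P.X Q.X
  let φ : (P ⟶ Q) →ₗ[ℂ] (P.X ⟶ Q.X) :=
    { toFun := fun f => f.f, map_add' := fun _ _ => rfl, map_smul' := fun _ _ => rfl }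
  exact FiniteDimensional.of_injective φ fun f g h => Karoubi.hom_ext f g h

end Karoubi

/-! ### Adding strands, caps and cups -/

namespace TLCat

variable {d : ℂ} {a b c : ℕ}

/-- Linear induction in categorical terms, so that the underlying finitely supported functions stay
hidden. -/
theorem hom_induction {p : ((⟨a⟩ : TLCat d) ⟶ ⟨b⟩) → Prop} (zero : p 0)
    (add : ∀ f g, p f → p g → p (f + g)) (smul : ∀ (z : ℂ) (D : Diagram a b), p (z • ofDiagram D))
    (f : (⟨a⟩ : TLCat d) ⟶ ⟨b⟩) : p f := by
  refine Finsupp.induction_linear (M := ℂ) (motive := p) f zero add fun D z => ?_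
  have h : (Finsupp.single D z : Diagram a b →₀ ℂ) = z • Finsupp.single D 1 := by
    rw [Finsupp.smul_single, smul_eq_mul, mul_one]
  rw [h]
  exact smul z D

theorem ofDiagram_comp (D : Diagram a b) (E : Diagram b c) :
    (ofDiagram D ≫ ofDiagram E : (⟨a⟩ : TLCat d) ⟶ ⟨c⟩) =
      d ^ loops D.rel E.rel • ofDiagram (D.comp E) := by
  have h := compLin_single d D E 1 1
  have h' : (Finsupp.single (D.comp E) (1 * 1 * d ^ loops D.rel E.rel) : Diagram a c →₀ ℂ) =
      d ^ loops D.rel E.rel • Finsupp.single (D.comp E) 1 := by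
    rw [Finsupp.smul_single, smul_eq_mul, mul_one, one_mul, mul_one]
  exact h.trans h'

theorem ofDiagram_one (a : ℕ) : (ofDiagram (Diagram.one a) : (⟨a⟩ : TLCat d) ⟶ ⟨a⟩) = 𝟙 _ := rfl

theorem tensorHom_ofDiagram {a' b' : ℕ} (D : Diagram a b) (E : Diagram a' b') :
    tensorHom (d := d) (A := ⟨a⟩) (B := ⟨b⟩) (A' := ⟨a'⟩) (B' := ⟨b'⟩) (ofDiagram D) (ofDiagram E) =
      ofDiagram (D.tensor E) := by
  have h := tensorLin_single D E 1 1
  rw [mul_one] at h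
  exact h

theorem add_tensorHom {A B A' B' : TLCat d} (f f' : A ⟶ B) (g : A' ⟶ B') :
    tensorHom (f + f') g = tensorHom f g + tensorHom f' g :=
  LinearMap.map_add₂ (tensorLin _ _ _ _) f f' g

theorem smul_tensorHom {A B A' B' : TLCat d} (z : ℂ) (f : A ⟶ B) (g : A' ⟶ B') :
    tensorHom (z • f) g = z • tensorHom f g :=
  LinearMap.map_smul₂ (tensorLin _ _ _ _) z f g

theorem zero_tensorHom {A B A' B' : TLCat d} (g : A' ⟶ B') :
    tensorHom (0 : A ⟶ B) g = 0 :=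
  LinearMap.map_zero₂ (tensorLin _ _ _ _) g

theorem tensorHom_add {A B A' B' : TLCat d} (f : A ⟶ B) (g g' : A' ⟶ B') :
    tensorHom f (g + g') = tensorHom f g + tensorHom f g' :=
  LinearMap.map_add (tensorLin _ _ _ _ f) g g'

theorem tensorHom_smul {A B A' B' : TLCat d} (z : ℂ) (f : A ⟶ B) (g : A' ⟶ B') :
    tensorHom f (z • g) = z • tensorHom f g :=
  LinearMap.map_smul (tensorLin _ _ _ _ f) z g

theorem tensorHom_zero {A B A' B' : TLCat d} (f : A ⟶ B) :
    tensorHom f (0 : A' ⟶ B') = 0 :=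
  LinearMap.map_zero (tensorLin _ _ _ _ f)

/-- The right unit is strict because `a + 0` reduces to `a`. -/
theorem tensorHom_id_zero (f : (⟨a⟩ : TLCat d) ⟶ ⟨b⟩) :
    (tensorHom f (𝟙 (⟨0⟩ : TLCat d)) : (⟨a⟩ : TLCat d) ⟶ ⟨b⟩) = f := by
  induction f using hom_induction with
  | zero => exact zero_tensorHom _
  | add f g hf hg => exact (add_tensorHom _ _ _).trans (congrArg₂ (· + ·) hf hg)
  | smul z D =>
    refine (smul_tensorHom _ _ _).trans (congrArg (z • ·) ?_)
    exact (tensorHom_ofDiagram D (Diagram.one 0)).trans (congrArg _ D.tensor_one_zero)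

/-- Adding a vertical line on the right. -/
noncomputable def addStrand (f : (⟨a⟩ : TLCat d) ⟶ ⟨b⟩) : (⟨a + 1⟩ : TLCat d) ⟶ ⟨b + 1⟩ :=
  tensorHom f (𝟙 (⟨1⟩ : TLCat d))

theorem addStrand_ofDiagram (D : Diagram a b) :
    addStrand (ofDiagram D : (⟨a⟩ : TLCat d) ⟶ ⟨b⟩) = ofDiagram (D.tensor (Diagram.one 1)) :=
  tensorHom_ofDiagram D (Diagram.one 1)

theorem addStrand_id (a : ℕ) : addStrand (𝟙 (⟨a⟩ : TLCat d)) = 𝟙 _ := tensorHom_id _ _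

theorem addStrand_comp (f : (⟨a⟩ : TLCat d) ⟶ ⟨b⟩) (g : (⟨b⟩ : TLCat d) ⟶ ⟨c⟩) :
    addStrand (f ≫ g) = addStrand f ≫ addStrand g := by
  have h := tensorHom_comp f g (𝟙 (⟨1⟩ : TLCat d)) (𝟙 _)
  rw [Category.comp_id] at h
  exact h

theorem addStrand_add (f g : (⟨a⟩ : TLCat d) ⟶ ⟨b⟩) :
    addStrand (f + g) = addStrand f + addStrand g := add_tensorHom _ _ _

theorem addStrand_smul (z : ℂ) (f : (⟨a⟩ : TLCat d) ⟶ ⟨b⟩) :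
    addStrand (z • f) = z • addStrand f := smul_tensorHom _ _ _

theorem addStrand_zero : addStrand (0 : (⟨a⟩ : TLCat d) ⟶ ⟨b⟩) = 0 := zero_tensorHom _

theorem addStrand_sub (f g : (⟨a⟩ : TLCat d) ⟶ ⟨b⟩) :
    addStrand (f - g) = addStrand f - addStrand g :=
  LinearMap.map_sub₂ (tensorLin _ _ _ _) f g _

/-- Bilinear extension of `Diagram.tensor_assoc_one`. For `f_j` and `f_k` it yields the
associativity behind the fusion recursion. -/
theorem addStrand_tensorHom {a' b' : ℕ} (f : (⟨a⟩ : TLCat d) ⟶ ⟨b⟩)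
    (g : (⟨a'⟩ : TLCat d) ⟶ ⟨b'⟩) :
    addStrand (a := a + a') (b := b + b') (tensorHom f g) =
      tensorHom (A' := ⟨a' + 1⟩) (B' := ⟨b' + 1⟩) f (addStrand g) := by
  induction f using hom_induction with
  | zero =>
    rw [zero_tensorHom, zero_tensorHom]
    exact addStrand_zero
  | add f f' hf hf' =>
    rw [add_tensorHom, add_tensorHom, ← hf, ← hf']
    exact addStrand_add _ _
  | smul z D =>
    rw [smul_tensorHom, smul_tensorHom]
    refine (addStrand_smul _ _).trans (congrArg (z • ·) ?_)
    induction g using hom_induction with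
    | zero =>
      rw [tensorHom_zero, addStrand_zero, tensorHom_zero]
      exact addStrand_zero
    | add f f' hf hf' =>
      rw [tensorHom_add, addStrand_add, tensorHom_add, ← hf, ← hf']
      exact addStrand_add _ _
    | smul w E =>
      rw [tensorHom_smul, addStrand_smul, tensorHom_smul]
      refine (addStrand_smul _ _).trans (congrArg (w • ·) ?_)
      have h1 := congrArg (addStrand (d := d) (a := a + a') (b := b + b'))
        (tensorHom_ofDiagram D E)
      have h2 := congrArg (tensorHom (A' := ⟨a' + 1⟩) (B' := ⟨b' + 1⟩) (ofDiagram D))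
        (addStrand_ofDiagram (d := d) E)
      exact h1.trans ((addStrand_ofDiagram _).trans ((congrArg _ (D.tensor_assoc_one E)).trans
        ((tensorHom_ofDiagram D _).symm.trans h2.symm)))

theorem addStrand_addStrand (f : (⟨a⟩ : TLCat d) ⟶ ⟨b⟩) :
    addStrand (addStrand f) = tensorHom f (𝟙 (⟨2⟩ : TLCat d)) := by
  have h := addStrand_tensorHom f (𝟙 (⟨1⟩ : TLCat d))
  rw [addStrand_id] at h
  exact h

/-- Vertical lines followed on the right by a cap. -/
noncomputable def capHom (d : ℂ) (k : ℕ) : (⟨k + 2⟩ : TLCat d) ⟶ ⟨k⟩ :=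
  ofDiagram ((Diagram.one k).tensor Diagram.cap)

/-- Vertical lines followed on the right by a cup. -/
noncomputable def cupHom (d : ℂ) (k : ℕ) : (⟨k⟩ : TLCat d) ⟶ ⟨k + 2⟩ :=
  ofDiagram ((Diagram.one k).tensor Diagram.cup)

theorem cupHom_eq (k : ℕ) : cupHom d k =
    tensorHom (𝟙 (⟨k⟩ : TLCat d)) (ofDiagram Diagram.cup : (⟨0⟩ : TLCat d) ⟶ ⟨2⟩) :=
  (tensorHom_ofDiagram (Diagram.one k) Diagram.cup).symm

theorem capHom_eq (k : ℕ) : capHom d k =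
    tensorHom (𝟙 (⟨k⟩ : TLCat d)) (ofDiagram Diagram.cap : (⟨2⟩ : TLCat d) ⟶ ⟨0⟩) :=
  (tensorHom_ofDiagram (Diagram.one k) Diagram.cap).symm

/-- Both sides are `f ⊗ cup`, by the interchange law: a morphism slides past a cup placed to its
right. -/
theorem comp_cupHom (f : (⟨a⟩ : TLCat d) ⟶ ⟨b⟩) :
    f ≫ cupHom d b = cupHom d a ≫ addStrand (addStrand f) := by
  have h1 := tensorHom_comp f (𝟙 (⟨b⟩ : TLCat d)) (𝟙 (⟨0⟩ : TLCat d))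
    (ofDiagram Diagram.cup : (⟨0⟩ : TLCat d) ⟶ ⟨2⟩)
  have h2 := tensorHom_comp (𝟙 (⟨a⟩ : TLCat d)) f
    (ofDiagram Diagram.cup : (⟨0⟩ : TLCat d) ⟶ ⟨2⟩) (𝟙 (⟨2⟩ : TLCat d))
  rw [Category.comp_id, Category.id_comp] at h1 h2
  rw [addStrand_addStrand, cupHom_eq, cupHom_eq]
  have h3 := congrArg (fun g : (⟨a⟩ : TLCat d) ⟶ ⟨b⟩ => g ≫ cupHom d b) (tensorHom_id_zero f)
  simp only [cupHom_eq] at h3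
  exact h3.symm.trans (h1.symm.trans h2)

/-- Both sides are `f ⊗ cap`, again by interchange. -/
theorem capHom_comp (f : (⟨a⟩ : TLCat d) ⟶ ⟨b⟩) :
    capHom d a ≫ f = addStrand (addStrand f) ≫ capHom d b := by
  have h1 := tensorHom_comp (𝟙 (⟨a⟩ : TLCat d)) f
    (ofDiagram Diagram.cap : (⟨2⟩ : TLCat d) ⟶ ⟨0⟩) (𝟙 (⟨0⟩ : TLCat d))
  have h2 := tensorHom_comp f (𝟙 (⟨b⟩ : TLCat d)) (𝟙 (⟨2⟩ : TLCat d))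
    (ofDiagram Diagram.cap : (⟨2⟩ : TLCat d) ⟶ ⟨0⟩)
  rw [Category.comp_id, Category.id_comp] at h1 h2
  rw [addStrand_addStrand, capHom_eq, capHom_eq]
  have h3 := congrArg (fun g : (⟨a⟩ : TLCat d) ⟶ ⟨b⟩ => capHom d a ≫ g) (tensorHom_id_zero f)
  simp only [capHom_eq] at h3
  exact h3.symm.trans (h1.symm.trans h2)

theorem cupHom_capHom (k : ℕ) : cupHom d k ≫ capHom d k = d • 𝟙 _ := by
  have h := tensorHom_comp (𝟙 (⟨k⟩ : TLCat d)) (𝟙 _)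
    (ofDiagram Diagram.cup : (⟨0⟩ : TLCat d) ⟶ ⟨2⟩) (ofDiagram Diagram.cap)
  rw [Category.comp_id, ofDiagram_comp, Diagram.loops_cup_cap, Diagram.cup_comp_cap, pow_one,
    tensorHom_smul, ofDiagram_one, tensorHom_id] at h
  rw [cupHom_eq, capHom_eq]
  exact h.symm

theorem elementary_eq (k : ℕ) : elementary k = capHom d k ≫ cupHom d k := by
  have h := tensorHom_comp (𝟙 (⟨k⟩ : TLCat d)) (𝟙 _)
    (ofDiagram Diagram.cap : (⟨2⟩ : TLCat d) ⟶ ⟨0⟩) (ofDiagram Diagram.cup)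
  rw [Category.comp_id, ofDiagram_comp, Diagram.loops_cap_cup, pow_zero, one_smul] at h
  rw [cupHom_eq, capHom_eq]
  exact (tensorHom_ofDiagram (Diagram.one k) _).symm.trans h

/-- This and the next straightening evaluate the partial trace of the correction term in Wenzl's
recursion. -/
theorem cupHom_addStrand_capHom (m : ℕ) :
    cupHom d (m + 1) ≫ addStrand (capHom d m) = 𝟙 _ := by
  rw [capHom, addStrand_ofDiagram]
  refine (ofDiagram_comp _ _).trans ?_
  have h := Diagram.zigzag_cup_cap m
  exact (congrArg₂ (fun (n : ℕ) D => d ^ n • (ofDiagram D : (⟨m + 1⟩ : TLCat d) ⟶ ⟨m + 1⟩))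
    h.2 h.1).trans (by rw [pow_zero, one_smul]; rfl)

theorem addStrand_cupHom_capHom (m : ℕ) :
    addStrand (cupHom d m) ≫ capHom d (m + 1) = 𝟙 _ := by
  rw [cupHom, addStrand_ofDiagram]
  refine (ofDiagram_comp _ _).trans ?_
  have h := Diagram.zigzag_cap_cup m
  exact (congrArg₂ (fun (n : ℕ) D => d ^ n • (ofDiagram D : (⟨m + 1⟩ : TLCat d) ⟶ ⟨m + 1⟩))
    h.2 h.1).trans (by rw [pow_zero, one_smul]; rfl)

theorem finiteDimensional_hom (A B : TLCat d) : FiniteDimensional ℂ (A ⟶ B) := by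
  exact inferInstanceAs (Module.Finite ℂ (Diagram A.strands B.strands →₀ ℂ))

end TLCat

/-! ### Quantum integers -/

section QuantumInt

variable {q : ℂ}

theorem quantumInt_zero : quantumInt q 0 = 0 := by simp [quantumInt]

theorem quantumInt_one : quantumInt q 1 = 1 := by simp [quantumInt]

theorem quantumInt_succ (hq : q ≠ 0) (n : ℕ) :
    quantumInt q (n + 1) = q * quantumInt q n + q ^ (-(n : ℤ)) := by
  unfold quantumInt
  rw [Finset.sum_range_succ, Finset.mul_sum]
  congr 1
  · refine Finset.sum_congr rfl fun i _ => ?_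
    rw [← zpow_one_add₀ hq]
    congr 1
    push_cast
    ring
  · congr 1
    push_cast
    ring

/-- With `d = [2]_q` as loop value, this is the recursion that the partial traces of the `f_k`
satisfy. -/
theorem quantumInt_add_two (hq : q ≠ 0) (n : ℕ) :
    quantumInt q (n + 2) = (q + q⁻¹) * quantumInt q (n + 1) - quantumInt q n := by
  rw [quantumInt_succ hq (n + 1), quantumInt_succ hq n]
  have h : q ^ (-((n + 1 : ℕ) : ℤ)) = q⁻¹ * q ^ (-(n : ℤ)) := by
    push_cast
    rw [neg_add, zpow_add₀ hq, zpow_neg_one, mul_comm]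
  rw [h]
  field_simp
  ring

theorem quantumInt_mul (hq : q ≠ 0) (n : ℕ) :
    quantumInt q n * (q - q⁻¹) = q ^ n - (q ^ n)⁻¹ := by
  induction n with
  | zero => simp [quantumInt_zero]
  | succ n ih =>
    rw [quantumInt_succ hq, add_mul, mul_assoc, ih, zpow_neg, zpow_natCast, pow_succ]
    field_simp
    ring

/-- If `q ^ 2 = 1`, all summands equal `q ^ n` and the sum is `(n + 1) * q ^ n`. Otherwise a zero
would give `q ^ (n + 1)` equal to its inverse, so that `q ^ 2` would be a proper root of unity. -/
theorem quantumInt_ne_zero (hq : q ≠ 0) (hroot : ∀ n : ℕ, 0 < n → (q ^ 2) ^ n = 1 → q ^ 2 = 1)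
    (n : ℕ) : quantumInt q (n + 1) ≠ 0 := by
  by_cases h1 : q ^ 2 = 1
  · have hterm : ∀ i : ℕ, q ^ (((n + 1 : ℕ) : ℤ) - 1 - 2 * i) = q ^ n := by
      intro i
      have e : ((n + 1 : ℕ) : ℤ) - 1 - 2 * i = n - (2 : ℕ) * i := by push_cast; ring
      rw [e, zpow_sub₀ hq, zpow_mul, zpow_natCast, zpow_natCast, zpow_natCast, h1, one_pow, div_one]
    unfold quantumInt
    simp only [hterm]
    rw [Finset.sum_const, Finset.card_range, nsmul_eq_mul]
    exact mul_ne_zero (by exact_mod_cast Nat.succ_ne_zero n) (pow_ne_zero _ hq)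
  · intro h
    have h2 := quantumInt_mul hq (n + 1)
    rw [h, zero_mul] at h2
    apply h1
    apply hroot (n + 1) (Nat.succ_pos n)
    have h3 : q ^ (n + 1) ≠ 0 := pow_ne_zero _ hq
    have h4 : q ^ (n + 1) = (q ^ (n + 1))⁻¹ := sub_eq_zero.1 h2.symm
    rw [← pow_mul, mul_comm, pow_mul, sq]
    nth_rewrite 2 [h4]
    exact mul_inv_cancel₀ h3

end QuantumInt

/-! ### Jones-Wenzl idempotents -/

section Wenzl

open TLCat

variable {q : ℂ}

theorem wenzl_succ (q : ℂ) (k : ℕ) : wenzl q (k + 2) = addStrand (wenzl q (k + 1)) -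
    (quantumInt q (k + 1) / quantumInt q (k + 2)) •
      (addStrand (wenzl q (k + 1)) ≫ capHom _ k ≫ cupHom _ k ≫ addStrand (wenzl q (k + 1))) := by
  have h : wenzl q (k + 2) = addStrand (wenzl q (k + 1)) -
    (quantumInt q (k + 1) / quantumInt q (k + 2)) •
      (addStrand (wenzl q (k + 1)) ≫ elementary k ≫ addStrand (wenzl q (k + 1))) := rfl
  rw [h, elementary_eq, Category.assoc]

/-- The properties of the Jones-Wenzl idempotents that are proved together by induction. -/
structure WenzlProps (q : ℂ) (k : ℕ) : Prop where
  idem : wenzl q (k + 1) ≫ wenzl q (k + 1) = wenzl q (k + 1)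
  comp_addStrand : wenzl q (k + 1) ≫ addStrand (wenzl q k) = wenzl q (k + 1)
  addStrand_comp : addStrand (wenzl q k) ≫ wenzl q (k + 1) = wenzl q (k + 1)
  trace : cupHom _ k ≫ addStrand (wenzl q (k + 1)) ≫ capHom _ k =
    (quantumInt q (k + 2) / quantumInt q (k + 1)) • wenzl q k

/-- Slid through the cap, `f_k` becomes `f_k ⊗ 1 ⊗ 1` and is absorbed by `f_{k+1} ⊗ 1`. So this
composite already lands in `X_k`. -/
theorem addStrand_comp_addStrand_capHom {k : ℕ} (h : WenzlProps q k) :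
    addStrand (wenzl q (k + 1)) ≫ capHom _ k ≫ wenzl q k =
      addStrand (wenzl q (k + 1)) ≫ capHom _ k := by
  rw [capHom_comp, ← Category.assoc, ← TLCat.addStrand_comp, h.comp_addStrand]

theorem wenzl_comp_cupHom {k : ℕ} (h : WenzlProps q k) :
    wenzl q k ≫ cupHom _ k ≫ addStrand (wenzl q (k + 1)) =
      cupHom _ k ≫ addStrand (wenzl q (k + 1)) := by
  rw [← Category.assoc, comp_cupHom, Category.assoc, ← TLCat.addStrand_comp, h.addStrand_comp]

/-- On the correction term the cup creates the partial trace of `f_{k+1}`, that is `[k+2]/[k+1]`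
times `f_k`. The coefficient `[k+1]/[k+2]` of the recursion is chosen to cancel this scalar. -/
theorem cupHom_comp_wenzl (hn : ∀ n, quantumInt q (n + 1) ≠ 0) {k : ℕ} (h : WenzlProps q k) :
    cupHom _ k ≫ wenzl q (k + 2) = 0 := by
  have h1 : cupHom _ k ≫ addStrand (wenzl q (k + 1)) ≫ capHom _ k ≫ cupHom _ k ≫
      addStrand (wenzl q (k + 1)) = (quantumInt q (k + 2) / quantumInt q (k + 1)) •
        (cupHom _ k ≫ addStrand (wenzl q (k + 1))) := by
    conv_rhs => rw [← wenzl_comp_cupHom h, ← Linear.smul_comp, ← h.trace]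
    simp only [Category.assoc]
  rw [wenzl_succ, Preadditive.comp_sub, Linear.comp_smul, h1, smul_smul,
    div_mul_div_cancel₀ (hn _), div_self (hn _), one_smul, sub_self]

theorem wenzl_comp_capHom (hn : ∀ n, quantumInt q (n + 1) ≠ 0) {k : ℕ} (h : WenzlProps q k) :
    wenzl q (k + 2) ≫ capHom _ k = 0 := by
  have h1 : addStrand (wenzl q (k + 1)) ≫ capHom _ k ≫ cupHom _ k ≫
      addStrand (wenzl q (k + 1)) ≫ capHom _ k =
        (quantumInt q (k + 2) / quantumInt q (k + 1)) •
        (addStrand (wenzl q (k + 1)) ≫ capHom _ k) := by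
    rw [h.trace, Linear.comp_smul, Linear.comp_smul, addStrand_comp_addStrand_capHom h]
  rw [wenzl_succ, Preadditive.sub_comp, Linear.smul_comp]
  simp only [Category.assoc]
  rw [h1, smul_smul,
    div_mul_div_cancel₀ (hn _), div_self (hn _), one_smul, sub_self]

theorem wenzlProps (hq : q ≠ 0) (hn : ∀ n, quantumInt q (n + 1) ≠ 0) (k : ℕ) : WenzlProps q k := by
  induction k with
  | zero =>
    have h0 : wenzl q 0 = 𝟙 _ := rfl
    have h1 : wenzl q 1 = 𝟙 _ := rfl
    refine ⟨?_, ?_, ?_, ?_⟩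
    · change 𝟙 _ ≫ 𝟙 _ = 𝟙 _
      rw [Category.comp_id]
    · rw [h0, addStrand_id]
      exact Category.comp_id _
    · rw [h0, addStrand_id]
      exact Category.id_comp _
    -- The partial trace of one strand is a closed loop, of value `d = [2]/[1]`.
    · rw [h0, h1, addStrand_id, Category.id_comp, cupHom_capHom]
      congr 1
      rw [quantumInt_add_two hq, quantumInt_zero, zero_add, quantumInt_one, mul_one, sub_zero,
        div_one]
  | succ k h =>
    set c := quantumInt q (k + 1) / quantumInt q (k + 2) with hc
    set F := addStrand (wenzl q (k + 1)) with hF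
    have hFF : F ≫ F = F := by rw [hF, ← TLCat.addStrand_comp, h.idem]
    have hw := wenzl_succ q k
    rw [← hc, ← hF] at hw
    -- Both terms of the recursion begin and end with the idempotent `F`.
    have h1 : wenzl q (k + 2) ≫ F = wenzl q (k + 2) := by
      rw [hw, Preadditive.sub_comp, Linear.smul_comp]
      simp only [Category.assoc, hFF]
    have h2 : F ≫ wenzl q (k + 2) = wenzl q (k + 2) := by
      rw [hw, Preadditive.comp_sub, Linear.comp_smul, ← Category.assoc F F, hFF]
    refine ⟨?_, h1, h2, ?_⟩
    -- Only the second factor is expanded: the correction term then meets a cap that annihilates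
    -- `f_{k+2}`.
    · have h3 : wenzl q (k + 2) ≫ wenzl q (k + 2) = wenzl q (k + 2) ≫ F - c •
          ((wenzl q (k + 2) ≫ F) ≫ capHom _ k ≫ cupHom _ k ≫ F) := by
        nth_rewrite 2 [hw]
        rw [Preadditive.comp_sub, Linear.comp_smul, Category.assoc]
      rw [h3, h1, ← Category.assoc (wenzl q (k + 2)), wenzl_comp_capHom hn h, Limits.zero_comp,
        smul_zero, sub_zero]
    · rw [hw, addStrand_sub, addStrand_smul, Preadditive.sub_comp, Preadditive.comp_sub,
        Linear.smul_comp, Linear.comp_smul]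
      -- The last strand of `F` is a bare line, so closing it splits off a loop.
      have e1 : cupHom _ (k + 1) ≫ addStrand F ≫ capHom _ (k + 1) =
          (q + q⁻¹) • wenzl q (k + 1) := by
        rw [hF, ← capHom_comp, ← Category.assoc, cupHom_capHom, Linear.smul_comp,
          Category.id_comp]
      -- The two copies of `f_{k+1}` slide outwards past the closing arcs, and two snakes straighten
      -- between them.
      have e2 : cupHom _ (k + 1) ≫ addStrand (F ≫ capHom _ k ≫ cupHom _ k ≫ F) ≫
          capHom _ (k + 1) = wenzl q (k + 1) := by
        simp only [TLCat.addStrand_comp, Category.assoc]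
        rw [hF, ← capHom_comp, ← Category.assoc, ← comp_cupHom, Category.assoc,
          ← Category.assoc (cupHom _ (k + 1)), cupHom_addStrand_capHom, Category.id_comp,
          ← Category.assoc (addStrand (cupHom _ k)), addStrand_cupHom_capHom, Category.id_comp,
          h.idem]
      rw [e1, e2, ← sub_smul]
      congr 1
      -- The scalar is `d - [k+1]/[k+2] = [k+3]/[k+2]`.
      rw [quantumInt_add_two hq (k + 1), hc, sub_div, mul_div_assoc, div_self (hn _), mul_one]

/-! ### Non-vanishing, annihilation of hooks and Schur's lemma -/

theorem wenzl_idem (hq : q ≠ 0) (hn : ∀ n, quantumInt q (n + 1) ≠ 0) (k : ℕ) :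
    wenzl q k ≫ wenzl q k = wenzl q k := by
  rcases k with _ | k
  · change 𝟙 _ ≫ 𝟙 _ = 𝟙 _
    rw [Category.comp_id]
  · exact (wenzlProps hq hn k).idem

/-- Partial traces lead from `f_{k+1}` to a non-zero multiple of `f_k`, and finally to the empty
diagram. -/
theorem wenzl_ne_zero (hq : q ≠ 0) (hn : ∀ n, quantumInt q (n + 1) ≠ 0) (k : ℕ) :
    wenzl q k ≠ 0 := by
  induction k with
  | zero =>
    have h : (Finsupp.single (Diagram.one 0) 1 : Diagram 0 0 →₀ ℂ) ≠ 0 := by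
      rw [Ne, Finsupp.single_eq_zero]
      exact one_ne_zero
    exact h
  | succ k ih =>
    intro h
    have ht := (wenzlProps hq hn k).trace
    rw [h, addStrand_zero, Limits.zero_comp, Limits.comp_zero] at ht
    rcases smul_eq_zero.1 ht.symm with h0 | h0
    · exact div_ne_zero (hn _) (hn _) h0
    · exact ih h0

/-- In the last position the hook ends with a cup that annihilates the idempotent. Otherwise it acts
on all strands but the last, and meets the factor `f_n ⊗ 1` absorbed in `f_{n+1}`. -/
theorem hook_comp_wenzl (hq : q ≠ 0) (hn : ∀ n, quantumInt q (n + 1) ≠ 0) (i j : ℕ) :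
    ofDiagram (Diagram.hook i j) ≫ wenzl q (i + 2 + j) = 0 := by
  induction j with
  | zero =>
    change elementary i ≫ wenzl q (i + 2) = 0
    rw [elementary_eq, Category.assoc, cupHom_comp_wenzl hn (wenzlProps hq hn i), Limits.comp_zero]
  | succ j ih =>
    have h1 := (wenzlProps hq hn (i + 2 + j)).addStrand_comp
    have h2 := addStrand_ofDiagram (d := q + q⁻¹) (Diagram.hook i j)
    have h3 : addStrand (ofDiagram (Diagram.hook i j)) ≫ wenzl q (i + 2 + j + 1) = 0 := by
      rw [← h1, ← Category.assoc, ← TLCat.addStrand_comp, ih, addStrand_zero, Limits.zero_comp]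
    rw [h2] at h3
    exact h3

theorem wenzl_comp_hook (hq : q ≠ 0) (hn : ∀ n, quantumInt q (n + 1) ≠ 0) (i j : ℕ) :
    wenzl q (i + 2 + j) ≫ ofDiagram (Diagram.hook i j) = 0 := by
  induction j with
  | zero =>
    change wenzl q (i + 2) ≫ elementary i = 0
    rw [elementary_eq, ← Category.assoc, wenzl_comp_capHom hn (wenzlProps hq hn i),
      Limits.zero_comp]
  | succ j ih =>
    have h1 := (wenzlProps hq hn (i + 2 + j)).comp_addStrand
    have h2 := addStrand_ofDiagram (d := q + q⁻¹) (Diagram.hook i j)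
    have h3 : wenzl q (i + 2 + j + 1) ≫ addStrand (ofDiagram (Diagram.hook i j)) = 0 := by
      rw [← h1, Category.assoc, ← TLCat.addStrand_comp, ih, addStrand_zero, Limits.comp_zero]
    rw [h2] at h3
    exact h3

/-- The loop parameter does not vanish. -/
theorem loop_ne_zero (hq : q ≠ 0) (hn : ∀ n, quantumInt q (n + 1) ≠ 0) : q + q⁻¹ ≠ 0 := by
  have h := hn 1
  rwa [quantumInt_add_two hq, quantumInt_zero, zero_add, quantumInt_one, mul_one, sub_zero] at h

/-- Splitting off a hook leaves a closed loop behind; dividing by its value requires `d ≠ 0`. -/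
theorem ofDiagram_eq_smul_comp (hq : q ≠ 0) (hn : ∀ n, quantumInt q (n + 1) ≠ 0) {a b c : ℕ}
    (D : Diagram a b) (E : Diagram b c) :
    (ofDiagram (D.comp E) : (⟨a⟩ : TLCat (q + q⁻¹)) ⟶ ⟨c⟩) =
      ((q + q⁻¹) ^ loops D.rel E.rel)⁻¹ • (ofDiagram D ≫ ofDiagram E) := by
  rw [ofDiagram_comp, inv_smul_smul₀ (pow_ne_zero _ (loop_ne_zero hq hn))]

/-- An arc between neighbouring points of one edge lets a hook be split off next to `f_j` or `f_k`,
which annihilates it. -/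
theorem wenzl_comp_ofDiagram_comp_wenzl (hq : q ≠ 0) (hn : ∀ n, quantumInt q (n + 1) ≠ 0) {j k : ℕ}
    (D : Diagram j k) :
    wenzl q j ≫ ofDiagram D ≫ wenzl q k = 0 ∨ ∃ e : j = k, D = e ▸ Diagram.one j := by
  rcases D.trichotomy with ⟨i, l, rfl, h⟩ | ⟨i, l, rfl, h⟩ | h
  · left
    rw [← D.hook_comp h, ofDiagram_eq_smul_comp hq hn, Linear.smul_comp, Linear.comp_smul,
      Category.assoc, ← Category.assoc, wenzl_comp_hook hq hn, Limits.zero_comp, smul_zero]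
  · left
    rw [← D.comp_hook h, ofDiagram_eq_smul_comp hq hn, Linear.smul_comp, Linear.comp_smul,
      Category.assoc, hook_comp_wenzl hq hn, Limits.comp_zero, Limits.comp_zero, smul_zero]
  · exact Or.inr h

theorem wenzl_comp_comp_wenzl_of_ne (hq : q ≠ 0) (hn : ∀ n, quantumInt q (n + 1) ≠ 0) {j k : ℕ}
    (hjk : j ≠ k)
    (f : (⟨j⟩ : TLCat (q + q⁻¹)) ⟶ ⟨k⟩) : wenzl q j ≫ f ≫ wenzl q k = 0 := by
  induction f using hom_induction with
  | zero => rw [Limits.zero_comp, Limits.comp_zero]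
  | add f g hf hg => rw [Preadditive.add_comp, Preadditive.comp_add, hf, hg, add_zero]
  | smul z D =>
    rw [Linear.smul_comp, Linear.comp_smul]
    rcases wenzl_comp_ofDiagram_comp_wenzl hq hn D with h | ⟨e, _⟩
    · rw [h, smul_zero]
    · exact absurd e hjk

theorem wenzl_comp_comp_wenzl (hq : q ≠ 0) (hn : ∀ n, quantumInt q (n + 1) ≠ 0) {k : ℕ}
    (f : (⟨k⟩ : TLCat (q + q⁻¹)) ⟶ ⟨k⟩) :
    ∃ z : ℂ, wenzl q k ≫ f ≫ wenzl q k = z • wenzl q k := by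
  induction f using hom_induction with
  | zero => exact ⟨0, by rw [Limits.zero_comp, Limits.comp_zero, zero_smul]⟩
  | add f g hf hg =>
    obtain ⟨y, hy⟩ := hf
    obtain ⟨z, hz⟩ := hg
    exact ⟨y + z, by rw [Preadditive.add_comp, Preadditive.comp_add, hy, hz, add_smul]⟩
  | smul z D =>
    rw [Linear.smul_comp, Linear.comp_smul]
    rcases wenzl_comp_ofDiagram_comp_wenzl hq hn D with h | ⟨_, h⟩
    · exact ⟨0, by rw [h, smul_zero, zero_smul]⟩
    · refine ⟨z, ?_⟩
      have h' : D = Diagram.one k := h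
      rw [h', ofDiagram_one, Category.id_comp, wenzl_idem hq hn]

/-- The decomposition of `f_{k+1} ⊗ 1`. -/
theorem addStrand_wenzl (hq : q ≠ 0) (hn : ∀ n, quantumInt q (n + 1) ≠ 0) (k : ℕ) :
    addStrand (wenzl q (k + 1)) = wenzl q (k + 2) +
    (quantumInt q (k + 1) / quantumInt q (k + 2)) •
      ((addStrand (wenzl q (k + 1)) ≫ capHom _ k) ≫ wenzl q k ≫
        (cupHom _ k ≫ addStrand (wenzl q (k + 1)))) := by
  rw [wenzl_comp_cupHom (wenzlProps hq hn k), wenzl_succ, Category.assoc, sub_add_cancel]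

/-- The identities lie in the ideal generated by the Jones-Wenzl idempotents. -/
theorem id_mem_span_wenzl (hq : q ≠ 0) (hn : ∀ n, quantumInt q (n + 1) ≠ 0) (n : ℕ) :
    𝟙 (⟨n⟩ : TLCat (q + q⁻¹)) ∈ Submodule.span ℂ
    {x : (⟨n⟩ : TLCat (q + q⁻¹)) ⟶ ⟨n⟩ | ∃ (k : ℕ) (g : (⟨n⟩ : TLCat (q + q⁻¹)) ⟶ ⟨k⟩)
      (h : (⟨k⟩ : TLCat (q + q⁻¹)) ⟶ ⟨n⟩), x = g ≫ wenzl q k ≫ h} := by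
  induction n with
  | zero =>
    apply Submodule.subset_span
    refine ⟨0, 𝟙 _, 𝟙 _, ?_⟩
    change 𝟙 _ = 𝟙 _ ≫ 𝟙 _ ≫ 𝟙 _
    rw [Category.comp_id, Category.comp_id]
  | succ n ih =>
    -- Adding a strand preserves the ideal, because `f_{k+1} ⊗ 1` is `f_{k+2}` plus a term through
    -- `f_k`, and `f_0 ⊗ 1 = f_1`.
    have key : ∀ x ∈ Submodule.span ℂ {x : (⟨n⟩ : TLCat (q + q⁻¹)) ⟶ ⟨n⟩ |
        ∃ (k : ℕ) (g : (⟨n⟩ : TLCat (q + q⁻¹)) ⟶ ⟨k⟩) (h : (⟨k⟩ : TLCat (q + q⁻¹)) ⟶ ⟨n⟩),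
          x = g ≫ wenzl q k ≫ h}, addStrand x ∈ Submodule.span ℂ
        {x : (⟨n + 1⟩ : TLCat (q + q⁻¹)) ⟶ ⟨n + 1⟩ |
          ∃ (k : ℕ) (g : (⟨n + 1⟩ : TLCat (q + q⁻¹)) ⟶ ⟨k⟩)
            (h : (⟨k⟩ : TLCat (q + q⁻¹)) ⟶ ⟨n + 1⟩), x = g ≫ wenzl q k ≫ h} := by
      intro x hx
      induction hx using Submodule.span_induction with
      | mem x hx =>
        obtain ⟨k, g, h, rfl⟩ := hx
        rw [TLCat.addStrand_comp, TLCat.addStrand_comp]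
        rcases k with _ | k
        · apply Submodule.subset_span
          refine ⟨1, addStrand g, addStrand h, ?_⟩
          have h0 : addStrand (wenzl q 0) = wenzl q 1 := addStrand_id _
          rw [h0]
        · rw [addStrand_wenzl hq hn, Preadditive.add_comp, Preadditive.comp_add,
            Linear.smul_comp, Linear.comp_smul]
          apply Submodule.add_mem
          · exact Submodule.subset_span ⟨k + 2, _, _, rfl⟩
          · apply Submodule.smul_mem
            apply Submodule.subset_span
            refine ⟨k, addStrand g ≫ addStrand (wenzl q (k + 1)) ≫ capHom _ k,
              (cupHom _ k ≫ addStrand (wenzl q (k + 1))) ≫ addStrand h, ?_⟩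
            simp only [Category.assoc]
      | zero =>
        rw [addStrand_zero]
        exact Submodule.zero_mem _
      | add x y _ _ hx hy =>
        rw [addStrand_add]
        exact Submodule.add_mem _ hx hy
      | smul z x _ hx =>
        rw [addStrand_smul]
        exact Submodule.smul_mem _ _ hx
    have h := key _ ih
    rwa [addStrand_id] at h

end Wenzl

/-! ### Tensor products in the idempotent completion -/

section Fusion

open TLCat Idempotents

variable {d : ℂ}

/-- Where strand numbers agree by computation, unit and associativity laws become equalities of
objects, along which dimensions of Hom-spaces can be rewritten directly. -/
theorem karoubi_mk_eq {C : Type*} [Category C] {A : C} {p p' : A ⟶ A} (h : p ≫ p = p)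
    (h' : p' ≫ p' = p') (e : p = p') : (⟨A, p, h⟩ : Karoubi C) = ⟨A, p', h'⟩ := by
  subst e
  rfl

/-- The tensor product of morphisms of the idempotent completion. -/
noncomputable def karoubiTensorHom {P Q P' Q' : Karoubi (TLCat d)} (f : P ⟶ Q) (g : P' ⟶ Q') :
    karoubiTensor P P' ⟶ karoubiTensor Q Q' where
  f := tensorHom f.f g.f
  comm := by
    change tensorHom P.p P'.p ≫ tensorHom f.f g.f ≫ tensorHom Q.p Q'.p = tensorHom f.f g.f
    rw [← tensorHom_comp, ← tensorHom_comp, f.comm, g.comm]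

theorem karoubiTensorHom_id (P Q : Karoubi (TLCat d)) :
    karoubiTensorHom (𝟙 P) (𝟙 Q) = 𝟙 (karoubiTensor P Q) := rfl

theorem karoubiTensorHom_comp {P Q R P' Q' R' : Karoubi (TLCat d)} (f : P ⟶ Q) (g : Q ⟶ R)
    (f' : P' ⟶ Q') (g' : Q' ⟶ R') : karoubiTensorHom (f ≫ g) (f' ≫ g') =
      karoubiTensorHom f f' ≫ karoubiTensorHom g g' :=
  Karoubi.hom_ext _ _ (tensorHom_comp _ _ _ _)

/-- Tensoring with an object on the left. -/
noncomputable def karoubiTensorLeft (P : Karoubi (TLCat d)) {Q R : Karoubi (TLCat d)} :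
    (Q ⟶ R) →+ (karoubiTensor P Q ⟶ karoubiTensor P R) where
  toFun f := karoubiTensorHom (𝟙 P) f
  map_zero' := Karoubi.hom_ext _ _ (tensorHom_zero _)
  map_add' _ _ := Karoubi.hom_ext _ _ (tensorHom_add _ _ _)

/-- Tensoring with an object on the right. -/
noncomputable def karoubiTensorRight (P : Karoubi (TLCat d)) {Q R : Karoubi (TLCat d)} :
    (Q ⟶ R) →+ (karoubiTensor Q P ⟶ karoubiTensor R P) where
  toFun f := karoubiTensorHom f (𝟙 P)
  map_zero' := Karoubi.hom_ext _ _ (zero_tensorHom _)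
  map_add' _ _ := Karoubi.hom_ext _ _ (add_tensorHom _ _ _)

theorem karoubiTensorLeft_comp (P : Karoubi (TLCat d)) {Q R S : Karoubi (TLCat d)} (f : Q ⟶ R)
    (g : R ⟶ S) : karoubiTensorLeft P f ≫ karoubiTensorLeft P g = karoubiTensorLeft P (f ≫ g) := by
  have h := karoubiTensorHom_comp (𝟙 P) (𝟙 P) f g
  rw [Category.comp_id] at h
  exact h.symm

theorem karoubiTensorRight_comp (P : Karoubi (TLCat d)) {Q R S : Karoubi (TLCat d)} (f : Q ⟶ R)
    (g : R ⟶ S) :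
    karoubiTensorRight P f ≫ karoubiTensorRight P g = karoubiTensorRight P (f ≫ g) := by
  have h := karoubiTensorHom_comp f g (𝟙 P) (𝟙 P)
  rw [Category.comp_id] at h
  exact h.symm

theorem IsDirectSum.tensorLeft {ι : Type*} [Fintype ι] {A : Karoubi (TLCat d)}
    {B : ι → Karoubi (TLCat d)} (h : IsDirectSum A B) (P : Karoubi (TLCat d)) :
    IsDirectSum (karoubiTensor P A) (fun i => karoubiTensor P (B i)) := by
  obtain ⟨α, β, h1, h2, h3⟩ := h
  refine ⟨fun i => karoubiTensorLeft P (α i), fun i => karoubiTensorLeft P (β i), fun i => ?_,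
    fun i j hij => ?_, ?_⟩
  · rw [karoubiTensorLeft_comp, h1]
    exact karoubiTensorHom_id _ _
  · rw [karoubiTensorLeft_comp, h2 i j hij, map_zero]
  · simp only [karoubiTensorLeft_comp]
    rw [← map_sum, h3]
    exact karoubiTensorHom_id _ _

theorem IsDirectSum.tensorRight {ι : Type*} [Fintype ι] {A : Karoubi (TLCat d)}
    {B : ι → Karoubi (TLCat d)} (h : IsDirectSum A B) (P : Karoubi (TLCat d)) :
    IsDirectSum (karoubiTensor A P) (fun i => karoubiTensor (B i) P) := by
  obtain ⟨α, β, h1, h2, h3⟩ := h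
  refine ⟨fun i => karoubiTensorRight P (α i), fun i => karoubiTensorRight P (β i), fun i => ?_,
    fun i j hij => ?_, ?_⟩
  · rw [karoubiTensorRight_comp, h1]
    exact karoubiTensorHom_id _ _
  · rw [karoubiTensorRight_comp, h2 i j hij, map_zero]
  · simp only [karoubiTensorRight_comp]
    rw [← map_sum, h3]
    exact karoubiTensorHom_id _ _

/-! ### Simple objects and fusion multiplicities -/

variable {q : ℂ} (hq : q ≠ 0) (hn : ∀ n, quantumInt q (n + 1) ≠ 0)

/-- The simple object `X_k`, the image of the Jones-Wenzl idempotent `f_k`. -/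
noncomputable def simpleObj (k : ℕ) : Karoubi (TLCat (q + q⁻¹)) :=
  ⟨⟨k⟩, wenzl q k, wenzl_idem hq hn k⟩

theorem isSchurFamily_simpleObj : IsSchurFamily (simpleObj hq hn) where
  finite := karoubi_finiteDimensional finiteDimensional_hom
  id_ne_zero k h := wenzl_ne_zero hq hn k (congrArg Karoubi.Hom.f h)
  scalar k f := by
    obtain ⟨z, hz⟩ := wenzl_comp_comp_wenzl hq hn f.f
    exact ⟨z, Karoubi.hom_ext _ _ (f.comm.symm.trans hz)⟩
  orthogonal j k hjk f :=
    Karoubi.hom_ext _ _ (f.comm.symm.trans (wenzl_comp_comp_wenzl_of_ne hq hn hjk f.f))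
  generates Y := by
    -- Compression by the idempotent of `Y`: it carries identity to identity and `g ≫ f_k ≫ h` to a
    -- morphism through `X_k`.
    let φ : (Y.X ⟶ Y.X) →ₗ[ℂ] (Y ⟶ Y) :=
      { toFun := fun x => ⟨Y.p ≫ x ≫ Y.p, by
          simp only [Category.assoc, Y.idem]
          rw [← Category.assoc Y.p Y.p, Y.idem]⟩
        map_add' := fun x y => Karoubi.hom_ext _ _ (by
          change Y.p ≫ (x + y) ≫ Y.p = Y.p ≫ x ≫ Y.p + Y.p ≫ y ≫ Y.p
          rw [Preadditive.add_comp, Preadditive.comp_add])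
        map_smul' := fun z x => Karoubi.hom_ext _ _ (by
          change Y.p ≫ (z • x) ≫ Y.p = z • (Y.p ≫ x ≫ Y.p)
          rw [Linear.smul_comp, Linear.comp_smul]) }
    have hφ : φ (𝟙 Y.X) = 𝟙 Y := Karoubi.hom_ext _ _ (by
      change Y.p ≫ 𝟙 _ ≫ Y.p = Y.p
      rw [Category.id_comp, Y.idem])
    rw [← hφ]
    refine Submodule.span_le.2 ?_ (Submodule.apply_mem_span_image_of_mem_span φ
      (id_mem_span_wenzl hq hn Y.X.strands))
    rintro _ ⟨_, ⟨k, g, h, rfl⟩, rfl⟩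
    apply Submodule.subset_span
    have hf := wenzl_idem hq hn k
    refine ⟨k, ⟨Y.p ≫ g ≫ wenzl q k, ?_⟩, ⟨wenzl q k ≫ h ≫ Y.p, ?_⟩, ?_⟩
    · change Y.p ≫ (Y.p ≫ g ≫ wenzl q k) ≫ wenzl q k = Y.p ≫ g ≫ wenzl q k
      simp only [Category.assoc, hf]
      rw [← Category.assoc Y.p Y.p, Y.idem]
    · change wenzl q k ≫ (wenzl q k ≫ h ≫ Y.p) ≫ Y.p = wenzl q k ≫ h ≫ Y.p
      simp only [Category.assoc, Y.idem]
      rw [← Category.assoc (wenzl q k) (wenzl q k), hf]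
    · apply Karoubi.hom_ext
      change Y.p ≫ (g ≫ wenzl q k ≫ h) ≫ Y.p =
        (Y.p ≫ g ≫ wenzl q k) ≫ wenzl q k ≫ h ≫ Y.p
      simp only [Category.assoc]
      rw [← Category.assoc (wenzl q k) (wenzl q k), hf]

/-- The embedding into the idempotent completion is full and faithful, so the regularity property
proved there descends. -/
theorem isEssentiallySemisimple_tlCat (hq : q ≠ 0) (hn : ∀ n, quantumInt q (n + 1) ≠ 0) :
    IsEssentiallySemisimple (TLCat (q + q⁻¹)) := by
  refine isEssentiallySemisimple_of_regular finiteDimensional_hom fun {A B} f hf => ?_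
  have hf' : (toKaroubi _).map f ≠ 0 := fun h => hf (congrArg Karoubi.Hom.f h)
  obtain ⟨g, hg, hgf⟩ := (isSchurFamily_simpleObj hq hn).regular hf'
  exact ⟨g.f, fun h => hg (Karoubi.hom_ext _ _ h), congrArg Karoubi.Hom.f hgf⟩

theorem karoubiTensor_simpleObj_zero (j : ℕ) :
    karoubiTensor (simpleObj hq hn j) (simpleObj hq hn 0) = simpleObj hq hn j :=
  karoubi_mk_eq (A := (⟨j⟩ : TLCat (q + q⁻¹))) _ _ (tensorHom_id_zero (wenzl q j))

/-- The left unit is strict here because `0 + 1` evaluates to `1`; this case is all that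
`fusionMult_one` needs. -/
theorem karoubiTensor_zero_one :
    karoubiTensor (simpleObj hq hn 0) (simpleObj hq hn 1) = simpleObj hq hn 1 :=
  karoubi_mk_eq (A := (⟨1⟩ : TLCat (q + q⁻¹))) _ _ (tensorHom_id _ _)

theorem karoubiTensor_assoc_one (j k : ℕ) :
    karoubiTensor (karoubiTensor (simpleObj hq hn j) (simpleObj hq hn k)) (simpleObj hq hn 1) =
      karoubiTensor (simpleObj hq hn j)
        (karoubiTensor (simpleObj hq hn k) (simpleObj hq hn 1)) :=
  karoubi_mk_eq (A := (⟨j + k + 1⟩ : TLCat (q + q⁻¹))) _ _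
    (addStrand_tensorHom (wenzl q j) (wenzl q k))

/-- `X_{k+1} ⊗ X_1 ≅ X_{k+2} ⊕ X_k`. -/
theorem isDirectSum_tensor_one (k : ℕ) :
    IsDirectSum (karoubiTensor (simpleObj hq hn (k + 1)) (simpleObj hq hn 1))
      (fun b : Bool => simpleObj hq hn (bif b then k + 2 else k)) := by
  have h := wenzlProps hq hn k
  have h' := wenzlProps hq hn (k + 1)
  let F : (⟨k + 2⟩ : TLCat (q + q⁻¹)) ⟶ ⟨k + 2⟩ := addStrand (wenzl q (k + 1))
  let c := quantumInt q (k + 1) / quantumInt q (k + 2)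
  have hFF : F ≫ F = F := by rw [← TLCat.addStrand_comp, h.idem]
  let α1 : simpleObj hq hn (k + 2) ⟶ karoubiTensor (simpleObj hq hn (k + 1)) (simpleObj hq hn 1) :=
    ⟨wenzl q (k + 2), by
      change wenzl q (k + 2) ≫ wenzl q (k + 2) ≫ F = wenzl q (k + 2)
      rw [h'.comp_addStrand, h'.idem]⟩
  let β1 : karoubiTensor (simpleObj hq hn (k + 1)) (simpleObj hq hn 1) ⟶ simpleObj hq hn (k + 2) :=
    ⟨wenzl q (k + 2), by
      change F ≫ wenzl q (k + 2) ≫ wenzl q (k + 2) = wenzl q (k + 2)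
      rw [h'.idem, h'.addStrand_comp]⟩
  let α2 : simpleObj hq hn k ⟶ karoubiTensor (simpleObj hq hn (k + 1)) (simpleObj hq hn 1) :=
    ⟨cupHom _ k ≫ F, by
      change wenzl q k ≫ (cupHom _ k ≫ F) ≫ F = cupHom _ k ≫ F
      rw [Category.assoc, hFF, wenzl_comp_cupHom h]⟩
  let β2 : karoubiTensor (simpleObj hq hn (k + 1)) (simpleObj hq hn 1) ⟶ simpleObj hq hn k :=
    -- The factor `c` inverts the partial trace, so that `α2 ≫ β2` is the identity of `X_k`.
    ⟨c • (F ≫ capHom _ k), by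
      change F ≫ (c • (F ≫ capHom _ k)) ≫ wenzl q k = c • (F ≫ capHom _ k)
      rw [Linear.smul_comp, Linear.comp_smul, Category.assoc, addStrand_comp_addStrand_capHom h,
        ← Category.assoc, hFF]⟩
  have e11 : α1 ≫ β1 = 𝟙 _ := Karoubi.hom_ext _ _ h'.idem
  have e22 : α2 ≫ β2 = 𝟙 _ := Karoubi.hom_ext _ _ (by
    change (cupHom _ k ≫ F) ≫ (c • (F ≫ capHom _ k)) = wenzl q k
    rw [Linear.comp_smul, Category.assoc, ← Category.assoc F F, hFF, h.trace, smul_smul,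
      div_mul_div_cancel₀ (hn _), div_self (hn _), one_smul])
  have e12 : α1 ≫ β2 = 0 := Karoubi.hom_ext _ _ (by
    change wenzl q (k + 2) ≫ (c • (F ≫ capHom _ k)) = 0
    rw [Linear.comp_smul, ← Category.assoc, h'.comp_addStrand, wenzl_comp_capHom hn h, smul_zero])
  have e21 : α2 ≫ β1 = 0 := Karoubi.hom_ext _ _ (by
    change (cupHom _ k ≫ F) ≫ wenzl q (k + 2) = 0
    rw [Category.assoc, h'.addStrand_comp, cupHom_comp_wenzl hn h])
  -- This is Wenzl's recursion solved for `f_{k+1} ⊗ 1`.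
  have esum : β1 ≫ α1 + β2 ≫ α2 = 𝟙 _ := Karoubi.hom_ext _ _ (by
    change wenzl q (k + 2) ≫ wenzl q (k + 2) + (c • (F ≫ capHom _ k)) ≫ (cupHom _ k ≫ F) = F
    have := addStrand_wenzl hq hn k
    rw [wenzl_comp_cupHom h] at this
    rw [h'.idem, Linear.smul_comp]
    exact this.symm)
  refine ⟨fun b => match b with | true => α1 | false => α2,
    fun b => match b with | true => β1 | false => β2, ?_, ?_, ?_⟩
  · rintro (_ | _)
    · exact e22
    · exact e11
  · rintro (_ | _) (_ | _) hne
    · exact absurd rfl hne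
    · exact e12
    · exact e21
    · exact absurd rfl hne
  · rw [Fintype.sum_bool]
    exact esum

/-- The multiplicity of `X_m` in `X_j ⊗ X_k`. -/
noncomputable def fusionMult (j k m : ℕ) : ℕ :=
  Module.finrank ℂ (simpleObj hq hn m ⟶
    karoubiTensor (simpleObj hq hn j) (simpleObj hq hn k))

theorem fusionMult_zero (j m : ℕ) : fusionMult hq hn j 0 m = if m = j then 1 else 0 := by
  rw [fusionMult, karoubiTensor_simpleObj_zero]
  exact (isSchurFamily_simpleObj hq hn).finrank_hom m j

theorem fusionMult_one (j m : ℕ) : fusionMult hq hn j 1 m =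
    (if m = j + 1 then 1 else 0) + if m + 1 = j then 1 else 0 := by
  have hX := isSchurFamily_simpleObj hq hn
  rcases j with _ | j
  · rw [fusionMult, karoubiTensor_zero_one, hX.finrank_hom]
    simp
  · rw [fusionMult, hX.finrank_hom_isDirectSum (isDirectSum_tensor_one hq hn j), Fintype.sum_bool]
    simp

/-- Both sides count `X_m` in `X_j ⊗ X_{k+1} ⊗ X_1`. Bracketed to the right, the last two factors
split into `X_{k+2}` and `X_k`. Bracketed to the left, each `X_l` in `X_j ⊗ X_{k+1}` contributes
when `m = l + 1` or `m = l - 1`. The case `m = 0` guards the truncated subtraction. -/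
theorem fusionMult_add_two (j k m : ℕ) :
    fusionMult hq hn j (k + 2) m + fusionMult hq hn j k m =
      (if m = 0 then 0 else fusionMult hq hn j (k + 1) (m - 1)) +
        fusionMult hq hn j (k + 1) (m + 1) := by
  have hX := isSchurFamily_simpleObj hq hn
  have h1 := ((isDirectSum_tensor_one hq hn k).tensorLeft (simpleObj hq hn j)).finrank_hom
    hX.finite (simpleObj hq hn m)
  rw [Fintype.sum_bool, ← karoubiTensor_assoc_one] at h1
  obtain ⟨n, l, hl⟩ := hX.exists_isDirectSum
    (karoubiTensor (simpleObj hq hn j) (simpleObj hq hn (k + 1)))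
  have h2 := (hl.tensorRight (simpleObj hq hn 1)).finrank_hom hX.finite (simpleObj hq hn m)
  have h3 : ∀ m, fusionMult hq hn j (k + 1) m = ∑ i, if m = l i then 1 else 0 :=
    fun m => hX.finrank_hom_isDirectSum hl m
  have h4 : ∀ i, Module.finrank ℂ (simpleObj hq hn m ⟶
      karoubiTensor (simpleObj hq hn (l i)) (simpleObj hq hn 1)) =
      (if m = l i + 1 then 1 else 0) + if m + 1 = l i then 1 else 0 :=
    fun i => fusionMult_one hq hn (l i) m
  refine h1.symm.trans (h2.trans ?_)
  rw [Finset.sum_congr rfl fun i _ => h4 i, Finset.sum_add_distrib, h3, h3]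
  congr 1
  rcases m with _ | m <;> simp

/-- The triangle inequalities with the parity condition have the same values at `k = 0, 1` and
satisfy the same two-step recursion. -/
theorem fusionMult_eq (j k m : ℕ) : fusionMult hq hn j k m =
    if j ≤ m + k ∧ k ≤ m + j ∧ m ≤ j + k ∧ (j + k + m) % 2 = 0 then 1 else 0 := by
  induction k using Nat.twoStepInduction generalizing m with
  | zero =>
    rw [fusionMult_zero]
    congr 1
    exact propext ⟨by omega, by omega⟩
  | one =>
    rw [fusionMult_one]
    split_ifs <;> omega
  | more k h0 h1 =>
    have h := fusionMult_add_two hq hn j k m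
    rw [h0, h1, h1] at h
    split_ifs at h ⊢ <;> omega

/-- The Clebsch-Gordan rule. -/
theorem isDirectSum_tensor (j k : ℕ) :
    IsDirectSum (karoubiTensor (simpleObj hq hn j) (simpleObj hq hn k))
      (fun i : Fin (min j k + 1) => simpleObj hq hn (max j k - min j k + 2 * i)) := by
  apply (isSchurFamily_simpleObj hq hn).isDirectSum_of_finrank
    (fun i : Fin (min j k + 1) => max j k - min j k + 2 * (i : ℕ))
  intro m
  refine (fusionMult_eq hq hn j k m).trans ?_
  split_ifs with h
  -- The index is the solution `i` of `m = |j - k| + 2 * i`; `max j k - min j k` is `|j - k|`.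
  · rw [Finset.sum_eq_single (⟨(m - (max j k - min j k)) / 2, by omega⟩ : Fin (min j k + 1))]
    · rw [if_pos]
      simp only
      omega
    · intro i _ hi
      rw [if_neg]
      intro e
      apply hi
      apply Fin.ext
      simp only
      omega
    · simp
  · symm
    apply Finset.sum_eq_zero
    intro i _
    have := i.2
    rw [if_neg]
    omega

end Fusion

end TemperleyLieb

theorem mainTheorem2 (q : ℂ) (hq : q ≠ 0)
    (hroot : ∀ n : ℕ, 0 < n → (q ^ 2) ^ n = 1 → q ^ 2 = 1) :
    TemperleyLieb.IsEssentiallySemisimple (TemperleyLieb.TLCat (q + q⁻¹)) ∧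
    ∃ X : ℕ → Idempotents.Karoubi (TemperleyLieb.TLCat (q + q⁻¹)),
      (∀ k, ∃ h : TemperleyLieb.wenzl q k ≫ TemperleyLieb.wenzl q k = TemperleyLieb.wenzl q k,
        X k = ⟨⟨k⟩, TemperleyLieb.wenzl q k, h⟩) ∧
      (∀ k, 𝟙 (X k) ≠ 0 ∧ ∀ f : X k ⟶ X k, ∃ z : ℂ, f.f = z • (X k).p) ∧
      (∀ j k, j ≠ k → ∀ f : X j ⟶ X k, f = 0) ∧
      (∀ Y : Idempotents.Karoubi (TemperleyLieb.TLCat (q + q⁻¹)),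
        ∃ (n : ℕ) (l : Fin n → ℕ), TemperleyLieb.IsDirectSum Y (fun i => X (l i))) ∧
      ∀ j k, TemperleyLieb.IsDirectSum (TemperleyLieb.TLCat.karoubiTensor (X j) (X k))
        (fun i : Fin (min j k + 1) => X (max j k - min j k + 2 * i)) := by
  have hn := TemperleyLieb.quantumInt_ne_zero hq hroot
  have hX := TemperleyLieb.isSchurFamily_simpleObj hq hn
  refine ⟨TemperleyLieb.isEssentiallySemisimple_tlCat hq hn, TemperleyLieb.simpleObj hq hn,
    fun k => ⟨TemperleyLieb.wenzl_idem hq hn k, rfl⟩, fun k => ⟨hX.id_ne_zero k, fun f => ?_⟩,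
    hX.orthogonal, hX.exists_isDirectSum, TemperleyLieb.isDirectSum_tensor hq hn⟩
  obtain ⟨z, hz⟩ := hX.scalar k f
  exact ⟨z, congrArg Idempotents.Karoubi.Hom.f hz⟩
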